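/- **Definitions.** Let the finite alphabet be partitioned into call letters $A_c$, internal letters $A_i$ and return letters $A_r$. A deterministic visibly pushdown machine has a finite state set $Q$, an initial state $q_0$, a finite stack alphabet $\Gamma$ and total functions $\delta_c : Q\times A_c\to Q\times\Gamma$, $\delta_i : Q\times A_i\to Q$, $\delta_r : Q\times\Gamma\times A_r\to Q$. It starts with the empty stack. A call pushes the given symbol, an internal letter leaves the stack unchanged, and a return pops the top symbol. There is no transition for a return on the empty stack, so a word with an unmatched return has no run. A position of a run is a *step* if no later configuration of the run has a smaller stack height. A *stair Büchi DVPA* has in addition a set $F\subseteq Q$ and accepts an infinite word if in its run a state of $F$ occurs on infinitely many steps. A *parity DVPA* has in addition $\Omega:Q\to\mathbb N$ and accepts if the highest priority that occurs infinitely often in its run is even. Two automata are equivalent if they accept the same infinite words. Write $(p,\sigma)\xrightarrow{u}(q,\tau)$ if there is a run on the finite word $u$ between these configurations, $\xrightarrow[F]{u}$ if moreover a state of $F$ occurs on a step of this run, and $\xrightarrow[\notin F]{u}$ if none does; an omitted $u$ is existentially quantified, and $\bot$ denotes the empty stack. A minimally well-matched word is $cwr$ with $c\in A_c$, $r\in A_r$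 and $w$ well matched (possibly empty). For $p,p',q,q'\in Q\setminus F$ let $(p,p')\prec(q,q')$ if there are $p''\in Q$, stack contents $\sigma,\sigma'$ and words $u,z$ with $uz$ minimally well matched and $$(q,\bot)\xrightarrow[F]{u}(p,\sigma),\quad (p,\bot)\xrightarrow[\notin F]{}(p',\bot),\quad (p',\bot)\xrightarrow[\notin F]{}(p,\sigma'),$$ $$(p,\bot)\to(p'',\bot),\quad (p'',\sigma')\to(p'',\bot),\quad (p'',\sigma)\xrightarrow{z}(q',\bot).$$ Let $ht(q,q')$ be the length of a longest $\prec$-chain ending in $(q,q')$, that is, $ht(q,q')=\max(\{0\}\cup\{ht(p,p') : (p,p')\prec(q,q')\})+1$; let $h$ be the maximal height of a pair in $(Q\setminus F)^2$ ($h=0$ if there is none), and $m=|Q|^3+1$. For a stair Büchi DVPA $\mathcal A$ let $\mathcal A'$ be the following parity DVPA. Its states are the $(q,\chi,f)$ with $q\in Q$, $\chi:\{0,\dots,h\}\to\{0,\dots,m\}$, $f:\{0,\dots,h\}\to\{0,1\}$; the initial state is $(q_0,0,1)$; its stack symbols are the $[Z,s]$ with $Z\in\Gamma$ and $s$ a state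 of $\mathcal A'$. The first component simulates $\mathcal A$, and a call pushes $[Z,s]$, where $Z$ is the symbol pushed by $\mathcal A$ and $s$ the state of $\mathcal A'$ before the call. If the new state $q'$ of $\mathcal A$ is in $F$, the new counters and flags are $\chi'=0$, $f'=1$. If $q'\notin F$, let $(q_b,\chi_b,f_b)$ be the current state of $\mathcal A'$ for a call or an internal letter, and the state of $\mathcal A'$ stored in the popped symbol for a return. Then $\chi'(i)=(\chi_b(i)\bmod m)+1$ if counter $i$ is increased and $\chi'(i)=\chi_b(i)\bmod m$ otherwise; $f'(i)=f_b(i)$ if $\chi_b(i)<m$ and $f'(i)=0$ otherwise. A call or an internal letter increases exactly counter $0$; a return increases exactly the counters $i\le ht(q_b,q')$ if $q_b\notin F$, and none if $q_b\in F$. The priority of $(q,\chi,f)$ is $2d+1+f(d)$ for $d=\max\{i:\chi(i)=m\}$, and $0$ if there is no such $i$. **Theorem.** If a stair Büchi DVPA is equivalent to some parity DVPA, then such a parity DVPA can be effectively constructed from it. Precisely: there is a total computable function on finite descriptions (lists of the sizes, the initial state, the transition tables and the table of final states or of priorities) that maps the description of every stair Büchi DVPA $\mathcal A$ which is equivalent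 to some parity DVPA to the description of a parity DVPA over the same partitioned alphabet that is equivalent to $\mathcal A$. Moreover, whenever all states of such an $\mathcal A$ are reachable, the constructed automaton is, up to renaming of states and stack symbols, the automaton $\mathcal A'$; in particular $\mathcal A'$ is then equivalent to $\mathcal A$. -/

import Mathlib

open Filter

/-- Letters of a visibly pushdown alphabet with call letters `C`, internal letters `I` and return
letters `R`. -/
inductive Letter (C I R : Type) : Type
  | call (c : C) : Letter C I R
  | int (i : I) : Letter C I R
  | ret (r : R) : Letter C I R

/-- Well-matched finite words (the empty word is well matched). -/
inductive WellMatched {C I R : Type} : List (Letter C I R) → Prop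
  | nil : WellMatched []
  | int (i : I) : WellMatched [Letter.int i]
  | append (u v : List (Letter C I R)) :
      WellMatched u → WellMatched v → WellMatched (u ++ v)
  | nest (c : C) (w : List (Letter C I R)) (r : R) :
      WellMatched w → WellMatched (Letter.call c :: w ++ [Letter.ret r])

/-- Minimally well-matched words `c w r` with `w` well matched. -/
def MinWellMatched {C I R : Type} (x : List (Letter C I R)) : Prop :=
  ∃ (c : C) (w : List (Letter C I R)) (r : R),
    WellMatched w ∧ x = Letter.call c :: w ++ [Letter.ret r]

/-- A deterministic visibly pushdown machine with state set `Q` and stack alphabet `Γ`. The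
transition functions are total and do not depend on the topmost stack symbol, except that a return
consumes it. -/
structure DVPM (C I R Q Γ : Type) where
  init : Q
  call : Q → C → Q × Γ
  int : Q → I → Q
  ret : Q → Γ → R → Q

/-- A stair Büchi DVPA: a machine with a set of final states. -/
structure StairBuchiDVPA (C I R Q Γ : Type) extends DVPM C I R Q Γ where
  final : Finset Q

/-- A parity DVPA: a machine with a priority function. -/
structure ParityDVPA (C I R Q Γ : Type) extends DVPM C I R Q Γ where
  prio : Q → ℕ

namespace DVPM

variable {C I R Q Γ : Type}

/-- One transition. A configuration `(q, σ)` consists of a state and the stack content above the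
bottom symbol, topmost symbol first. There is no return transition on the empty stack. -/
inductive Trans (M : DVPM C I R Q Γ) :
    Q × List Γ → Letter C I R → Q × List Γ → Prop
  | call (q : Q) (σ : List Γ) (c : C) :
      Trans M (q, σ) (Letter.call c) ((M.call q c).1, (M.call q c).2 :: σ)
  | int (q : Q) (σ : List Γ) (i : I) :
      Trans M (q, σ) (Letter.int i) (M.int q i, σ)
  | ret (q : Q) (Z : Γ) (σ : List Γ) (r : R) :
      Trans M (q, Z :: σ) (Letter.ret r) (M.ret q Z r, σ)

/-- `ρ` is the (infinite) run of `M` on the infinite word `w`. -/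
def IsRun (M : DVPM C I R Q Γ) (w : ℕ → Letter C I R) (ρ : ℕ → Q × List Γ) : Prop :=
  ρ 0 = (M.init, []) ∧ ∀ n, M.Trans (ρ n) (w n) (ρ (n + 1))

/-- `ρ 0, …, ρ |u|` is a run of `M` on the finite word `u` from `s` to `t`. -/
def IsFinRun (M : DVPM C I R Q Γ) (u : List (Letter C I R)) (s t : Q × List Γ)
    (ρ : ℕ → Q × List Γ) : Prop :=
  ρ 0 = s ∧ ρ u.length = t ∧
    ∀ (n : ℕ) (hn : n < u.length), M.Trans (ρ n) u[n] (ρ (n + 1))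

/-- `M` has a run on `u` from `s` to `t`. -/
def Reach (M : DVPM C I R Q Γ) (u : List (Letter C I R)) (s t : Q × List Γ) : Prop :=
  ∃ ρ, M.IsFinRun u s t ρ

/-- A state is reachable if it occurs in a configuration reachable from the initial one. -/
def ReachableState (M : DVPM C I R Q Γ) (q : Q) : Prop :=
  ∃ u σ, M.Reach u (M.init, []) (q, σ)

end DVPM

/-- Position `n` of the infinite run `ρ` is a step. -/
def IsStep {Q Γ : Type} (ρ : ℕ → Q × List Γ) (n : ℕ) : Prop :=
  ∀ m, n ≤ m → (ρ n).2.length ≤ (ρ m).2.length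

/-- Position `n` of the finite run `ρ 0, …, ρ N` is a step of that run. -/
def IsFinStep {Q Γ : Type} (ρ : ℕ → Q × List Γ) (N n : ℕ) : Prop :=
  n ≤ N ∧ ∀ m, n ≤ m → m ≤ N → (ρ n).2.length ≤ (ρ m).2.length

/-- The language of a parity DVPA: the highest priority occurring infinitely often is even. -/
def ParityDVPA.lang {C I R Q Γ : Type} (B : ParityDVPA C I R Q Γ) : Set (ℕ → Letter C I R) :=
  {w | ∃ ρ, B.IsRun w ρ ∧
    ∃ p, IsGreatest {k | ∃ᶠ n in atTop, B.prio (ρ n).1 = k} p ∧ Even p}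

/-- Two parity DVPAs over the same alphabet that are equal up to renaming of states and stack
symbols. -/
def ParityDVPA.Isomorphic {C I R Q Γ Q' Γ' : Type}
    (B : ParityDVPA C I R Q Γ) (B' : ParityDVPA C I R Q' Γ') : Prop :=
  ∃ (e : Q ≃ Q') (g : Γ ≃ Γ'),
    e B.init = B'.init ∧
    (∀ q c, B'.call (e q) c = (e (B.call q c).1, g (B.call q c).2)) ∧
    (∀ q i, B'.int (e q) i = e (B.int q i)) ∧
    (∀ q Z r, B'.ret (e q) (g Z) r = e (B.ret q Z r)) ∧
    (∀ q, B'.prio (e q) = B.prio q)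

namespace StairBuchiDVPA

variable {C I R Q Γ : Type}

/-- The language of a stair Büchi DVPA: a final state occurs on infinitely many steps. -/
def lang (A : StairBuchiDVPA C I R Q Γ) : Set (ℕ → Letter C I R) :=
  {w | ∃ ρ, A.IsRun w ρ ∧ ∃ᶠ n in atTop, IsStep ρ n ∧ (ρ n).1 ∈ A.final}

/-- A run on `u` from `s` to `t` with a final state on at least one step. -/
def ReachF (A : StairBuchiDVPA C I R Q Γ) (u : List (Letter C I R)) (s t : Q × List Γ) : Prop :=
  ∃ ρ, A.IsFinRun u s t ρ ∧ ∃ n, IsFinStep ρ u.length n ∧ (ρ n).1 ∈ A.final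

/-- A run on `u` from `s` to `t` without a final state on a step. -/
def ReachNF (A : StairBuchiDVPA C I R Q Γ) (u : List (Letter C I R)) (s t : Q × List Γ) : Prop :=
  ∃ ρ, A.IsFinRun u s t ρ ∧ ∀ n, IsFinStep ρ u.length n → (ρ n).1 ∉ A.final

/-- The relation `(p, p') ≺ (q, q')` on pairs of non-final states. -/
def Prec (A : StairBuchiDVPA C I R Q Γ) (x y : Q × Q) : Prop :=
  x.1 ∉ A.final ∧ x.2 ∉ A.final ∧ y.1 ∉ A.final ∧ y.2 ∉ A.final ∧
  ∃ (p'' : Q) (σ σ' : List Γ) (u z : List (Letter C I R)),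
    A.ReachF u (y.1, []) (x.1, σ) ∧
    (∃ v, A.ReachNF v (x.1, []) (x.2, [])) ∧
    (∃ w, A.ReachNF w (x.2, []) (x.1, σ')) ∧
    (∃ v, A.Reach v (x.1, []) (p'', [])) ∧
    (∃ v, A.Reach v (p'', σ') (p'', [])) ∧
    A.Reach z (p'', σ) (y.2, []) ∧
    MinWellMatched (u ++ z)

/-- `A.HeightGE x n`: some chain `x₁ ≺ x₂ ≺ ⋯ ≺ xₙ = x` has `n` elements. -/
inductive HeightGE (A : StairBuchiDVPA C I R Q Γ) : Q × Q → ℕ → Prop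
  | one (x : Q × Q) : HeightGE A x 1
  | succ (x y : Q × Q) (n : ℕ) : A.Prec x y → HeightGE A x n → HeightGE A y (n + 1)

/-- The height of a pair: the length of a longest chain of `≺` ending in it, that is,
`ht y = max ({0} ∪ {ht x | x ≺ y}) + 1`, when the lengths of these chains are bounded. -/
noncomputable def ht (A : StairBuchiDVPA C I R Q Γ) (x : Q × Q) : ℕ :=
  sSup {n | A.HeightGE x n}

/-- The maximal height of a pair of non-final states (`0` if there is no such pair). -/
noncomputable def maxHt (A : StairBuchiDVPA C I R Q Γ) : ℕ :=
  sSup {n | ∃ x : Q × Q, x.1 ∉ A.final ∧ x.2 ∉ A.final ∧ n = A.ht x}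

/-- The bound `m = |Q|³ + 1` on the counters. -/
def bound (_A : StairBuchiDVPA C I R Q Γ) [Fintype Q] : ℕ := Fintype.card Q ^ 3 + 1

/-- States `(q, χ, f)` of the simulating parity DVPA, with counters
`χ : {0, …, h} → {0, …, m}` and flags `f : {0, …, h} → {0, 1}`. -/
abbrev SimState (A : StairBuchiDVPA C I R Q Γ) [Fintype Q] : Type :=
  Q × (Fin (A.maxHt + 1) → Fin (A.bound + 1)) × (Fin (A.maxHt + 1) → Fin 2)

/-- The counters and flags `(χ', f')` after a transition to the state `q'`, computed from `(χ, f)`,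
where `inc` is the set of counters to be increased. -/
noncomputable def update (A : StairBuchiDVPA C I R Q Γ) [Fintype Q] (q' : Q)
    (χ : Fin (A.maxHt + 1) → Fin (A.bound + 1)) (f : Fin (A.maxHt + 1) → Fin 2)
    (inc : Fin (A.maxHt + 1) → Prop) : A.SimState :=
  open Classical in
  if q' ∈ A.final then (q', fun _ => 0, fun _ => 1)
  else
    (q',
      fun i => ⟨(χ i : ℕ) % A.bound + (if inc i then 1 else 0), by
        have h : (χ i : ℕ) % A.bound < A.bound := Nat.mod_lt _ (Nat.succ_pos _)
        split_ifs <;> omega⟩,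
      fun i => if (χ i : ℕ) < A.bound then f i else 0)

/-- The priority of `(q, χ, f)`: it is `2 d + 1 + f d` for the largest `d` with `χ d = m`, and `0`
if there is no such `d`. -/
noncomputable def simPrio (A : StairBuchiDVPA C I R Q Γ) [Fintype Q] (s : A.SimState) : ℕ :=
  open Classical in
  if h : (Finset.univ.filter fun i => (s.2.1 i : ℕ) = A.bound).Nonempty then
    let d := (Finset.univ.filter fun i => (s.2.1 i : ℕ) = A.bound).max' h
    2 * (d : ℕ) + 1 + (s.2.2 d : ℕ)
  else 0

/-- The parity DVPA that simulates `A` together with counters and flags. It pushes the stack symbol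
of `A` together with its own current state. -/
noncomputable def sim (A : StairBuchiDVPA C I R Q Γ) [Fintype Q] :
    ParityDVPA C I R A.SimState (Γ × A.SimState) where
  init := (A.init, fun _ => 0, fun _ => 1)
  call s c := (A.update (A.call s.1 c).1 s.2.1 s.2.2 (fun i => i = 0), ((A.call s.1 c).2, s))
  int s a := A.update (A.int s.1 a) s.2.1 s.2.2 (fun i => i = 0)
  ret s Z r := A.update (A.ret s.1 Z.1 r) Z.2.2.1 Z.2.2.2
    (fun i => Z.2.1 ∉ A.final ∧ (i : ℕ) ≤ A.ht (Z.2.1, A.ret s.1 Z.1 r))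
  prio := A.simPrio

end StairBuchiDVPA

/-- The description of a machine: the sizes of its alphabets, state set and stack alphabet, the
initial state, and its transition tables. -/
def DVPM.encode {a b c n k : ℕ} (M : DVPM (Fin a) (Fin b) (Fin c) (Fin n) (Fin k)) : List ℕ :=
  [a, b, c, n, k, M.init.val] ++
  ((List.finRange n).flatMap fun q => (List.finRange a).flatMap fun x =>
    [(M.call q x).1.val, (M.call q x).2.val]) ++
  ((List.finRange n).flatMap fun q => (List.finRange b).map fun x => (M.int q x).val) ++
  ((List.finRange n).flatMap fun q => (List.finRange k).flatMap fun Z =>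
    (List.finRange c).map fun x => (M.ret q Z x).val)

/-- The description of a stair Büchi DVPA: its machine and the characteristic sequence of its set
of final states. -/
def StairBuchiDVPA.encode {a b c n k : ℕ}
    (A : StairBuchiDVPA (Fin a) (Fin b) (Fin c) (Fin n) (Fin k)) : List ℕ :=
  A.toDVPM.encode ++ (List.finRange n).map fun q => if q ∈ A.final then 1 else 0

/-- The description of a parity DVPA: its machine and the table of its priorities. -/
def ParityDVPA.encode {a b c n k : ℕ}
    (B : ParityDVPA (Fin a) (Fin b) (Fin c) (Fin n) (Fin k)) : List ℕ :=
  B.toDVPM.encode ++ (List.finRange n).map fun q => B.prio q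

/-! The parent of a position is the preceding position after a call or an internal letter, and the
matching call position after a return. The chain of parents of a position lists the steps of the
prefix ending there (`IsStair.parent`). Because a call stores the current state of the simulation on
the stack, counters and flags are always computed from those of the parent (`counterSim_parent`); a
final state on the chain resets them. Every increment concerns an initial segment of the counters,
so as long as flags are set lower counters are ahead of higher ones (`flagAt_mono`).

A relation `(p, p') ≺ (q, q')` describes a factor from `q` to `q'` that first passes a final state
on a step and then contains, at `p`, a loop through `p'` without final states on steps; the loop can
be repeated and undone again at `p''`. If a reachable pair were below itself, these two ingredients
could be nested without end: a factor from `q` to `q'` closes a rejecting loop at `q`, and together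
with the way up to the final state an accepting one, and every power of either loop can again be
completed to a factor from `q` to `q'`. An equivalent parity automaton that visits priority at least
`i` on a loop whose omega-power has the verdict opposite to the parity of `i` must visit a greater
priority on some power (`Visits.boost`). Alternating the two loops forces arbitrarily large
priorities, which is absurd (`not_prec_self`). Since `≺` is transitive, it is a strict order on the
pairs with reachable first component, and their heights are at most `|Q|²`.

If the run of the stair automaton is accepting, a recurring odd priority `2d+1` is impossible: the
cleared flag of counter `d` goes back to a position after the last final step at which that counter
was full with its flag set, and the priority there is even and greater (`mem_counterSim_lang`).

If the run is rejecting, suppose that the greatest recurring priority is even, `2d+2`. Counter `d`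
is then full with its flag set infinitely often, at steps or inside factors between consecutive
steps. If a final state lies on the chain inside such a factor, the `|Q|³+1` increments after it
contain two with equal states at the start, at the end and at the completion of the incremented
factor. They form a pumpable loop, so the pair of the surrounding factor has height greater than `d`
(`lt_rank_of_counterAt_eq_bound`), and counter `d+1` is increased at the steps. Otherwise the
increments of counter `d` inside the factor show that this counter is increased at the steps too. In
the first case, if recurrent, a priority of at least `2d+3` recurs; in the second the flag of `d` is
eventually cleared at all steps. Both are contradictions (`mem_lang_of_mem_counterSim_lang`).

For effectiveness, reachability, the ingredients of `≺` and the heights are least fixed points over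
finite sets. Each is expressed by quantifying over all subsets, coded as numbers, which is primitive
recursive (`least_iff`). The simulation is analysed for any rank function satisfying `IsRank`,
because away from reachable pairs the computed heights need not agree with `ht`. -/

/-! ### Heights of words -/

section Words

variable {C I R : Type}

/-- `Fits ℓ u`: a stack of height `ℓ` suffices to read `u`. -/
def Fits : ℕ → List (Letter C I R) → Prop
  | _, [] => True
  | ℓ, .call _ :: u => Fits (ℓ + 1) u
  | ℓ, .int _ :: u => Fits ℓ u
  | 0, .ret _ :: _ => False
  | ℓ + 1, .ret _ :: u => Fits ℓ u

/-- The stack height after reading `u` from the height `ℓ`. -/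
def endHeight : ℕ → List (Letter C I R) → ℕ
  | ℓ, [] => ℓ
  | ℓ, .call _ :: u => endHeight (ℓ + 1) u
  | ℓ, .int _ :: u => endHeight ℓ u
  | ℓ, .ret _ :: u => endHeight (ℓ - 1) u

theorem endHeight_append (ℓ : ℕ) (u v : List (Letter C I R)) :
    endHeight ℓ (u ++ v) = endHeight (endHeight ℓ u) v := by
  induction u generalizing ℓ with
  | nil => rfl
  | cons x u ih => cases x <;> simp [endHeight, ih]

theorem fits_append (ℓ : ℕ) (u v : List (Letter C I R)) :
    Fits ℓ (u ++ v) ↔ Fits ℓ u ∧ Fits (endHeight ℓ u) v := by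
  induction u generalizing ℓ with
  | nil => simp [Fits, endHeight]
  | cons x u ih =>
    cases x with
    | call c => simp [Fits, endHeight, ih]
    | int i => simp [Fits, endHeight, ih]
    | ret r => cases ℓ <;> simp [Fits, endHeight, ih]

theorem Fits.add {ℓ : ℕ} {u : List (Letter C I R)} (h : Fits ℓ u) (k : ℕ) :
    Fits (ℓ + k) u ∧ endHeight (ℓ + k) u = endHeight ℓ u + k := by
  induction u generalizing ℓ with
  | nil => simp [Fits, endHeight]
  | cons x u ih =>
    cases x with
    | call c => have := ih (ℓ := ℓ + 1) h; simpa [Fits, endHeight, Nat.add_right_comm] using this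
    | int i => exact ih (ℓ := ℓ) h
    | ret r =>
      cases ℓ with
      | zero => exact h.elim
      | succ ℓ =>
        have := ih (ℓ := ℓ) h
        rw [Nat.add_right_comm]
        simpa [Fits, endHeight] using this

theorem Fits.of_zero {u : List (Letter C I R)} (h : Fits 0 u) (k : ℕ) :
    Fits k u ∧ endHeight k u = endHeight 0 u + k := by
  simpa using h.add k

/-- A word that can be read from the height `ℓ + k` can be read from the height `k` if and only if
the height never drops below `ℓ`. -/
theorem fits_iff_le_endHeight {ℓ k : ℕ} {u : List (Letter C I R)} (h : Fits (ℓ + k) u) :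
    Fits k u ↔ ∀ j ≤ u.length, ℓ ≤ endHeight (ℓ + k) (u.take j) := by
  induction u generalizing k with
  | nil => simp [Fits, endHeight]
  | cons x u ih =>
    have key : (∀ j ≤ (x :: u).length, ℓ ≤ endHeight (ℓ + k) ((x :: u).take j)) ↔
        ∀ j ≤ u.length, ℓ ≤ endHeight (ℓ + k) (x :: u.take j) := by
      constructor
      · intro H j hj
        simpa using H (j + 1) (by simpa using hj)
      · intro H j hj
        cases j with
        | zero => simp [endHeight]
        | succ j => simpa using H j (by simpa using hj)
    rw [key]
    cases x with
    | call c => exact ih (k := k + 1) h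
    | int i => exact ih (k := k) h
    | ret r =>
      cases k with
      | zero =>
        refine iff_of_false (fun h => h) fun H => ?_
        have := H 0 (Nat.zero_le _)
        cases ℓ with
        | zero => exact h
        | succ ℓ => simp [endHeight] at this
      | succ k =>
        have := ih (k := k) h
        simpa [Fits, endHeight] using this

theorem WellMatched.fits {u : List (Letter C I R)} (h : WellMatched u) :
    Fits 0 u ∧ endHeight 0 u = 0 := by
  induction h with
  | nil => simp [Fits, endHeight]
  | int i => simp [Fits, endHeight]
  | append u v _ _ hu hv => simp [fits_append, endHeight_append, hu, hv]
  | nest c w r _ hw =>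
    have := hw.1.of_zero 1
    simp [Fits, endHeight, fits_append, endHeight_append, this, hw]

end Words

/-! ### Deterministic runs -/

namespace DVPM

variable {C I R Q Γ : Type}

/-- The successor configuration; a return on the empty stack is ignored. -/
def next (M : DVPM C I R Q Γ) : Q × List Γ → Letter C I R → Q × List Γ
  | (q, σ), .call c => ((M.call q c).1, (M.call q c).2 :: σ)
  | (q, σ), .int i => (M.int q i, σ)
  | (q, []), .ret _ => (q, [])
  | (q, Z :: σ), .ret r => (M.ret q Z r, σ)

/-- The configuration after reading a word. -/
def runOn (M : DVPM C I R Q Γ) (s : Q × List Γ) (u : List (Letter C I R)) : Q × List Γ :=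
  u.foldl M.next s

@[simp] theorem runOn_nil (M : DVPM C I R Q Γ) (s : Q × List Γ) : M.runOn s [] = s := rfl

@[simp] theorem runOn_cons (M : DVPM C I R Q Γ) (s : Q × List Γ) (x : Letter C I R)
    (u : List (Letter C I R)) : M.runOn s (x :: u) = M.runOn (M.next s x) u := rfl

theorem runOn_append (M : DVPM C I R Q Γ) (s : Q × List Γ) (u v : List (Letter C I R)) :
    M.runOn s (u ++ v) = M.runOn (M.runOn s u) v := List.foldl_append

theorem trans_iff (M : DVPM C I R Q Γ) (s t : Q × List Γ) (x : Letter C I R) :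
    M.Trans s x t ↔ Fits s.2.length [x] ∧ M.next s x = t := by
  constructor
  · rintro (_ | _ | _) <;> simp [Fits, next]
  · rintro ⟨h, rfl⟩
    obtain ⟨q, σ⟩ := s
    cases x with
    | call c => exact .call q σ c
    | int i => exact .int q σ i
    | ret r =>
      cases σ with
      | nil => exact h.elim
      | cons Z σ => exact .ret q Z σ r

theorem length_next (M : DVPM C I R Q Γ) (s : Q × List Γ) (x : Letter C I R) :
    (M.next s x).2.length = endHeight s.2.length [x] := by
  obtain ⟨q, σ⟩ := s
  cases x with
  | call c => rfl
  | int i => rfl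
  | ret r => cases σ <;> rfl

theorem length_runOn (M : DVPM C I R Q Γ) (s : Q × List Γ) (u : List (Letter C I R)) :
    (M.runOn s u).2.length = endHeight s.2.length u := by
  induction u generalizing s with
  | nil => rfl
  | cons x u ih =>
    rw [runOn_cons, ih, length_next, ← endHeight_append]; rfl

theorem next_frame (M : DVPM C I R Q Γ) (q : Q) (σ τ : List Γ) (x : Letter C I R)
    (h : Fits σ.length [x]) :
    M.next (q, σ ++ τ) x = ((M.next (q, σ) x).1, (M.next (q, σ) x).2 ++ τ) := by
  cases x with
  | call c => rfl
  | int i => rfl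
  | ret r =>
    cases σ with
    | nil => exact h.elim
    | cons Z σ => rfl

theorem runOn_frame (M : DVPM C I R Q Γ) (q : Q) (σ τ : List Γ) (u : List (Letter C I R))
    (h : Fits σ.length u) :
    M.runOn (q, σ ++ τ) u = ((M.runOn (q, σ) u).1, (M.runOn (q, σ) u).2 ++ τ) := by
  induction u generalizing q σ with
  | nil => rfl
  | cons x u ih =>
    have h' := (fits_append σ.length [x] u).1 h
    rw [runOn_cons, runOn_cons, next_frame M q σ τ x h'.1]
    exact ih _ _ (by rw [length_next]; exact h'.2)

/-- By determinism a run is the sequence of configurations reached on the prefixes. Questions about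
runs thus become questions about the function `runOn` and the purely letter-based condition `Fits`.
-/
theorem isFinRun_iff (M : DVPM C I R Q Γ) (u : List (Letter C I R)) (s t : Q × List Γ)
    (ρ : ℕ → Q × List Γ) :
    M.IsFinRun u s t ρ ↔
      Fits s.2.length u ∧ M.runOn s u = t ∧ ∀ n ≤ u.length, ρ n = M.runOn s (u.take n) := by
  constructor
  · rintro ⟨h0, hl, ht⟩
    have key : ∀ n ≤ u.length, Fits s.2.length (u.take n) ∧ ρ n = M.runOn s (u.take n) := by
      intro n
      induction n with
      | zero => simp [Fits, h0]
      | succ n ih =>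
        intro hn
        obtain ⟨h1, h2⟩ := ih (by omega)
        obtain ⟨h3, h4⟩ := (M.trans_iff _ _ _).1 (ht n hn)
        have e : u.take (n + 1) = u.take n ++ [u[n]] := by simp
        rw [e, fits_append, runOn_append, ← h2, ← h4]
        refine ⟨⟨h1, ?_⟩, rfl⟩
        rwa [h2, length_runOn] at h3
    have hU := key u.length le_rfl
    rw [List.take_length] at hU
    exact ⟨hU.1, by rw [← hU.2, hl], fun n hn => (key n hn).2⟩
  · rintro ⟨hf, rfl, h⟩
    refine ⟨by simpa using h 0 (Nat.zero_le _), by simpa using h u.length le_rfl, fun n hn => ?_⟩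
    rw [trans_iff, h n hn.le, h (n + 1) hn]
    have e : u.take (n + 1) = u.take n ++ [u[n]] := by simp
    rw [e, runOn_append, length_runOn]
    refine ⟨?_, rfl⟩
    have e2 : u = u.take n ++ [u[n]] ++ u.drop (n + 1) := by rw [← e]; simp
    rw [e2, fits_append, fits_append] at hf
    exact hf.1.2

theorem reach_iff (M : DVPM C I R Q Γ) (u : List (Letter C I R)) (s t : Q × List Γ) :
    M.Reach u s t ↔ Fits s.2.length u ∧ M.runOn s u = t := by
  constructor
  · rintro ⟨ρ, h⟩
    have := (M.isFinRun_iff _ _ _ _).1 h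
    exact ⟨this.1, this.2.1⟩
  · rintro ⟨h1, h2⟩
    exact ⟨fun n => M.runOn s (u.take n), (M.isFinRun_iff _ _ _ _).2 ⟨h1, h2, fun _ _ => rfl⟩⟩

theorem Reach.append {M : DVPM C I R Q Γ} {u v : List (Letter C I R)} {s t z : Q × List Γ}
    (h : M.Reach u s t) (h' : M.Reach v t z) : M.Reach (u ++ v) s z := by
  rw [reach_iff] at *
  obtain ⟨h1, rfl⟩ := h
  rw [length_runOn] at h'
  exact ⟨(fits_append _ _ _).2 ⟨h1, h'.1⟩, by rw [runOn_append, h'.2]⟩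

theorem Reach.frame {M : DVPM C I R Q Γ} {u : List (Letter C I R)} {p q : Q} {σ τ : List Γ}
    (h : M.Reach u (p, σ) (q, τ)) (υ : List Γ) : M.Reach u (p, σ ++ υ) (q, τ ++ υ) := by
  rw [reach_iff] at *
  refine ⟨by simpa using (h.1.add υ.length).1, ?_⟩
  rw [runOn_frame M _ _ _ _ h.1, h.2]

theorem Reach.det {M : DVPM C I R Q Γ} {u : List (Letter C I R)} {s t t' : Q × List Γ}
    (h : M.Reach u s t) (h' : M.Reach u s t') : t = t' := by
  rw [reach_iff] at *
  rw [← h.2, h'.2]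

theorem reach_ret (M : DVPM C I R Q Γ) (q : Q) (Z : Γ) (σ : List Γ) (r : R) :
    M.Reach [.ret r] (q, Z :: σ) (M.ret q Z r, σ) := by
  simp [reach_iff, Fits, next]

theorem reach_call (M : DVPM C I R Q Γ) (q : Q) (σ : List Γ) (c : C) :
    M.Reach [.call c] (q, σ) ((M.call q c).1, (M.call q c).2 :: σ) := by
  simp [reach_iff, Fits, next]

/-- A word that can be read from the height of `σ` leads somewhere from every `(q, σ ++ τ)`, and the
part `τ` of the stack is untouched. -/
theorem Reach.unframe {M : DVPM C I R Q Γ} {u : List (Letter C I R)} {p q : Q} {σ τ τ' : List Γ}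
    (h : M.Reach u (p, σ ++ τ) (q, τ')) (hu : Fits σ.length u) :
    ∃ σ', τ' = σ' ++ τ ∧ M.Reach u (p, σ) (q, σ') := by
  rw [reach_iff, runOn_frame M _ _ _ _ hu] at h
  obtain ⟨-, h⟩ := h
  rw [Prod.mk.injEq] at h
  refine ⟨(M.runOn (p, σ) u).2, h.2.symm, ?_⟩
  rw [reach_iff, ← h.1]
  exact ⟨hu, rfl⟩

end DVPM

/-! ### Stairs -/

namespace StairBuchiDVPA

variable {C I R Q Γ : Type}

/-- `A.Stair p u q σ b`: the run on `u` leads from `(p, ⊥)` to `(q, σ)`, and `b` says whether a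
final state occurs on a step of this run. -/
inductive Stair (A : StairBuchiDVPA C I R Q Γ) :
    Q → List (Letter C I R) → Q → List Γ → Prop → Prop
  | nil (p : Q) : Stair A p [] p [] (p ∈ A.final)
  | int {p u q σ b} (i : I) : Stair A p u q σ b →
      Stair A p (u ++ [.int i]) (A.int q i) σ (b ∨ A.int q i ∈ A.final)
  | call {p u q σ b} (c : C) : Stair A p u q σ b →
      Stair A p (u ++ [.call c]) (A.call q c).1 ((A.call q c).2 :: σ)
        (b ∨ (A.call q c).1 ∈ A.final)
  -- The flag `b'` of the inner word is dropped: its positions lie above the height after the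
  -- return, so they are not steps of the longer word.
  | nest {p u q σ b v t b'} (c : C) (r : R) : Stair A p u q σ b →
      Stair A (A.call q c).1 v t [] b' →
      Stair A p (u ++ .call c :: (v ++ [.ret r])) (A.ret t (A.call q c).2 r) σ
        (b ∨ A.ret t (A.call q c).2 r ∈ A.final)

theorem Stair.reach {A : StairBuchiDVPA C I R Q Γ} {p u q σ b} (h : A.Stair p u q σ b) :
    A.Reach u (p, []) (q, σ) := by
  induction h with
  | nil p => simp [DVPM.reach_iff, Fits]
  | int i _ ih => exact ih.append (by simp [DVPM.reach_iff, Fits, DVPM.next])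
  | call c _ ih => exact ih.append (A.reach_call _ _ _)
  | nest c r _ _ ih ih' =>
    exact ih.append ((A.reach_call _ _ _).append ((ih'.frame _).append (A.reach_ret _ _ _ _)))

theorem Stair.fits {A : StairBuchiDVPA C I R Q Γ} {p u q σ b} (h : A.Stair p u q σ b) :
    Fits 0 u ∧ endHeight 0 u = σ.length := by
  have := h.reach
  rw [DVPM.reach_iff] at this
  refine ⟨this.1, ?_⟩
  have h2 := A.length_runOn (p, []) u
  rw [this.2] at h2
  exact h2.symm

/-- The topmost symbol stems from the last unmatched call. Cutting there is what lets a following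
return be absorbed by `nest`, and so shows in `exists_stair` that stairs cover all readable words.
-/
theorem Stair.split {A : StairBuchiDVPA C I R Q Γ} {p u q Z σ τ b} (h : A.Stair p u q τ b)
    (hτ : τ = Z :: σ) :
    ∃ u₁ c v q₁ b₁ b₂, u = u₁ ++ .call c :: v ∧ A.Stair p u₁ q₁ σ b₁ ∧
      Z = (A.call q₁ c).2 ∧ A.Stair (A.call q₁ c).1 v q [] b₂ := by
  induction h with
  | nil p => cases hτ
  | int i _ ih =>
    obtain ⟨u₁, c, v, q₁, b₁, b₂, rfl, h1, h2, h3⟩ := ih hτ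
    exact ⟨u₁, c, v ++ [.int i], q₁, b₁, _, by simp, h1, h2, h3.int i⟩
  | call c h ih =>
    cases hτ
    exact ⟨_, c, [], _, _, _, rfl, h, rfl, .nil _⟩
  | nest c r _ h' ih =>
    obtain ⟨u₁, c', v, q₁, b₁, b₂, rfl, h1, h2, h3⟩ := ih hτ
    exact ⟨u₁, c', _, q₁, b₁, _, by simp, h1, h2, h3.nest c r h'⟩

theorem exists_stair (A : StairBuchiDVPA C I R Q Γ) (p : Q) {u : List (Letter C I R)}
    (h : Fits 0 u) : ∃ q σ b, A.Stair p u q σ b := by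
  induction u using List.reverseRecOn with
  | nil => exact ⟨_, _, _, .nil p⟩
  | append_singleton u x ih =>
    obtain ⟨h1, h2⟩ := (fits_append _ _ _).1 h
    obtain ⟨q, σ, b, hs⟩ := ih h1
    cases x with
    | call c => exact ⟨_, _, _, hs.call c⟩
    | int i => exact ⟨_, _, _, hs.int i⟩
    | ret r =>
      rw [hs.fits.2] at h2
      cases σ with
      | nil => exact h2.elim
      | cons Z σ =>
        obtain ⟨u₁, c, v, q₁, b₁, b₂, rfl, h3, rfl, h4⟩ := hs.split rfl
        exact ⟨_, _, _, by simpa using h3.nest c r h4⟩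

theorem Stair.wellMatched {A : StairBuchiDVPA C I R Q Γ} {p u q σ b} (h : A.Stair p u q σ b)
    (hσ : σ = []) : WellMatched u := by
  induction h with
  | nil p => exact .nil
  | int i _ ih => exact .append _ _ (ih hσ) (.int i)
  | call c => cases hσ
  | nest c r _ _ ih ih' => exact .append _ _ (ih hσ) (.nest c _ r (ih' rfl))

/-- The flag of a stair says whether a final state occurs at a position after which the word can be
read from the empty stack. -/
theorem Stair.flag_iff {A : StairBuchiDVPA C I R Q Γ} {p u q σ b} (h : A.Stair p u q σ b) :
    b ↔ ∃ u₁ u₂, u = u₁ ++ u₂ ∧ Fits 0 u₂ ∧ (A.runOn (p, []) u₁).1 ∈ A.final := by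
  induction h with
  | nil p => simp [Fits]
  | @int p u q σ b i h ih =>
    have hr := (A.reach_iff _ _ _).1 (h.int i).reach
    constructor
    · rintro (hb | hb)
      · obtain ⟨u₁, u₂, rfl, h1, h2⟩ := ih.1 hb
        exact ⟨u₁, u₂ ++ [.int i], by simp, by simp [fits_append, h1, Fits], h2⟩
      · exact ⟨_, [], (List.append_nil _).symm, trivial, by rw [hr.2]; exact hb⟩
    · rintro ⟨u₁, u₂, he, h1, h2⟩
      rcases List.eq_nil_or_concat' u₂ with rfl | ⟨u₂, x, rfl⟩
      · right
        rw [List.append_nil] at he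
        rw [← he, hr.2] at h2
        exact h2
      · rw [← List.append_assoc] at he
        obtain ⟨rfl, -⟩ := List.append_inj' he rfl
        exact .inl (ih.2 ⟨u₁, u₂, rfl, ((fits_append _ _ _).1 h1).1, h2⟩)
  | @call p u q σ b c h ih =>
    have hr := (A.reach_iff _ _ _).1 (h.call c).reach
    constructor
    · rintro (hb | hb)
      · obtain ⟨u₁, u₂, rfl, h1, h2⟩ := ih.1 hb
        exact ⟨u₁, u₂ ++ [.call c], by simp, by simp [fits_append, h1, Fits], h2⟩
      · exact ⟨_, [], (List.append_nil _).symm, trivial, by rw [hr.2]; exact hb⟩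
    · rintro ⟨u₁, u₂, he, h1, h2⟩
      rcases List.eq_nil_or_concat' u₂ with rfl | ⟨u₂, x, rfl⟩
      · right
        rw [List.append_nil] at he
        rw [← he, hr.2] at h2
        exact h2
      · rw [← List.append_assoc] at he
        obtain ⟨rfl, -⟩ := List.append_inj' he rfl
        exact .inl (ih.2 ⟨u₁, u₂, rfl, ((fits_append _ _ _).1 h1).1, h2⟩)
  | @nest p u q σ b v t b' c r h h' ih _ =>
    have hr := (A.reach_iff _ _ _).1 (h.nest c r h').reach
    have hw := (WellMatched.nest c v r (h'.wellMatched rfl)).fits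
    constructor
    · rintro (hb | hb)
      · obtain ⟨u₁, u₂, rfl, h1, h2⟩ := ih.1 hb
        refine ⟨u₁, u₂ ++ .call c :: (v ++ [.ret r]), by simp, ?_, h2⟩
        exact (fits_append _ _ _).2 ⟨h1, (hw.1.of_zero _).1⟩
      · exact ⟨_, [], (List.append_nil _).symm, trivial, by rw [hr.2]; exact hb⟩
    · rintro ⟨u₁, u₂, he, h1, h2⟩
      rcases List.eq_nil_or_concat' u₂ with rfl | ⟨u₂, x, rfl⟩
      · right
        rw [List.append_nil] at he
        rw [← he, hr.2] at h2
        exact h2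
      · rw [← List.append_assoc, ← List.cons_append, ← List.append_assoc] at he
        obtain ⟨he', hx⟩ := List.append_inj' he rfl
        obtain rfl : Letter.ret r = x := by simpa using hx
        obtain ⟨h1, h3⟩ := (fits_append _ _ _).1 h1
        rcases List.append_eq_append_iff.1 he' with ⟨v₁, rfl, hv⟩ | ⟨v₁, rfl, hv⟩
        · cases v₁ with
          | nil => exact .inl (ih.2 ⟨u, [], by simp, trivial, by simpa using h2⟩)
          -- The position would lie strictly inside the factor. The rest of the inner word then ends
          -- at height zero, and the closing return does not fit.
          | cons x v₁ =>
            exfalso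
            obtain ⟨rfl, rfl⟩ := List.cons.inj hv
            have h4 : endHeight 0 (v₁ ++ u₂) = 0 := h'.fits.2
            rw [endHeight_append, (h1.of_zero _).2] at h4
            rw [show endHeight 0 u₂ = 0 by omega] at h3
            exact h3
        · refine .inl (ih.2 ⟨u₁, v₁, rfl, ?_, h2⟩)
          subst hv
          exact ((fits_append _ _ _).1 h1).1

theorem Stair.of_start {A : StairBuchiDVPA C I R Q Γ} {p u q σ b} (h : A.Stair p u q σ b)
    (hp : p ∈ A.final) : b :=
  h.flag_iff.2 ⟨[], u, rfl, h.fits.1, hp⟩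

theorem Stair.of_end {A : StairBuchiDVPA C I R Q Γ} {p u q σ b} (h : A.Stair p u q σ b)
    (hq : q ∈ A.final) : b := by
  refine h.flag_iff.2 ⟨u, [], (List.append_nil _).symm, trivial, ?_⟩
  rwa [((A.reach_iff _ _ _).1 h.reach).2]

theorem Stair.congr {A : StairBuchiDVPA C I R Q Γ} {p u q σ b b'} (h : A.Stair p u q σ b)
    (hb : b ↔ b') : A.Stair p u q σ b' := propext hb ▸ h

/-- The second word never goes below its starting height, so all steps of the first word remain
steps. -/
theorem Stair.append {A : StairBuchiDVPA C I R Q Γ} {p u q σ b v t τ b'}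
    (h : A.Stair p u q σ b) (h' : A.Stair q v t τ b') :
    A.Stair p (u ++ v) t (τ ++ σ) (b ∨ b') := by
  induction h' with
  | nil q => simpa using h.congr (or_iff_left_of_imp h.of_end).symm
  | int i _ ih => simpa [or_assoc] using (ih h).int i
  | call c _ ih => simpa [or_assoc] using (ih h).call c
  | nest c r _ h' ih => simpa [or_assoc] using (ih h).nest c r h'

theorem stair_of_reach {A : StairBuchiDVPA C I R Q Γ} {p u q σ} (h : A.Reach u (p, []) (q, σ)) :
    ∃ b, A.Stair p u q σ b := by
  obtain ⟨q', σ', b, hs⟩ := A.exists_stair p ((A.reach_iff _ _ _).1 h).1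
  obtain ⟨rfl, rfl⟩ := Prod.mk.inj (h.det hs.reach)
  exact ⟨b, hs⟩

/-- The height never drops below that of position `n` precisely when the rest of the word can be
read from the empty stack; this replaces configurations by words. -/
theorem isFinStep_iff {A : StairBuchiDVPA C I R Q Γ} {u : List (Letter C I R)} {p : Q}
    {t : Q × List Γ} {ρ : ℕ → Q × List Γ} (h : A.IsFinRun u (p, []) t ρ) {n : ℕ} :
    IsFinStep ρ u.length n ↔ n ≤ u.length ∧ Fits 0 (u.drop n) := by
  obtain ⟨hf, -, hρ⟩ := (A.isFinRun_iff _ _ _ _).1 h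
  refine and_congr_right fun hn => ?_
  have e : ∀ m ≤ u.length, (ρ m).2.length = endHeight 0 (u.take m) := fun m hm => by
    rw [hρ m hm, DVPM.length_runOn]; rfl
  have hf' : Fits (endHeight 0 (u.take n) + 0) (u.drop n) := by
    have := (fits_append 0 (u.take n) (u.drop n)).1 (by rw [List.take_append_drop]; exact hf)
    exact this.2
  have e2 : ∀ j, endHeight 0 (u.take (n + j)) =
      endHeight (endHeight 0 (u.take n) + 0) ((u.drop n).take j) := fun j => by
    rw [List.take_add, endHeight_append]; rfl
  rw [fits_iff_le_endHeight hf']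
  constructor
  · intro H j hj
    rw [List.length_drop] at hj
    rw [← e2, ← e n hn, ← e (n + j) (by omega)]
    exact H _ (by omega) (by omega)
  · intro H m hnm hm
    obtain ⟨j, rfl⟩ := Nat.exists_eq_add_of_le hnm
    rw [e n hn, e _ hm, e2]
    exact H j (by rw [List.length_drop]; omega)

theorem exists_isFinStep_iff {A : StairBuchiDVPA C I R Q Γ} {p u q σ b} (hs : A.Stair p u q σ b)
    {t : Q × List Γ} {ρ : ℕ → Q × List Γ} (h : A.IsFinRun u (p, []) t ρ) :
    (∃ n, IsFinStep ρ u.length n ∧ (ρ n).1 ∈ A.final) ↔ b := by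
  have hρ := ((A.isFinRun_iff _ _ _ _).1 h).2.2
  rw [hs.flag_iff]
  constructor
  · rintro ⟨n, hn, hF⟩
    obtain ⟨h1, h2⟩ := (isFinStep_iff h).1 hn
    exact ⟨u.take n, u.drop n, (List.take_append_drop _ _).symm, h2, by rwa [← hρ n h1]⟩
  · rintro ⟨u₁, u₂, rfl, h1, h2⟩
    refine ⟨u₁.length, (isFinStep_iff h).2 ⟨by simp, by simpa using h1⟩, ?_⟩
    rw [hρ _ (by simp)]
    simpa using h2

theorem reachF_iff {A : StairBuchiDVPA C I R Q Γ} {p u q σ} :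
    A.ReachF u (p, []) (q, σ) ↔ A.Stair p u q σ True := by
  constructor
  · rintro ⟨ρ, h, hF⟩
    obtain ⟨b, hs⟩ := stair_of_reach ⟨ρ, h⟩
    exact hs.congr (iff_true_intro ((exists_isFinStep_iff hs h).1 hF))
  · intro hs
    obtain ⟨ρ, h⟩ := hs.reach
    exact ⟨ρ, h, (exists_isFinStep_iff hs h).2 trivial⟩

theorem reachNF_iff {A : StairBuchiDVPA C I R Q Γ} {p u q σ} :
    A.ReachNF u (p, []) (q, σ) ↔ A.Stair p u q σ False := by
  constructor
  · rintro ⟨ρ, h, hF⟩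
    obtain ⟨b, hs⟩ := stair_of_reach ⟨ρ, h⟩
    refine hs.congr (iff_false_intro fun hb => ?_)
    obtain ⟨n, hn, hn'⟩ := (exists_isFinStep_iff hs h).2 hb
    exact hF n hn hn'
  · intro hs
    obtain ⟨ρ, h⟩ := hs.reach
    exact ⟨ρ, h, fun n hn hn' => (exists_isFinStep_iff hs h).1 ⟨n, hn, hn'⟩⟩

theorem Stair.det {A : StairBuchiDVPA C I R Q Γ} {p u q σ b q' σ' b'} (h : A.Stair p u q σ b)
    (h' : A.Stair p u q' σ' b') : q = q' ∧ σ = σ' ∧ (b ↔ b') := by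
  obtain ⟨rfl, rfl⟩ := Prod.mk.inj (h.reach.det h'.reach)
  exact ⟨rfl, rfl, h.flag_iff.trans h'.flag_iff.symm⟩

end StairBuchiDVPA

/-! ### The nesting relation -/

namespace StairBuchiDVPA

variable {C I R Q Γ : Type}

/-- Some minimally well-matched factor from `q` to `q'` passes through `p`, and is completed from
`p''` after the return to the height of this position; `b` says whether a final state occurs on a
step of the run from the first letter of the factor to `p`. -/
def Wraps (A : StairBuchiDVPA C I R Q Γ) (q q' p p'' : Q) (b : Prop) : Prop :=
  ∃ c u σ z t r, A.Stair (A.call q c).1 u p σ b ∧ A.Reach z (p'', σ) (t, []) ∧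
    A.ret t (A.call q c).2 r = q'

/-- The loop of the nesting relation: `p` leads to `p'` and back to `p` without final states on
steps, and `p''` undoes this loop. -/
def Pumps (A : StairBuchiDVPA C I R Q Γ) (p p' p'' : Q) : Prop :=
  ∃ v₀ w σ v₁ y, A.Stair p v₀ p' [] False ∧ A.Stair p' w p σ False ∧
    A.Reach v₁ (p, []) (p'', []) ∧ A.Reach y (p'', σ) (p'', [])

theorem Pumps.not_final {A : StairBuchiDVPA C I R Q Γ} {p p' p'' : Q} (h : A.Pumps p p' p'') :
    p ∉ A.final ∧ p' ∉ A.final := by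
  obtain ⟨v₀, w, σ, v₁, y, h1, h2, -, -⟩ := h
  exact ⟨h1.of_start, h2.of_start⟩

theorem Stair.cons_call {A : StairBuchiDVPA C I R Q Γ} {q c u p σ b}
    (h : A.Stair (A.call q c).1 u p σ b) :
    A.Stair q (.call c :: u) p (σ ++ [(A.call q c).2]) (q ∈ A.final ∨ b) := by
  refine (((Stair.nil q).call c).append h).congr ?_
  have := h.of_start
  tauto

/-- The cut between `u` and `z` lies strictly inside the minimally well-matched word: the only steps
of an empty `u` or of a complete factor are its end points, with states `q` and `p`, and neither is
final. So the outer call and return can be split off. -/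
theorem prec_iff {A : StairBuchiDVPA C I R Q Γ} {p p' q q' : Q} :
    A.Prec (p, p') (q, q') ↔ q ∉ A.final ∧ q' ∉ A.final ∧
      ∃ p'', A.Wraps q q' p p'' True ∧ A.Pumps p p' p'' := by
  constructor
  · rintro ⟨hp, -, hq, hq', p'', σ, σ', u, z, h1, ⟨v₀, h2⟩, ⟨w, h3⟩, ⟨v₁, h4⟩, ⟨y, h5⟩, h6, h7⟩
    rw [reachF_iff] at h1
    rw [reachNF_iff] at h2 h3
    refine ⟨hq, hq', p'', ?_, v₀, w, σ', v₁, y, h2, h3, h4, h5⟩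
    obtain ⟨c, x, r, hx, he⟩ := h7
    cases u with
    | nil => exact absurd (((h1.det (.nil _)).2.2).1 trivial) hq
    | cons l u =>
      obtain ⟨rfl, he⟩ := List.cons.inj he
      have hzne : z ≠ [] := by
        rintro rfl
        rw [List.append_nil] at he
        obtain ⟨t, τ, b, ht⟩ := A.exists_stair (A.call q c).1 hx.fits.1
        have hτ : τ = [] := List.length_eq_zero_iff.1 (by rw [← ht.fits.2, hx.fits.2])
        subst hτ
        have hn := (Stair.nil (A := A) q).nest c r ht
        replace he : [] ++ Letter.call c :: (x ++ [.ret r]) = .call c :: u := he.symm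
        rw [he] at hn
        have := h1.det hn
        have h8 := this.2.2.1 trivial
        rw [← this.1] at h8
        tauto
      obtain ⟨z, l, rfl⟩ := (List.eq_nil_or_concat' z).resolve_left hzne
      replace he : (u ++ z) ++ [l] = x ++ [.ret r] := by simpa using he
      obtain ⟨rfl, hl⟩ := List.append_inj' he rfl
      obtain rfl : l = .ret r := by simpa using hl
      obtain ⟨hf, h0⟩ := hx.fits
      obtain ⟨hf, hfz⟩ := (fits_append _ _ _).1 hf
      obtain ⟨t, τ, b, ht⟩ := A.exists_stair (A.call q c).1 hf
      obtain ⟨rfl, rfl, hb⟩ := h1.det ht.cons_call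
      rw [endHeight_append] at h0
      rw [ht.fits.2] at hfz h0
      obtain ⟨s, υ, hs⟩ : ∃ s υ, A.Reach z (p'', τ) (s, υ) :=
        ⟨_, _, (A.reach_iff _ _ _).2 ⟨hfz, rfl⟩⟩
      have hυ : υ = [] := by
        have h8 := A.length_runOn (p'', τ) z
        rw [((A.reach_iff _ _ _).1 hs).2, h0] at h8
        exact List.length_eq_zero_iff.1 h8
      subst hυ
      have h9 := (hs.frame [(A.call q c).2]).append (A.reach_ret _ _ _ r)
      refine ⟨c, u, τ, z, s, r, ht.congr ?_, hs, (Prod.mk.inj (h6.det h9)).1.symm⟩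
      tauto
  · rintro ⟨hq, hq', p'', ⟨c, u, σ, z, t, r, h1, h2, rfl⟩, hP⟩
    refine ⟨hP.not_final.1, hP.not_final.2, hq, hq', ?_⟩
    obtain ⟨v₀, w, σ', v₁, y, h3, h4, h5, h6⟩ := hP
    refine ⟨p'', σ ++ [(A.call q c).2], σ', .call c :: u, z ++ [.ret r], ?_, ⟨v₀, ?_⟩, ⟨w, ?_⟩,
      ⟨v₁, h5⟩, ⟨y, h6⟩, (h2.frame _).append (A.reach_ret _ _ _ _), c, u ++ z, r, ?_, by simp⟩
    · rw [reachF_iff]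
      exact h1.cons_call.congr (by simp)
    · exact reachNF_iff.2 h3
    · exact reachNF_iff.2 h4
    · have hfz := (A.reach_iff _ _ _).1 h2
      have hl := A.length_runOn (p'', σ) z
      rw [hfz.2] at hl
      have hf : Fits 0 (u ++ z) := (fits_append _ _ _).2 ⟨h1.fits.1, by rw [h1.fits.2]; exact hfz.1⟩
      obtain ⟨s, τ, b, hs⟩ := A.exists_stair q hf
      refine hs.wellMatched (List.length_eq_zero_iff.1 ?_)
      rw [← hs.fits.2, endHeight_append, h1.fits.2]
      exact hl.symm

/-- A factor from `p` to `p'` is plugged into the gap of a factor from `q` to `q'`. -/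
theorem Wraps.trans {A : StairBuchiDVPA C I R Q Γ} {q q' p p' r r' : Q} {b b' : Prop}
    (h : A.Wraps q q' p p' b) (h' : A.Wraps p p' r r' b') : A.Wraps q q' r r' (b ∨ b') := by
  obtain ⟨c, u, σ, z, t, l, h1, h2, rfl⟩ := h
  obtain ⟨c', u', σ', z', t', l', h3, h4, rfl⟩ := h'
  refine ⟨c, u ++ .call c' :: u', (σ' ++ [(A.call p c').2]) ++ σ, z' ++ ([.ret l'] ++ z), t, l,
    (h1.append h3.cons_call).congr ?_, ?_, rfl⟩
  · have := h1.of_end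
    tauto
  · rw [List.append_assoc]
    exact (h4.frame _).append ((A.reach_ret _ _ _ _).append h2)

theorem Wraps.of_reach {A : StairBuchiDVPA C I R Q Γ} {q q' p p' p'' : Q} {b : Prop}
    {v : List (Letter C I R)} (h : A.Wraps q q' p p'' b) (hv : A.Reach v (p', []) (p'', [])) :
    A.Wraps q q' p p' b := by
  obtain ⟨c, u, σ, z, t, l, h1, h2, rfl⟩ := h
  exact ⟨c, u, σ, v ++ z, t, l, h1, (by simpa using hv.frame σ : A.Reach v _ (p'', σ)).append h2, rfl⟩

/-- Climb from `p'` to `p`, cross over to `p''` and undo the climb. This detour allows a gap that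
ends in `p''` to be replaced by one that ends in `p'`. -/
theorem Pumps.reach {A : StairBuchiDVPA C I R Q Γ} {p p' p'' : Q} (h : A.Pumps p p' p'') :
    ∃ v, A.Reach v (p', []) (p'', []) := by
  obtain ⟨v₀, w, σ, v₁, y, h1, h2, h3, h4⟩ := h
  exact ⟨_, h2.reach.append ((by simpa using h3.frame σ : A.Reach v₁ (p, σ) (p'', σ)).append h4)⟩

theorem Prec.of_wraps {A : StairBuchiDVPA C I R Q Γ} {x : Q × Q} {p p' q q' : Q} {b : Prop}
    (h : A.Prec x (p, p')) (hw : A.Wraps q q' p p' b) (hq : q ∉ A.final) (hq' : q' ∉ A.final) :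
    A.Prec x (q, q') := by
  obtain ⟨r, r'⟩ := x
  obtain ⟨-, -, r'', h1, h2⟩ := prec_iff.1 h
  refine prec_iff.2 ⟨hq, hq', r'', ?_, h2⟩
  simpa using hw.trans h1

/-- By the detour of `Pumps.reach`, the factor of `z` also wraps the pair `y` itself; the factor of
`y` that contains the loop of `x` is then plugged in. -/
theorem Prec.trans {A : StairBuchiDVPA C I R Q Γ} {x y z : Q × Q} (h : A.Prec x y)
    (h' : A.Prec y z) : A.Prec x z := by
  obtain ⟨p, p'⟩ := y
  obtain ⟨q, q'⟩ := z
  obtain ⟨hq, hq', p'', h1, h2⟩ := prec_iff.1 h'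
  obtain ⟨v, hv⟩ := h2.reach
  exact h.of_wraps (h1.of_reach hv) hq hq'

theorem Prec.reachable {A : StairBuchiDVPA C I R Q Γ} {x y : Q × Q} (h : A.Prec x y)
    (hy : A.ReachableState y.1) : A.ReachableState x.1 := by
  obtain ⟨-, -, -, -, p'', σ, σ', u, z, h1, -⟩ := h
  obtain ⟨v, τ, hv⟩ := hy
  exact ⟨v ++ u, σ ++ τ, hv.append ((reachF_iff.1 h1).reach.frame τ)⟩

end StairBuchiDVPA

/-! ### Infinite words -/

/-- The factor `w n, …, w (m - 1)` of an infinite word. -/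
def seg {α : Type} (w : ℕ → α) (n m : ℕ) : List α := (List.range' n (m - n)).map w

section Seg

variable {α : Type} (w : ℕ → α)

@[simp] theorem length_seg (n m : ℕ) : (seg w n m).length = m - n := by simp [seg]

@[simp] theorem seg_self (n : ℕ) : seg w n n = [] := by simp [seg]

theorem seg_append {n m k : ℕ} (h : n ≤ m) (h' : m ≤ k) : seg w n m ++ seg w m k = seg w n k := by
  rw [seg, seg, seg, ← List.map_append]
  congr 1
  have := List.range'_append_1 (s := n) (m := m - n) (n := k - m)
  rw [show n + (m - n) = m by omega, show m - n + (k - m) = k - n by omega] at this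
  exact this

theorem seg_succ {n m : ℕ} (h : n ≤ m) : seg w n (m + 1) = seg w n m ++ [w m] := by
  rw [← seg_append w h (Nat.le_succ m)]
  simp [seg]

theorem seg_eq_cons {n m : ℕ} (h : n < m) : seg w n m = w n :: seg w (n + 1) m := by
  rw [← seg_append w (Nat.le_succ n) h]
  simp [seg]

theorem take_seg {n m k : ℕ} (h : n + k ≤ m) : (seg w n m).take k = seg w n (n + k) := by
  rw [← seg_append w (Nat.le_add_right n k) h, List.take_left' (by simp)]

theorem exists_seg_eq {V : ℕ → List α} (h : ∀ K, V K <+: V (K + 1)) (hl : ∀ K, K ≤ (V K).length) :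
    ∃ w : ℕ → α, ∀ K, seg w 0 (V K).length = V K := by
  have mono : ∀ {K L}, K ≤ L → V K <+: V L := fun {K L} hKL => by
    induction L, hKL using Nat.le_induction with
    | base => exact List.prefix_refl _
    | succ L _ ih => exact ih.trans (h L)
  refine ⟨fun n => (V (n + 1))[n]'(hl (n + 1)), fun K => ?_⟩
  refine List.ext_getElem (by simp) fun n h1 h2 => ?_
  simp only [seg, List.getElem_map, List.getElem_range']
  rcases le_total K (n + 1) with hK | hK
  · simp [← (mono hK).getElem h2]
  · simp [(mono hK).getElem (hl (n + 1))]

end Seg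

/-! ### Infinite runs and acceptance in terms of prefixes -/

section Runs

variable {C I R Q Γ : Type}

theorem DVPM.isRun_iff (M : DVPM C I R Q Γ) (w : ℕ → Letter C I R) (ρ : ℕ → Q × List Γ) :
    M.IsRun w ρ ↔ (∀ n, Fits 0 (seg w 0 n)) ∧ ∀ n, ρ n = M.runOn (M.init, []) (seg w 0 n) := by
  constructor
  · rintro ⟨h0, ht⟩
    rw [← forall_and]
    intro n
    induction n with
    | zero => simp [Fits, h0]
    | succ n ih =>
      obtain ⟨h3, h4⟩ := (M.trans_iff _ _ _).1 (ht n)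
      rw [ih.2, length_runOn] at h3
      rw [seg_succ _ (Nat.zero_le n), fits_append, runOn_append, ← ih.2]
      exact ⟨⟨ih.1, h3⟩, h4.symm⟩
  · rintro ⟨hf, hρ⟩
    refine ⟨hρ 0, fun n => ?_⟩
    have := hf (n + 1)
    rw [seg_succ _ (Nat.zero_le n), fits_append] at this
    rw [trans_iff, hρ, hρ, seg_succ _ (Nat.zero_le n), runOn_append, length_runOn]
    exact ⟨this.2, rfl⟩

/-- The run of `M` on `w`, if there is one. -/
def DVPM.confAt (M : DVPM C I R Q Γ) (w : ℕ → Letter C I R) (n : ℕ) : Q × List Γ :=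
  M.runOn (M.init, []) (seg w 0 n)

theorem DVPM.isRun_confAt (M : DVPM C I R Q Γ) {w : ℕ → Letter C I R}
    (h : ∀ n, Fits 0 (seg w 0 n)) : M.IsRun w (M.confAt w) :=
  (M.isRun_iff _ _).2 ⟨h, fun _ => rfl⟩

theorem DVPM.IsRun.eq {M : DVPM C I R Q Γ} {w : ℕ → Letter C I R} {ρ : ℕ → Q × List Γ}
    (h : M.IsRun w ρ) : ρ = M.confAt w := funext ((M.isRun_iff _ _).1 h).2

theorem DVPM.confAt_eq (M : DVPM C I R Q Γ) (w : ℕ → Letter C I R) {n m : ℕ} (h : n ≤ m) :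
    M.confAt w m = M.runOn (M.confAt w n) (seg w n m) := by
  rw [confAt, confAt, ← runOn_append, seg_append _ (Nat.zero_le n) h]

/-- Position `i` is a step of the prefix of length `n` of `w`. -/
def IsStair (w : ℕ → Letter C I R) (i n : ℕ) : Prop := i ≤ n ∧ Fits 0 (seg w i n)

theorem fits_seg {w : ℕ → Letter C I R} (hw : ∀ n, Fits 0 (seg w 0 n)) {i n : ℕ} (h : i ≤ n) :
    Fits (endHeight 0 (seg w 0 i)) (seg w i n) := by
  have := hw n
  rw [← seg_append w (Nat.zero_le i) h, fits_append] at this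
  exact this.2

theorem isStair_iff {w : ℕ → Letter C I R} (hw : ∀ n, Fits 0 (seg w 0 n)) {i n : ℕ} :
    IsStair w i n ↔ i ≤ n ∧ ∀ k, i ≤ k → k ≤ n →
      endHeight 0 (seg w 0 i) ≤ endHeight 0 (seg w 0 k) := by
  refine and_congr_right fun h => ?_
  rw [fits_iff_le_endHeight (k := 0) (fits_seg hw h)]
  have e : ∀ j, i + j ≤ n → endHeight (endHeight 0 (seg w 0 i) + 0) ((seg w i n).take j) =
      endHeight 0 (seg w 0 (i + j)) := fun j hj => by
    rw [take_seg w hj, Nat.add_zero, ← endHeight_append, seg_append w (by omega) (by omega)]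
  constructor
  · intro H k hik hkn
    obtain ⟨j, rfl⟩ := Nat.exists_eq_add_of_le hik
    rw [← e j hkn]
    exact H j (by rw [length_seg]; omega)
  · intro H j hj
    rw [length_seg] at hj
    rw [e j (by omega)]
    exact H _ (by omega) (by omega)

theorem DVPM.isStep_iff (M : DVPM C I R Q Γ) {w : ℕ → Letter C I R}
    (hw : ∀ n, Fits 0 (seg w 0 n)) {n : ℕ} :
    IsStep (M.confAt w) n ↔ ∀ m, n ≤ m → IsStair w n m := by
  simp only [isStair_iff hw, IsStep, confAt, length_runOn]
  constructor
  · exact fun H m hm => ⟨hm, fun k hk _ => H k hk⟩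
  · exact fun H m hm => (H m hm).2 m hm le_rfl

theorem StairBuchiDVPA.mem_lang_iff (A : StairBuchiDVPA C I R Q Γ) (w : ℕ → Letter C I R) :
    w ∈ A.lang ↔ (∀ n, Fits 0 (seg w 0 n)) ∧
      ∃ᶠ n in atTop, (∀ m, n ≤ m → IsStair w n m) ∧ (A.confAt w n).1 ∈ A.final := by
  constructor
  · rintro ⟨ρ, h, hF⟩
    have hw := ((A.isRun_iff _ _).1 h).1
    rw [h.eq] at hF
    simp only [A.isStep_iff hw] at hF
    exact ⟨hw, hF⟩
  · rintro ⟨hw, hF⟩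
    refine ⟨_, A.isRun_confAt hw, ?_⟩
    simpa only [A.isStep_iff hw] using hF

theorem ParityDVPA.mem_lang_iff (B : ParityDVPA C I R Q Γ) (w : ℕ → Letter C I R) :
    w ∈ B.lang ↔ (∀ n, Fits 0 (seg w 0 n)) ∧
      ∃ p, IsGreatest {k | ∃ᶠ n in atTop, B.prio (B.confAt w n).1 = k} p ∧ Even p := by
  constructor
  · rintro ⟨ρ, h, hF⟩
    have hw := ((B.isRun_iff _ _).1 h).1
    rw [h.eq] at hF
    exact ⟨hw, hF⟩
  · rintro ⟨hw, hF⟩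
    exact ⟨_, B.isRun_confAt hw, hF⟩

end Runs

/-! ### Recurring values of bounded sequences, and omega-powers -/

theorem exists_frequently_eq {f : ℕ → ℕ} {M i : ℕ} (hf : ∀ n, f n ≤ M)
    (h : ∃ᶠ n in atTop, i ≤ f n) : ∃ k, i ≤ k ∧ ∃ᶠ n in atTop, f n = k := by
  by_contra! H
  have : ∀ k ∈ Finset.Icc i M, ∀ᶠ n in atTop, f n ≠ k := fun k hk =>
    H k (Finset.mem_Icc.1 hk).1
  rw [← Filter.eventually_all_finset] at this
  obtain ⟨n, hn, hn'⟩ := (h.and_eventually this).exists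
  exact hn' _ (Finset.mem_Icc.2 ⟨hn, hf n⟩) rfl

theorem exists_isGreatest_frequently {f : ℕ → ℕ} {M : ℕ} (hf : ∀ n, f n ≤ M) :
    ∃ p, IsGreatest {k | ∃ᶠ n in atTop, f n = k} p := by
  obtain ⟨k, -, hk⟩ := exists_frequently_eq (i := 0) hf (Frequently.of_forall fun n => Nat.zero_le _)
  refine ⟨_, Nat.sSup_mem ⟨k, hk⟩ ⟨M, fun k hk => ?_⟩, fun k hk => le_csSup ⟨M, fun k hk => ?_⟩ hk⟩
  all_goals
    obtain ⟨n, hn⟩ := hk.exists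
    exact hn ▸ hf n

/-- The `K`-th power of a word. -/
def wpow {α : Type} (x : List α) (K : ℕ) : List α := (List.replicate K x).flatten

theorem wpow_succ {α : Type} (x : List α) (K : ℕ) : wpow x (K + 1) = wpow x K ++ x := by
  simp [wpow, List.replicate_succ']

theorem wpow_add {α : Type} (x : List α) (K L : ℕ) : wpow x (K + L) = wpow x K ++ wpow x L := by
  simp [wpow, ← List.replicate_append_replicate]

theorem length_wpow {α : Type} (x : List α) (K : ℕ) : (wpow x K).length = K * x.length := by
  simp [wpow]

theorem exists_omega_power {α : Type} (t x : List α) (hx : x ≠ []) :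
    ∃ w : ℕ → α, ∀ K, seg w 0 (t.length + K * x.length) = t ++ wpow x K := by
  have hx' : 0 < x.length := List.length_pos_iff.2 hx
  obtain ⟨w, hw⟩ := exists_seg_eq (V := fun K => t ++ wpow x K)
    (fun K => ⟨x, by simp [wpow_succ]⟩)
    (fun K => by simp only [List.length_append, length_wpow]; nlinarith)
  exact ⟨w, fun K => by simpa [length_wpow] using hw K⟩

/-! ### Automata with a pair nested in itself -/

namespace StairBuchiDVPA

variable {C I R Q Γ Q' Γ' : Type}

theorem Stair.wpow {A : StairBuchiDVPA C I R Q Γ} {q x τ b} (h : A.Stair q x q τ b) (K : ℕ) :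
    ∃ τ' b', A.Stair q (wpow x K) q τ' b' ∧ (¬ b → ¬ b') := by
  induction K with
  | zero => exact ⟨_, _, .nil q, fun hb hq => hb (h.of_start hq)⟩
  | succ K ih =>
    obtain ⟨τ', b', h1, h2⟩ := ih
    rw [wpow_succ]
    exact ⟨_, _, h1.append h, by tauto⟩

/-- Acceptance of a word that ends in a power of a stair from `q` to `q`. -/
theorem omega_power_mem_lang {A : StairBuchiDVPA C I R Q Γ} {q ρ τ b} {t x : List (Letter C I R)}
    (ht : A.Reach t (A.init, []) (q, ρ)) (hx : A.Stair q x q τ b) (hne : x ≠ [])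
    {w : ℕ → Letter C I R} (hw : ∀ K, seg w 0 (t.length + K * x.length) = t ++ wpow x K) :
    (∀ n, Fits 0 (seg w 0 n)) ∧ (w ∈ A.lang ↔ b) := by
  have hpos : 0 < x.length := List.length_pos_iff.2 hne
  have hle : ∀ n, n ≤ t.length + n * x.length := fun n => by nlinarith
  have hK : ∀ K, ∃ υ, A.Reach (t ++ _root_.wpow x K) (A.init, []) (q, υ) := fun K => by
    obtain ⟨τ', b', h1, -⟩ := hx.wpow K
    exact ⟨_, ht.append (h1.reach.frame ρ)⟩
  have hf : ∀ n, Fits 0 (seg w 0 n) := fun n => by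
    obtain ⟨υ, h⟩ := hK n
    rw [← hw, ← seg_append w (Nat.zero_le n) (hle n), DVPM.reach_iff, fits_append] at h
    exact h.1.1
  have hc : ∀ K, ∃ υ, A.confAt w (t.length + K * x.length) = (q, υ) := fun K => by
    obtain ⟨υ, h⟩ := hK K
    exact ⟨υ, by rw [DVPM.confAt, hw, ((A.reach_iff _ _ _).1 h).2]⟩
  have hblock : ∀ K L, K ≤ L → seg w (t.length + K * x.length) (t.length + L * x.length) =
      _root_.wpow x (L - K) := fun K L hKL => by
    have h1 := seg_append w (Nat.zero_le (t.length + K * x.length))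
      (show t.length + K * x.length ≤ t.length + L * x.length by gcongr)
    rw [hw, hw, show L = K + (L - K) by omega, wpow_add, ← List.append_assoc] at h1
    have := List.append_cancel_left h1
    rwa [show K + (L - K) = L by omega] at this
  have hstate : ∀ K u₁ u₂, x = u₁ ++ u₂ →
      (A.confAt w (t.length + K * x.length + u₁.length)).1 = (A.runOn (q, []) u₁).1 := by
    intro K u₁ u₂ he
    obtain ⟨υ, h⟩ := hc K
    have hb := hblock K (K + 1) (Nat.le_succ K)
    rw [show K + 1 - K = 1 by omega, show _root_.wpow x 1 = x by simp [_root_.wpow]] at hb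
    have h1 : seg w (t.length + K * x.length) (t.length + K * x.length + u₁.length) = u₁ := by
      have h2 : u₁.length ≤ x.length := by simp [he]
      rw [← take_seg w (m := t.length + (K + 1) * x.length) (by nlinarith), hb, he]
      simp
    rw [A.confAt_eq w (Nat.le_add_right _ u₁.length), h1, h]
    have h3 := A.runOn_frame q [] υ u₁ (by
      have := hx.fits.1
      rw [he, fits_append] at this
      exact this.1)
    rw [List.nil_append] at h3
    rw [h3]
  refine ⟨hf, ?_⟩
  rw [A.mem_lang_iff]
  constructor
  · rintro ⟨-, h⟩
    rw [frequently_atTop] at h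
    obtain ⟨n, hn, hst, hF⟩ := h t.length
    obtain ⟨K, r, hr, rfl⟩ : ∃ K r, r < x.length ∧ n = t.length + K * x.length + r :=
      ⟨(n - t.length) / x.length, (n - t.length) % x.length, Nat.mod_lt _ hpos, by
        have := Nat.div_add_mod (n - t.length) x.length
        rw [mul_comm] at this
        omega⟩
    -- A step of the infinite word at offset `r` of block `K` is in particular a step of that copy
    -- of `x`.
    have hm : t.length + K * x.length + r ≤ t.length + (K + 1) * x.length := by nlinarith
    have h1 := (hst _ hm).2
    have hb := hblock K (K + 1) (Nat.le_succ K)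
    rw [show K + 1 - K = 1 by omega, show _root_.wpow x 1 = x by simp [_root_.wpow],
      ← seg_append w (Nat.le_add_right _ r) hm] at hb
    refine hx.flag_iff.2 ⟨_, _, hb.symm, h1, ?_⟩
    rw [← hstate K _ _ hb.symm, length_seg]
    simpa using hF
  · intro hb
    refine ⟨hf, frequently_atTop.2 fun N => ?_⟩
    obtain ⟨u₁, u₂, rfl, h1, h2⟩ := hx.flag_iff.1 hb
    set x := u₁ ++ u₂ with hxdef
    have hlen : u₁.length ≤ x.length := by simp [hxdef]
    refine ⟨t.length + N * x.length + u₁.length, by have := hle N; omega, fun m hm => ⟨hm, ?_⟩, ?_⟩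
    · have hL : N + 1 ≤ m + N + 1 := by omega
      have hb := hblock N (m + N + 1) (by omega)
      have hm' : m ≤ t.length + (m + N + 1) * x.length := by nlinarith
      rw [show m + N + 1 - N = 1 + m by omega, wpow_add, show _root_.wpow x 1 = x by
        simp [_root_.wpow], ← seg_append w (Nat.le_add_right _ u₁.length) (hm.trans hm'), hxdef,
        List.append_assoc] at hb
      have hb2 := (List.append_inj hb (by simp)).2
      obtain ⟨τ', b', h3, -⟩ := hx.wpow m
      have h4 : Fits 0 (u₂ ++ _root_.wpow x m) :=
        (fits_append _ _ _).2 ⟨h1, (h3.fits.1.of_zero _).1⟩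
      rw [← hb2, ← seg_append w hm hm', fits_append] at h4
      exact h4.1
    · rw [hstate N u₁ u₂ rfl]
      exact h2

/-! ### Priorities forced on an equivalent parity automaton -/

/-- `b` is a state of `B` after some word that leads `A` to the state `q`. -/
def Companion (A : StairBuchiDVPA C I R Q Γ) (B : ParityDVPA C I R Q' Γ') (q : Q) (b : Q') : Prop :=
  ∃ t ρ τ, A.Reach t (A.init, []) (q, ρ) ∧ B.Reach t (B.init, []) (b, τ)

/-- `B` visits a priority of at least `i` on `x` whenever `A` is in the state `q`. -/
def Visits (A : StairBuchiDVPA C I R Q Γ) (B : ParityDVPA C I R Q' Γ') (q : Q)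
    (x : List (Letter C I R)) (i : ℕ) : Prop :=
  ∀ b, A.Companion B q b → ∃ u₁ u₂, x = u₁ ++ u₂ ∧ i ≤ B.prio (B.runOn (b, []) u₁).1

theorem Companion.runOn {A : StairBuchiDVPA C I R Q Γ} {B : ParityDVPA C I R Q' Γ'} {q p : Q}
    {b : Q'} {x : List (Letter C I R)} {τ : List Γ} (h : A.Companion B q b)
    (hx : A.Reach x (q, []) (p, τ)) : A.Companion B p (B.runOn (b, []) x).1 := by
  obtain ⟨t, ρ, υ, h1, h2⟩ := h
  have h3 : B.Reach x (b, []) ((B.runOn (b, []) x).1, (B.runOn (b, []) x).2) :=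
    (B.reach_iff _ _ _).2 ⟨((A.reach_iff _ _ _).1 hx).1, rfl⟩
  exact ⟨_, _, _, h1.append (hx.frame ρ), h2.append (h3.frame υ)⟩

theorem Visits.append_left {A : StairBuchiDVPA C I R Q Γ} {B : ParityDVPA C I R Q' Γ'} {q : Q}
    {x : List (Letter C I R)} {i : ℕ} (h : A.Visits B q x i) (y : List (Letter C I R)) :
    A.Visits B q (x ++ y) i := fun b hb => by
  obtain ⟨u₁, u₂, rfl, h1⟩ := h b hb
  exact ⟨u₁, u₂ ++ y, by simp, h1⟩

theorem Visits.append_right {A : StairBuchiDVPA C I R Q Γ} {B : ParityDVPA C I R Q' Γ'} {q p : Q}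
    {x y : List (Letter C I R)} {τ : List Γ} {i : ℕ} (hx : A.Reach x (q, []) (p, τ))
    (h : A.Visits B p y i) (hy : Fits 0 y) : A.Visits B q (x ++ y) i := fun b hb => by
  obtain ⟨u₁, u₂, rfl, h1⟩ := h _ (hb.runOn hx)
  refine ⟨x ++ u₁, u₂, by simp, ?_⟩
  have h2 := B.runOn_frame (B.runOn (b, []) x).1 [] (B.runOn (b, []) x).2 u₁
    ((fits_append _ _ _).1 hy).1
  rw [List.nil_append] at h2
  rw [B.runOn_append, h2]
  exact h1

/-- If every traversal of a loop visits a priority of at least `i` and `i` has the wrong parity, then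
some power of the loop visits a greater priority. -/
theorem Visits.boost {A : StairBuchiDVPA C I R Q Γ} {B : ParityDVPA C I R Q' Γ'} [Finite Q']
    (hlang : B.lang = A.lang) {q τ b} {x : List (Letter C I R)} {i : ℕ}
    (hx : A.Stair q x q τ b) (hne : x ≠ []) (h : A.Visits B q x i) (hb : b ↔ ¬ Even i) :
    ∃ K, A.Visits B q (_root_.wpow x K) (i + 1) := by
  have hpos : 0 < x.length := List.length_pos_iff.2 hne
  have key : ∀ c, A.Companion B q c → ∃ K u₁ u₂, _root_.wpow x K = u₁ ++ u₂ ∧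
      i + 1 ≤ B.prio (B.runOn (c, []) u₁).1 := by
    rintro c ⟨t, ρ, υ, h1, h2⟩
    obtain ⟨w, hw⟩ := exists_omega_power t x hne
    obtain ⟨hf, hA⟩ := omega_power_mem_lang h1 hx hne hw
    obtain ⟨M, hM⟩ : ∃ M, ∀ s, B.prio s ≤ M := by
      obtain ⟨M, hM⟩ := (Set.finite_range B.prio).bddAbove
      exact ⟨M, fun s => hM ⟨s, rfl⟩⟩
    obtain ⟨p, hp⟩ := exists_isGreatest_frequently (f := fun n => B.prio (B.confAt w n).1)
      (fun n => hM _)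
    have hpar : Even p ↔ b := by
      rw [← hA, ← hlang, B.mem_lang_iff]
      exact ⟨fun h => ⟨hf, p, hp, h⟩, fun ⟨_, p', hp', h⟩ => hp.unique hp' ▸ h⟩
    have hst : ∀ L u₁ u₂, _root_.wpow x L = u₁ ++ u₂ →
        (B.confAt w (t.length + u₁.length)).1 = (B.runOn (c, []) u₁).1 := by
      intro L u₁ u₂ he
      have hlen : u₁.length ≤ L * x.length := by rw [← length_wpow, he]; simp
      have h3 : seg w 0 (t.length + u₁.length) = t ++ u₁ := by
        have := take_seg w (n := 0) (m := t.length + L * x.length) (k := t.length + u₁.length)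
          (by omega)
        rw [hw, he, Nat.zero_add] at this
        rw [← this, ← List.append_assoc, ← List.length_append, List.take_left]
      obtain ⟨τ', b', h4, -⟩ := hx.wpow L
      have h5 := B.runOn_frame c [] υ u₁ (by
        have := h4.fits.1
        rw [he, fits_append] at this
        exact this.1)
      rw [DVPM.confAt, h3, B.runOn_append, ((B.reach_iff _ _ _).1 h2).2]
      rw [List.nil_append] at h5
      rw [h5]
    have hfreq : ∃ᶠ n in atTop, i ≤ B.prio (B.confAt w n).1 := by
      refine frequently_atTop.2 fun N => ?_
      obtain ⟨τ', b', h4, -⟩ := hx.wpow N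
      have h3 := Visits.append_right h4.reach h hx.fits.1
      obtain ⟨u₁, u₂, he, h5⟩ := h _ (Companion.runOn ⟨t, ρ, υ, h1, h2⟩ h4.reach)
      refine ⟨t.length + (_root_.wpow x N ++ u₁).length, ?_, ?_⟩
      · rw [List.length_append, length_wpow]
        nlinarith
      · rw [hst (N + 1) _ u₂ (by rw [wpow_succ, List.append_assoc, ← he]), B.runOn_append]
        have h6 := B.runOn_frame (B.runOn (c, []) (_root_.wpow x N)).1 []
          (B.runOn (c, []) (_root_.wpow x N)).2 u₁ (by
            have := hx.fits.1
            rw [he, fits_append] at this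
            exact this.1)
        rw [List.nil_append] at h6
        rw [h6]
        exact h5
    obtain ⟨k, hik, hk⟩ := exists_frequently_eq (fun n => hM (B.confAt w n).1) hfreq
    -- The greatest recurring priority `p` is at least `i`, and its parity is dictated by the
    -- verdict of `A`, which by `hb` is not the parity of `i`.
    have hip : i + 1 ≤ p := by
      have h3 : k ≤ p := hp.2 hk
      have h4 : i ≠ p := by
        rintro rfl
        tauto
      omega
    obtain ⟨n, hn, hpn⟩ := (frequently_atTop.1 hp.1) t.length
    obtain ⟨j, rfl⟩ := Nat.exists_eq_add_of_le hn
    -- The offset `j` itself serves as exponent: `x` is non-empty, so its `j`-th power has at least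
    -- `j` letters.
    refine ⟨j, (_root_.wpow x j).take j, (_root_.wpow x j).drop j,
      (List.take_append_drop _ _).symm, ?_⟩
    have hj : ((_root_.wpow x j).take j).length = j := by
      rw [List.length_take, length_wpow]
      exact min_eq_left (by nlinarith)
    rw [← hst j _ _ (List.take_append_drop j _).symm, hj, hpn]
    exact hip
  choose! K hK using key
  -- Companions are states of `B`, of which there are finitely many, so one exponent serves all of
  -- them.
  obtain ⟨M, hM⟩ := (Set.finite_range K).bddAbove
  refine ⟨M, fun c hc => ?_⟩
  obtain ⟨u₁, u₂, he, h1⟩ := hK c hc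
  refine ⟨u₁, u₂ ++ _root_.wpow x (M - K c), ?_, h1⟩
  rw [← List.append_assoc, ← he, ← wpow_add, Nat.add_sub_cancel' (hM ⟨c, rfl⟩)]

/-- A pair below itself would allow accepting and rejecting loops to be nested alternately to any
depth, and each change of verdict costs `B` a greater priority. Reachability of the first component
supplies a companion state at which this is contradictory. -/
theorem not_prec_self {A : StairBuchiDVPA C I R Q Γ} {B : ParityDVPA C I R Q' Γ'} [Finite Q']
    (hlang : B.lang = A.lang) {x : Q × Q} (hx : A.ReachableState x.1) : ¬ A.Prec x x := by
  obtain ⟨q, q'⟩ := x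
  intro h
  obtain ⟨hq, hq', q'', ⟨c, u, σ, z, s, r, hu, hz, rfl⟩, hP⟩ := prec_iff.1 h
  obtain ⟨y', hy'⟩ := hP.reach
  obtain ⟨v₀, w, σ', v₁, y, hv₀, hw, hv₁, hy⟩ := hP
  set q' := A.ret s (A.call q c).2 r with hq'def
  -- close a loop to a factor from `q` to `q'`
  have close : ∀ X τ b v, A.Stair q X q τ b → A.Reach v (q'', τ) (q'', []) →
      ∃ W, A.Stair q (.call c :: (u ++ X) ++ W) q' [] False := by
    intro X τ b v hX hv
    have h1 : A.Reach v₁ (q, τ ++ σ) (q'', τ ++ σ) := by simpa using hv₁.frame (τ ++ σ)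
    have h2 : A.Reach v (q'', τ ++ σ) (q'', σ) := by simpa using hv.frame σ
    obtain ⟨b', h3⟩ := stair_of_reach (((hu.append hX).reach.append h1).append (h2.append hz))
    refine ⟨v₁ ++ (v ++ z) ++ [.ret r], ?_⟩
    have h4 := ((Stair.nil q).nest c r h3).congr (b' := False) (by tauto)
    simpa using h4
  have key : ∀ i, ∃ W, W ≠ [] ∧ A.Stair q W q' [] False ∧ A.Visits B q W i := by
    intro i
    induction i with
    | zero =>
      obtain ⟨W, hW⟩ := close [] [] _ [] (.nil q) (by simp [DVPM.reach_iff, Fits])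
      exact ⟨_, by simp, hW, fun b _ => ⟨[], _, rfl, Nat.zero_le _⟩⟩
    | succ i ih =>
      obtain ⟨W, hne, hW, hV⟩ := ih
      have hX := (hW.append hw).congr (b' := False) (by tauto)
      have hXV := hV.append_left w
      suffices ∃ X τ b v, A.Stair q X q τ b ∧ A.Reach v (q'', τ) (q'', []) ∧
          A.Visits B q X (i + 1) by
        obtain ⟨X, τ, b, v, h1, h2, h3⟩ := this
        obtain ⟨W', hW'⟩ := close X τ b v h1 h2
        refine ⟨_, by simp, hW', ?_⟩
        have h4 := (Visits.append_right hu.cons_call.reach h3 h1.fits.1).append_left W'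
        simpa using h4
      -- A power of a loop at `q` is undone at `q''` one copy at a time, so boosting preserves the
      -- possibility of closing the factor.
      have hpop : ∀ {X τ b v}, A.Stair q X q τ b → A.Reach v (q'', τ) (q'', []) →
          ∀ K, ∃ τ b v, A.Stair q (wpow X K) q τ b ∧ A.Reach v (q'', τ) (q'', []) := by
        intro X τ b v h1 h2 K
        induction K with
        | zero => exact ⟨_, _, [], .nil q, by simp [DVPM.reach_iff, Fits]⟩
        | succ K ih =>
          obtain ⟨τ', b', v', h3, h4⟩ := ih
          rw [wpow_succ]
          exact ⟨_, _, _, h3.append h1,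
            (by simpa using h2.frame τ' : A.Reach v (q'', τ ++ τ') (q'', τ')).append h4⟩
      -- For even `i` the loop `W w` is used, which has no final state on a step and whose
      -- omega-power is rejected. For odd `i` it is preceded by `c u`, which brings a final state
      -- onto a step.
      by_cases hi : Even i
      · obtain ⟨K, hK⟩ := hXV.boost hlang hX (by simp [hne]) (by simp [hi])
        obtain ⟨τ, b, v, h1, h2⟩ := hpop hX (by simpa using hy) K
        exact ⟨_, τ, b, v, h1, h2, hK⟩
      · have hT := (hu.cons_call.append hX).congr (b' := True) (by tauto)
        have hTV := Visits.append_right hu.cons_call.reach hXV hX.fits.1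
        -- The word `y` removes the stack content of `w`, `z` and the return complete the factor
        -- begun by `c u` and lead to `q'`, and `y'` goes back to `q''`.
        have hTpop : A.Reach (y ++ (z ++ [.ret r] ++ y'))
            (q'', (σ' ++ []) ++ (σ ++ [(A.call q c).2])) (q'', []) := by
          refine (by simpa using hy.frame (σ ++ [(A.call q c).2]) : A.Reach y _ _).append ?_
          exact ((hz.frame _).append (A.reach_ret _ _ _ _)).append hy'
        obtain ⟨K, hK⟩ := hTV.boost hlang hT (by simp) (by simp [hi])
        obtain ⟨τ, b, v, h1, h2⟩ := hpop hT hTpop K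
        exact ⟨_, τ, b, v, h1, h2, hK⟩
  obtain ⟨M, hM⟩ := (Set.finite_range B.prio).bddAbove
  obtain ⟨W, hne, hW, hV⟩ := key (M + 1)
  have hB : ∃ b, A.Companion B q b := by
    obtain ⟨t, ρ, ht⟩ := hx
    exact ⟨_, t, ρ, _, ht, (B.reach_iff _ _ _).2 ⟨((A.reach_iff _ _ _).1 ht).1, rfl⟩⟩
  obtain ⟨b, hb⟩ := hB
  obtain ⟨u₁, u₂, -, h1⟩ := hV b hb
  have h2 := hM ⟨(B.runOn (b, []) u₁).1, rfl⟩
  omega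

end StairBuchiDVPA

/-! ### Heights of pairs -/

namespace StairBuchiDVPA

variable {C I R Q Γ : Type}

theorem HeightGE.pos {A : StairBuchiDVPA C I R Q Γ} {x : Q × Q} {n : ℕ} (h : A.HeightGE x n) :
    1 ≤ n := by
  cases h <;> omega

theorem HeightGE.of_le {A : StairBuchiDVPA C I R Q Γ} {x : Q × Q} {n k : ℕ} (h : A.HeightGE x n)
    (hk : 1 ≤ k) (hkn : k ≤ n) : A.HeightGE x k := by
  induction h generalizing k with
  | one x =>
    obtain rfl : k = 1 := by omega
    exact .one x
  | succ x y n hxy _ ih =>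
    obtain ⟨k, rfl⟩ := Nat.exists_eq_add_of_le' hk
    rcases Nat.eq_zero_or_pos k with rfl | hk'
    · exact .one y
    · exact .succ x y k hxy (ih hk' (by omega))

/-- By transitivity all earlier members of a chain are below its last one, and by irreflexivity they
are distinct. This bounds the length of chains by the number of pairs. -/
theorem HeightGE.exists_chain {A : StairBuchiDVPA C I R Q Γ}
    (hA : ∀ x : Q × Q, A.ReachableState x.1 → ¬ A.Prec x x) {y : Q × Q} {n : ℕ}
    (h : A.HeightGE y n) (hy : A.ReachableState y.1) :
    ∃ S : Finset (Q × Q), S.card + 1 = n ∧ ∀ x ∈ S, A.Prec x y := by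
  classical
  induction h with
  | one x => exact ⟨∅, by simp, by simp⟩
  | succ x y n hxy _ ih =>
    have hx := hxy.reachable hy
    obtain ⟨S, hS, hS'⟩ := ih hx
    refine ⟨insert x S, ?_, ?_⟩
    · rw [Finset.card_insert_of_notMem fun hxS => hA x hx (hS' x hxS), hS]
    · intro z hz
      rcases Finset.mem_insert.1 hz with rfl | hz
      · exact hxy
      · exact (hS' z hz).trans hxy

theorem HeightGE.le_card [Fintype Q] {A : StairBuchiDVPA C I R Q Γ}
    (hA : ∀ x : Q × Q, A.ReachableState x.1 → ¬ A.Prec x x) {y : Q × Q} {n : ℕ}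
    (h : A.HeightGE y n) (hy : A.ReachableState y.1) : n ≤ Fintype.card Q * Fintype.card Q := by
  obtain ⟨S, rfl, hS⟩ := h.exists_chain hA hy
  have hyS : y ∉ S := fun hyS => hA y hy (hS y hyS)
  rw [← Finset.card_cons hyS, ← Fintype.card_prod]
  exact Finset.card_le_univ _

/-- The properties of the height of pairs that make the simulation correct. -/
structure IsRank (A : StairBuchiDVPA C I R Q Γ) (H : ℕ) (t : Q × Q → ℕ) : Prop where
  -- Nothing is required of pairs with an unreachable first component: there `ht` may be the
  -- supremum of an unbounded set, which is `0` by convention.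
  pos : ∀ x, A.ReachableState x.1 → 1 ≤ t x
  le : ∀ x, A.ReachableState x.1 → x.1 ∉ A.final → x.2 ∉ A.final → t x ≤ H
  lt : ∀ x y, A.ReachableState y.1 → A.Prec x y → t x < t y
  exists_prec : ∀ y, A.ReachableState y.1 → t y ≤ 1 ∨ ∃ x, A.Prec x y ∧ t y ≤ t x + 1

theorem isRank_ht [Fintype Q] {A : StairBuchiDVPA C I R Q Γ}
    (hA : ∀ x : Q × Q, A.ReachableState x.1 → ¬ A.Prec x x) {H : ℕ}
    (hH : ∀ x : Q × Q, A.ReachableState x.1 → x.1 ∉ A.final → x.2 ∉ A.final → A.ht x ≤ H) :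
    A.IsRank H A.ht := by
  have hb : ∀ x : Q × Q, A.ReachableState x.1 → BddAbove {n | A.HeightGE x n} := fun x hx =>
    ⟨_, fun n hn => HeightGE.le_card hA hn hx⟩
  have hm : ∀ x : Q × Q, A.ReachableState x.1 → A.HeightGE x (A.ht x) := fun x hx =>
    Nat.sSup_mem ⟨1, .one x⟩ (hb x hx)
  refine ⟨fun x hx => (hm x hx).pos, hH, fun x y hy hxy => ?_, fun y hy => ?_⟩
  · exact le_csSup (hb y hy) (HeightGE.succ x y _ hxy (hm x (hxy.reachable hy)))
  · have h := hm y hy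
    generalize A.ht y = n at h
    cases h with
    | one => exact .inl le_rfl
    | succ x y n hxy hx =>
      exact .inr ⟨x, hxy, Nat.succ_le_succ (le_csSup (hb x (hxy.reachable hy)) hx)⟩

/-- By `Prec.of_wraps` whatever is below the inner pair is below the outer one, although the inner
pair itself need not be. -/
theorem IsRank.le_of_wraps {A : StairBuchiDVPA C I R Q Γ} {H : ℕ} {t : Q × Q → ℕ}
    (ht : A.IsRank H t) {p p' q q' : Q} {b : Prop} (hp : A.ReachableState p)
    (hq : A.ReachableState q) (h : A.Wraps q q' p p' b) (hqF : q ∉ A.final) (hqF' : q' ∉ A.final) :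
    t (p, p') ≤ t (q, q') := by
  rcases ht.exists_prec (p, p') hp with h1 | ⟨x, hx, h1⟩
  · exact h1.trans (ht.pos _ hq)
  · exact h1.trans (ht.lt x (q, q') hq (hx.of_wraps h hqF hqF'))

/-! ### The simulating automaton for a given rank function -/

/-- States of the simulating automaton with `H + 1` counters. -/
abbrev CounterState (A : StairBuchiDVPA C I R Q Γ) [Fintype Q] (H : ℕ) : Type :=
  Q × (Fin (H + 1) → Fin (A.bound + 1)) × (Fin (H + 1) → Fin 2)

open Classical in
/-- The generalization of `StairBuchiDVPA.update` to any number of counters. -/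
noncomputable def counterUpdate (A : StairBuchiDVPA C I R Q Γ) [Fintype Q] (H : ℕ) (q' : Q)
    (χ : Fin (H + 1) → Fin (A.bound + 1)) (f : Fin (H + 1) → Fin 2)
    (inc : Fin (H + 1) → Prop) : A.CounterState H :=
  if q' ∈ A.final then (q', fun _ => 0, fun _ => 1)
  else
    (q',
      fun i => ⟨(χ i : ℕ) % A.bound + (if inc i then 1 else 0), by
        have h : (χ i : ℕ) % A.bound < A.bound := Nat.mod_lt _ (Nat.succ_pos _)
        split_ifs <;> omega⟩,
      fun i => if (χ i : ℕ) < A.bound then f i else 0)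

open Classical in
/-- The generalization of `StairBuchiDVPA.simPrio` to any number of counters. -/
noncomputable def counterPrio (A : StairBuchiDVPA C I R Q Γ) [Fintype Q] (H : ℕ)
    (s : A.CounterState H) : ℕ :=
  if h : (Finset.univ.filter fun i => (s.2.1 i : ℕ) = A.bound).Nonempty then
    let d := (Finset.univ.filter fun i => (s.2.1 i : ℕ) = A.bound).max' h
    2 * (d : ℕ) + 1 + (s.2.2 d : ℕ)
  else 0

/-- The generalization of `StairBuchiDVPA.sim` to any number of counters and any rank function. -/
noncomputable def counterSim (A : StairBuchiDVPA C I R Q Γ) [Fintype Q] (H : ℕ) (t : Q × Q → ℕ) :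
    ParityDVPA C I R (A.CounterState H) (Γ × A.CounterState H) where
  init := (A.init, fun _ => 0, fun _ => 1)
  call s c := (A.counterUpdate H (A.call s.1 c).1 s.2.1 s.2.2 (fun i => i = 0),
    ((A.call s.1 c).2, s))
  int s a := A.counterUpdate H (A.int s.1 a) s.2.1 s.2.2 (fun i => i = 0)
  ret s Z r := A.counterUpdate H (A.ret s.1 Z.1 r) Z.2.2.1 Z.2.2.2
    (fun i => Z.2.1 ∉ A.final ∧ (i : ℕ) ≤ t (Z.2.1, A.ret s.1 Z.1 r))
  prio := A.counterPrio H

end StairBuchiDVPA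

/-! ### Parents of positions -/

section Parents

variable {C I R Q Γ : Type}

/-- The height at position `n` of an infinite word. -/
def heightAt (w : ℕ → Letter C I R) (n : ℕ) : ℕ := endHeight 0 (seg w 0 n)

/-- `seg w p n` is minimally well matched. -/
def IsFactor (w : ℕ → Letter C I R) (p n : ℕ) : Prop :=
  ∃ c r m, n = m + 1 ∧ p < m ∧ w p = .call c ∧ w m = .ret r ∧ WellMatched (seg w (p + 1) m)

/-- `p` is the last step before `n` of the prefix of length `n` of `w`. -/
def IsParent (w : ℕ → Letter C I R) (p n : ℕ) : Prop :=
  (n = p + 1 ∧ ∀ r, w p ≠ .ret r) ∨ IsFactor w p n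

theorem DVPM.length_confAt (M : DVPM C I R Q Γ) (w : ℕ → Letter C I R) (n : ℕ) :
    (M.confAt w n).2.length = heightAt w n := M.length_runOn _ _

variable {w : ℕ → Letter C I R}

theorem heightAt_eq {n m : ℕ} (h : n ≤ m) :
    heightAt w m = endHeight (heightAt w n) (seg w n m) := by
  rw [heightAt, heightAt, ← endHeight_append, seg_append w (Nat.zero_le n) h]

theorem heightAt_succ (n : ℕ) : heightAt w (n + 1) = endHeight (heightAt w n) [w n] := by
  rw [heightAt_eq (Nat.le_succ n), seg_succ _ le_rfl, seg_self, List.nil_append]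

theorem IsFactor.heightAt {p n : ℕ} (hw : ∀ n, Fits 0 (seg w 0 n)) (h : IsFactor w p n) :
    p + 1 < n ∧ heightAt w n = heightAt w p ∧ heightAt w (p + 1) = heightAt w p + 1 ∧
      ∀ k, p < k → k < n → heightAt w p < heightAt w k := by
  obtain ⟨c, r, m, rfl, hpm, hc, hr, hm⟩ := h
  have h1 : _root_.heightAt w (p + 1) = _root_.heightAt w p + 1 := by
    rw [heightAt_succ, hc]; rfl
  have h2 : _root_.heightAt w m = _root_.heightAt w p + 1 := by
    rw [heightAt_eq (Nat.succ_le_of_lt hpm), h1, (hm.fits.1.of_zero _).2, hm.fits.2, zero_add]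
  refine ⟨by omega, ?_, h1, fun k hk hkm => ?_⟩
  · rw [heightAt_succ, h2, hr]; rfl
  · have := ((isStair_iff hw).1 ⟨Nat.succ_le_of_lt hpm, hm.fits.1⟩).2 k hk (Nat.lt_succ_iff.1 hkm)
    change _root_.heightAt w (p + 1) ≤ _root_.heightAt w k at this
    omega

theorem IsParent.heightAt {p n : ℕ} (hw : ∀ n, Fits 0 (seg w 0 n)) (h : IsParent w p n) :
    p < n ∧ heightAt w p ≤ heightAt w n ∧ ∀ k, p < k → k < n → heightAt w n < heightAt w k := by
  rcases h with ⟨rfl, h⟩ | h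
  · refine ⟨Nat.lt_succ_self p, ?_, fun k hk hk' => by omega⟩
    rw [heightAt_succ]
    cases hx : w p with
    | call c => exact Nat.le_succ _
    | int i => exact le_rfl
    | ret r => exact absurd hx (h r)
  · obtain ⟨h1, h2, -, h3⟩ := h.heightAt hw
    refine ⟨by omega, h2.ge, fun k hk hk' => ?_⟩
    rw [h2]
    exact h3 k hk hk'

theorem isStair_iff_heightAt {i n : ℕ} (hw : ∀ n, Fits 0 (seg w 0 n)) :
    IsStair w i n ↔ i ≤ n ∧ ∀ k, i ≤ k → k ≤ n → heightAt w i ≤ heightAt w k := isStair_iff hw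

theorem IsStair.refl (n : ℕ) : IsStair w n n := ⟨le_rfl, by simp [Fits]⟩

theorem IsStair.trans (hw : ∀ n, Fits 0 (seg w 0 n)) {i j n : ℕ} (h : IsStair w i j)
    (h' : IsStair w j n) : IsStair w i n := by
  rw [isStair_iff_heightAt hw] at *
  refine ⟨h.1.trans h'.1, fun k hik hkn => ?_⟩
  rcases le_total k j with hk | hk
  · exact h.2 k hik hk
  · exact (h.2 j h.1 le_rfl).trans (h'.2 k hk hkn)

theorem IsStair.of_le (hw : ∀ n, Fits 0 (seg w 0 n)) {i j n : ℕ} (h : IsStair w i n)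
    (hij : i ≤ j) (hjn : j ≤ n) : IsStair w i j := by
  rw [isStair_iff_heightAt hw] at *
  exact ⟨hij, fun k hk hk' => h.2 k hk (hk'.trans hjn)⟩

theorem IsParent.isStair (hw : ∀ n, Fits 0 (seg w 0 n)) {p n : ℕ} (h : IsParent w p n) :
    IsStair w p n := by
  obtain ⟨h1, h2, h3⟩ := h.heightAt hw
  refine (isStair_iff_heightAt hw).2 ⟨h1.le, fun k hk hk' => ?_⟩
  rcases hk.eq_or_lt with rfl | hk
  · rfl
  · rcases hk'.eq_or_lt with rfl | hk'
    · exact h2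
    · exact h2.trans (h3 k hk hk').le

/-- Positions strictly between `p` and `n` are higher than `n`, so they are not steps. Steps of a
prefix can therefore be handled by induction along parents. -/
theorem IsStair.parent (hw : ∀ n, Fits 0 (seg w 0 n)) {i p n : ℕ} (h : IsStair w i n)
    (hin : i ≠ n) (hp : IsParent w p n) : IsStair w i p := by
  obtain ⟨h1, h2, h3⟩ := hp.heightAt hw
  have h4 := ((isStair_iff_heightAt hw).1 h).2 n h.1 le_rfl
  have h5 : i ≤ p := by
    by_contra hi
    have := h3 i (by omega) (lt_of_le_of_ne h.1 hin)
    omega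
  exact h.of_le hw h5 h1.le

/-- The matching call is the one that pushed the topmost symbol, found by `Stair.split`; the
automaton serves only for this decomposition. -/
theorem exists_isFactor (A : StairBuchiDVPA C I R Q Γ) (hw : ∀ n, Fits 0 (seg w 0 n)) {m : ℕ}
    {r : R} (hr : w m = .ret r) : ∃ p, IsFactor w p (m + 1) := by
  obtain ⟨q, τ, b, hs⟩ := A.exists_stair A.init (hw m)
  have h1 := hw (m + 1)
  rw [seg_succ _ (Nat.zero_le m), hr, fits_append, hs.fits.2] at h1
  cases τ with
  | nil => exact h1.2.elim
  | cons Z τ =>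
    obtain ⟨u, c, v, q₁, b₁, b₂, he, h2, -, h3⟩ := hs.split rfl
    have hl : u.length + (v.length + 1) = m := by
      have := congrArg List.length he
      simp at this
      omega
    have h4 : seg w 0 u.length ++ seg w u.length m = u ++ .call c :: v := by
      rw [seg_append w (Nat.zero_le _) (by omega), he]
    have h5 := (List.append_inj h4 (by simp)).2
    rw [seg_eq_cons w (by omega)] at h5
    obtain ⟨h6, h7⟩ := List.cons.inj h5
    exact ⟨u.length, c, r, m, rfl, by omega, h6, hr, h7 ▸ h3.wellMatched rfl⟩

theorem exists_isParent (A : StairBuchiDVPA C I R Q Γ) (hw : ∀ n, Fits 0 (seg w 0 n)) {n : ℕ}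
    (hn : n ≠ 0) : ∃ p, IsParent w p n := by
  obtain ⟨m, rfl⟩ := Nat.exists_eq_succ_of_ne_zero hn
  cases hx : w m with
  | call c => exact ⟨m, .inl ⟨rfl, fun r h => by simp [hx] at h⟩⟩
  | int i => exact ⟨m, .inl ⟨rfl, fun r h => by simp [hx] at h⟩⟩
  | ret r =>
    obtain ⟨p, hp⟩ := exists_isFactor A hw hx
    exact ⟨p, .inr hp⟩

theorem DVPM.confAt_succ (M : DVPM C I R Q Γ) (n : ℕ) :
    M.confAt w (n + 1) = M.next (M.confAt w n) (w n) := by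
  rw [M.confAt_eq w (Nat.le_succ n), seg_succ _ le_rfl, seg_self]; rfl

/-- The stack before the return of a minimally well-matched factor. -/
theorem DVPM.confAt_factor (M : DVPM C I R Q Γ) {p m : ℕ} {c : C} (hpm : p < m)
    (hc : w p = .call c) (hm : WellMatched (seg w (p + 1) m)) :
    (M.confAt w m).2 = (M.call (M.confAt w p).1 c).2 :: (M.confAt w p).2 := by
  have h1 : M.confAt w (p + 1) = ((M.call (M.confAt w p).1 c).1,
      (M.call (M.confAt w p).1 c).2 :: (M.confAt w p).2) := by
    rw [M.confAt_succ, hc]; rfl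
  rw [M.confAt_eq w (Nat.succ_le_of_lt hpm), h1]
  have h2 := M.runOn_frame (M.call (M.confAt w p).1 c).1 []
    ((M.call (M.confAt w p).1 c).2 :: (M.confAt w p).2) _ hm.fits.1
  rw [List.nil_append] at h2
  rw [h2]
  have h3 := (M.length_runOn ((M.call (M.confAt w p).1 c).1, []) (seg w (p + 1) m)).trans
    hm.fits.2
  rw [List.length_eq_zero_iff] at h3
  rw [h3, List.nil_append]

/-- Stack content below the lowest height that is passed is untouched and can be removed from the
run. -/
theorem DVPM.reach_seg (M : DVPM C I R Q Γ) (hw : ∀ n, Fits 0 (seg w 0 n)) {i n : ℕ} (h : i ≤ n)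
    {σ τ : List Γ} (hi : (M.confAt w i).2 = σ ++ τ)
    (hk : ∀ k, i ≤ k → k ≤ n → τ.length ≤ heightAt w k) :
    ∃ σ', (M.confAt w n).2 = σ' ++ τ ∧
      M.Reach (seg w i n) ((M.confAt w i).1, σ) ((M.confAt w n).1, σ') := by
  have hhi : heightAt w i = τ.length + σ.length := by
    rw [← M.length_confAt, hi, List.length_append, add_comm]
  have hf : Fits (τ.length + σ.length) (seg w i n) := hhi ▸ fits_seg hw h
  have h1 : M.Reach (seg w i n) ((M.confAt w i).1, σ ++ τ)
      ((M.confAt w n).1, (M.confAt w n).2) := by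
    rw [← hi]
    exact (M.reach_iff _ _ _).2 ⟨by rw [M.length_confAt]; exact fits_seg hw h,
      (M.confAt_eq w h).symm⟩
  refine h1.unframe ((fits_iff_le_endHeight hf).2 fun j hj => ?_)
  rw [length_seg] at hj
  rw [take_seg w (by omega), ← hhi, ← heightAt_eq (Nat.le_add_right i j)]
  exact hk _ (Nat.le_add_right i j) (by omega)

theorem StairBuchiDVPA.stair_seg (A : StairBuchiDVPA C I R Q Γ) (hw : ∀ n, Fits 0 (seg w 0 n))
    {i n : ℕ} (h : IsStair w i n) :
    ∃ σ, (A.confAt w n).2 = σ ++ (A.confAt w i).2 ∧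
      A.Stair (A.confAt w i).1 (seg w i n) (A.confAt w n).1 σ
        (∃ k, i ≤ k ∧ IsStair w k n ∧ (A.confAt w k).1 ∈ A.final) := by
  have hst := ((isStair_iff_heightAt hw).1 h).2
  obtain ⟨σ, h1, h2⟩ := A.reach_seg hw h.1 (σ := []) (τ := (A.confAt w i).2) rfl
    (fun k hk hk' => by rw [A.length_confAt]; exact hst k hk hk')
  obtain ⟨b, hb⟩ := stair_of_reach h2
  refine ⟨σ, h1, hb.congr ?_⟩
  have hstate : ∀ k, i ≤ k → k ≤ n →
      (A.runOn ((A.confAt w i).1, []) (seg w i k)).1 = (A.confAt w k).1 := fun k hk hk' => by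
    have h3 := A.runOn_frame (A.confAt w i).1 [] (A.confAt w i).2 (seg w i k) (h.of_le hw hk hk').2
    rw [A.confAt_eq w hk, ← Prod.mk.eta (p := A.confAt w i)]
    rw [List.nil_append] at h3
    rw [h3]
  rw [hb.flag_iff]
  constructor
  · rintro ⟨u₁, u₂, he, h3, h4⟩
    have hl : u₁.length ≤ n - i := by
      have := congrArg List.length he
      simp at this
      omega
    have h5 : seg w i (i + u₁.length) = u₁ := by
      rw [← take_seg w (m := n) (by have := h.1; omega), he, List.take_left]
    have hle : i + u₁.length ≤ n := by have := h.1; omega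
    refine ⟨i + u₁.length, Nat.le_add_right _ _, ⟨hle, ?_⟩, ?_⟩
    · rw [← seg_append w (Nat.le_add_right i u₁.length) hle, h5] at he
      rwa [List.append_cancel_left he]
    · rwa [← hstate _ (Nat.le_add_right _ _) hle, h5]
  · rintro ⟨k, hik, hk, hF⟩
    exact ⟨_, _, (seg_append w hik hk.1).symm, hk.2, by rwa [hstate k hik hk.1]⟩

theorem StairBuchiDVPA.reachable_confAt (A : StairBuchiDVPA C I R Q Γ)
    (hw : ∀ n, Fits 0 (seg w 0 n)) (n : ℕ) : A.ReachableState (A.confAt w n).1 :=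
  ⟨seg w 0 n, (A.confAt w n).2, (A.reach_iff _ _ _).2 ⟨hw n, rfl⟩⟩

/-- Cut a well-matched piece from `a` to `e` out of a factor: the stacks at `a` and `e` agree, so
what is built up before `a` is exactly what is removed after `e`. -/
theorem StairBuchiDVPA.wraps_seg (A : StairBuchiDVPA C I R Q Γ) (hw : ∀ n, Fits 0 (seg w 0 n))
    {s s' a e : ℕ} (h : IsFactor w s s') (hsa : s < a) (hae : IsStair w a e) (hes : e < s')
    (he : heightAt w e = heightAt w a) :
    A.Wraps (A.confAt w s).1 (A.confAt w s').1 (A.confAt w a).1 (A.confAt w e).1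
      (∃ k, s < k ∧ IsStair w k a ∧ (A.confAt w k).1 ∈ A.final) := by
  obtain ⟨-, -, hs1, hh⟩ := h.heightAt hw
  obtain ⟨c, r, m, rfl, hsm, hc, hr, hm⟩ := h
  have hst : IsStair w (s + 1) a := (isStair_iff_heightAt hw).2 ⟨hsa, fun k hk hk' => by
    have := hh k hk (by have := hae.1; omega)
    omega⟩
  obtain ⟨σ, h1, h2⟩ := A.stair_seg hw hst
  have hbase : (A.confAt w (s + 1)) = ((A.call (A.confAt w s).1 c).1,
      (A.call (A.confAt w s).1 c).2 :: (A.confAt w s).2) := by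
    rw [A.confAt_succ, hc]; rfl
  obtain ⟨υ, h3, -⟩ := A.stair_seg hw hae
  have hυ : υ = [] := by
    have := congrArg List.length h3
    rw [List.length_append, A.length_confAt, A.length_confAt] at this
    exact List.length_eq_zero_iff.1 (by omega)
  rw [hυ, List.nil_append, h1] at h3
  have hlen : (A.confAt w (s + 1)).2.length = heightAt w (s + 1) := A.length_confAt _ _
  have hes' : e ≤ m := Nat.lt_succ_iff.1 hes
  obtain ⟨σ', h4, h5⟩ := A.reach_seg hw hes' h3 (fun k hk hk' => by
    have := hh k (by have := hae.1; omega) (by omega)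
    omega)
  have hfac := A.confAt_factor hsm hc hm
  have hσ' : σ' = [] := by
    rw [hbase, hfac] at h4
    have := congrArg List.length h4
    simp only [List.length_append, List.length_cons] at this
    exact List.length_eq_zero_iff.1 (by omega)
  subst hσ'
  have h2' : A.Stair (A.call (A.confAt w s).1 c).1 _ _ _ _ := (congrArg Prod.fst hbase) ▸ h2
  refine ⟨c, _, σ, _, _, r, h2', h5, ?_⟩
  rw [A.confAt_succ, hr, ← Prod.mk.eta (p := A.confAt w m), hfac]
  rfl

end Parents

/-! ### The counters along a run -/

namespace StairBuchiDVPA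

variable {C I R Q Γ : Type} [Fintype Q] {A : StairBuchiDVPA C I R Q Γ} {H : ℕ} {t : Q × Q → ℕ}
  {w : ℕ → Letter C I R}

variable (A H t w) in
/-- The value of counter `d` at position `n`. -/
noncomputable def counterAt (n : ℕ) (d : Fin (H + 1)) : ℕ :=
  (((A.counterSim H t).confAt w n).1.2.1 d : ℕ)

variable (A H t w) in
/-- The flag of counter `d` at position `n`. -/
noncomputable def flagAt (n : ℕ) (d : Fin (H + 1)) : Fin 2 :=
  ((A.counterSim H t).confAt w n).1.2.2 d

variable (A H t w) in
/-- Counter `d` is increased between position `p` and the position `n` with parent `p`. -/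
def Increases (p n : ℕ) (d : Fin (H + 1)) : Prop :=
  (n = p + 1 ∧ d = 0) ∨ (IsFactor w p n ∧ (A.confAt w p).1 ∉ A.final ∧
    (d : ℕ) ≤ t ((A.confAt w p).1, (A.confAt w n).1))

@[simp] theorem counterUpdate_fst (q : Q) (χ : Fin (H + 1) → Fin (A.bound + 1))
    (f : Fin (H + 1) → Fin 2) (inc : Fin (H + 1) → Prop) :
    (A.counterUpdate H q χ f inc).1 = q := by
  unfold counterUpdate
  split_ifs <;> rfl

theorem counterSim_next (s : A.CounterState H × List (Γ × A.CounterState H)) (x : Letter C I R) :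
    A.next (s.1.1, s.2.map Prod.fst) x =
      (((A.counterSim H t).next s x).1.1, ((A.counterSim H t).next s x).2.map Prod.fst) := by
  obtain ⟨q, σ⟩ := s
  cases x with
  | call c => simp [DVPM.next, counterSim]
  | int i => simp [DVPM.next, counterSim]
  | ret r => cases σ <;> simp [DVPM.next, counterSim]

theorem counterSim_confAt (n : ℕ) :
    A.confAt w n = (((A.counterSim H t).confAt w n).1.1,
      ((A.counterSim H t).confAt w n).2.map Prod.fst) := by
  induction n with
  | zero => rfl
  | succ n ih => rw [A.confAt_succ, (A.counterSim H t).confAt_succ, ih, counterSim_next (t := t)]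

theorem counterSim_state (n : ℕ) : ((A.counterSim H t).confAt w n).1.1 = (A.confAt w n).1 := by
  rw [counterSim_confAt (H := H) (t := t)]

/-- On a return the popped symbol holds the state before the matching call, that is, the state at
the parent. Counters and flags thus ignore everything inside completed factors, apart from the end
states of the factor. -/
theorem counterSim_parent {p n : ℕ} (h : IsParent w p n) :
    ((A.counterSim H t).confAt w n).1 = A.counterUpdate H (A.confAt w n).1
      ((A.counterSim H t).confAt w p).1.2.1 ((A.counterSim H t).confAt w p).1.2.2
      (A.Increases H t w p n) := by
  rcases h with ⟨rfl, h⟩ | h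
  · have hI : A.Increases H t w p (p + 1) = fun i => i = 0 := by
      funext i
      refine propext ⟨?_, fun h => .inl ⟨rfl, h⟩⟩
      rintro (⟨-, h⟩ | ⟨⟨c, r, m, h1, h2, -⟩, -⟩)
      · exact h
      · omega
    rw [hI, ← counterSim_state (H := H) (t := t), (A.counterSim H t).confAt_succ]
    generalize (A.counterSim H t).confAt w p = s
    obtain ⟨⟨q, χ, f⟩, σ⟩ := s
    cases hx : w p with
    | call c => simp [DVPM.next, counterSim]
    | int i => simp [DVPM.next, counterSim]
    | ret r => exact absurd hx (h r)
  · have hI : A.Increases H t w p n = fun i : Fin (H + 1) => (A.confAt w p).1 ∉ A.final ∧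
        (i : ℕ) ≤ t ((A.confAt w p).1, (A.confAt w n).1) := by
      funext i
      refine propext ⟨?_, fun hi => .inr ⟨h, hi⟩⟩
      rintro (⟨rfl, -⟩ | h')
      · obtain ⟨c, r, m, h1, h2, -⟩ := h
        omega
      · exact h'.2
    rw [hI, ← counterSim_state (H := H) (t := t), ← counterSim_state (H := H) (t := t)]
    obtain ⟨c, r, m, rfl, hpm, hc, hr, hm⟩ := h
    have h1 := (A.counterSim H t).confAt_factor hpm hc hm
    rw [(A.counterSim H t).confAt_succ, hr]
    generalize (A.counterSim H t).confAt w p = s at *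
    generalize (A.counterSim H t).confAt w m = s' at *
    obtain ⟨s', σ'⟩ := s'
    obtain rfl : σ' = _ := h1
    simp [DVPM.next, counterSim]

theorem counterAt_of_final {n : ℕ} (hn : n ≠ 0) (hw : ∀ n, Fits 0 (seg w 0 n))
    (hF : (A.confAt w n).1 ∈ A.final) (d : Fin (H + 1)) :
    A.counterAt H t w n d = 0 ∧ A.flagAt H t w n d = 1 := by
  obtain ⟨p, hp⟩ := exists_isParent A hw hn
  rw [counterAt, flagAt, counterSim_parent hp, counterUpdate, if_pos hF]
  simp

theorem counterAt_zero (d : Fin (H + 1)) :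
    A.counterAt H t w 0 d = 0 ∧ A.flagAt H t w 0 d = 1 := ⟨rfl, rfl⟩

open Classical in
theorem counterAt_parent {p n : ℕ} (hp : IsParent w p n) (hF : (A.confAt w n).1 ∉ A.final)
    (d : Fin (H + 1)) :
    A.counterAt H t w n d =
        A.counterAt H t w p d % A.bound + (if A.Increases H t w p n d then 1 else 0) ∧
      A.flagAt H t w n d = if A.counterAt H t w p d < A.bound then A.flagAt H t w p d else 0 := by
  rw [counterAt, flagAt, counterSim_parent hp, counterUpdate, if_neg hF]
  exact ⟨rfl, rfl⟩

theorem counterAt_le (n : ℕ) (d : Fin (H + 1)) : A.counterAt H t w n d ≤ A.bound :=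
  Nat.lt_succ_iff.1 (((A.counterSim H t).confAt w n).1.2.1 d).2

theorem bound_pos : 0 < A.bound := Nat.succ_pos _

theorem fin_two_cases (x : Fin 2) : x = 0 ∨ x = 1 := by fin_cases x <;> simp

theorem counterPrio_cases (s : A.CounterState H) :
    (A.counterPrio H s = 0 ∧ ∀ d, (s.2.1 d : ℕ) ≠ A.bound) ∨
      ∃ d, (s.2.1 d : ℕ) = A.bound ∧ (∀ e, (s.2.1 e : ℕ) = A.bound → e ≤ d) ∧
        A.counterPrio H s = 2 * (d : ℕ) + 1 + (s.2.2 d : ℕ) := by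
  classical
  unfold counterPrio
  split_ifs with h
  · right
    refine ⟨_, (Finset.mem_filter.1 (Finset.max'_mem _ h)).2, fun e he => ?_, ?_⟩
    · exact Finset.le_max' _ _ (Finset.mem_filter.2 ⟨Finset.mem_univ e, he⟩)
    · convert rfl
  · left
    refine ⟨rfl, fun d hd => h ⟨d, Finset.mem_filter.2 ⟨Finset.mem_univ d, hd⟩⟩⟩

variable (A H t w) in
/-- The priority at position `n`. -/
noncomputable def prioAt (n : ℕ) : ℕ := A.counterPrio H ((A.counterSim H t).confAt w n).1

theorem prioAt_le (n : ℕ) : A.prioAt H t w n ≤ 2 * H + 2 := by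
  rcases counterPrio_cases ((A.counterSim H t).confAt w n).1 with ⟨h, -⟩ | ⟨d, -, -, h⟩
  · rw [prioAt, h]
    omega
  · rw [prioAt, h]
    omega

theorem lt_prioAt {n : ℕ} {d : Fin (H + 1)} (h : A.counterAt H t w n d = A.bound) :
    2 * (d : ℕ) < A.prioAt H t w n := by
  rcases counterPrio_cases ((A.counterSim H t).confAt w n).1 with ⟨-, h'⟩ | ⟨e, -, h1, h2⟩
  · exact absurd h (h' d)
  · have : (d : ℕ) ≤ e := h1 d h
    rw [prioAt, h2]
    omega

/-- Flag and counter decrease along the order of the counters. -/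
theorem flagAt_mono (hw : ∀ n, Fits 0 (seg w 0 n)) {d e : Fin (H + 1)} (hde : d ≤ e) (n : ℕ)
    (hf : A.flagAt H t w n d = 1) :
    A.flagAt H t w n e = 1 ∧ A.counterAt H t w n e ≤ A.counterAt H t w n d := by
  classical
  induction n using Nat.strong_induction_on with
  | _ n ih =>
    rcases eq_or_ne n 0 with rfl | hn
    · exact ⟨rfl, le_rfl⟩
    by_cases hF : (A.confAt w n).1 ∈ A.final
    · simp [counterAt_of_final hn hw hF]
    obtain ⟨p, hp⟩ := exists_isParent A hw hn
    obtain ⟨h1, h2⟩ := counterAt_parent (t := t) hp hF d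
    obtain ⟨h3, h4⟩ := counterAt_parent (t := t) hp hF e
    rw [h2] at hf
    split_ifs at hf with h5
    · obtain ⟨h6, h7⟩ := ih p (hp.heightAt hw).1 hf
      have h8 : A.counterAt H t w p e < A.bound := h7.trans_lt h5
      rw [h4, if_pos h8, h1, h3, Nat.mod_eq_of_lt h5, Nat.mod_eq_of_lt h8]
      refine ⟨h6, Nat.add_le_add h7 ?_⟩
      -- The increased counters form an initial segment, so an increment of `e` comes with one of
      -- every `d ≤ e`.
      have h9 : A.Increases H t w p n e → A.Increases H t w p n d := by
        rintro (⟨h, rfl⟩ | ⟨h, h', h''⟩)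
        · exact .inl ⟨h, le_antisymm hde (Fin.zero_le _)⟩
        · exact .inr ⟨h, h', le_trans hde h''⟩
      split_ifs <;> tauto
    · simp at hf

/-- A cleared flag stems from a position at which the counter has reached its bound for the first
time. -/
theorem exists_of_flagAt_eq_zero (hw : ∀ n, Fits 0 (seg w 0 n)) {d : Fin (H + 1)} (n : ℕ)
    (hf : A.flagAt H t w n d = 0) :
    ∃ k, IsStair w k n ∧ (∀ i, k ≤ i → IsStair w i n → (A.confAt w i).1 ∉ A.final) ∧
      A.counterAt H t w k d = A.bound ∧ A.flagAt H t w k d = 1 := by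
  classical
  induction n using Nat.strong_induction_on with
  | _ n ih =>
    rcases eq_or_ne n 0 with rfl | hn
    · exact absurd ((counterAt_zero (A := A) (t := t) (w := w) d).2.symm.trans hf) (by simp)
    by_cases hF : (A.confAt w n).1 ∈ A.final
    · exact absurd ((counterAt_of_final (t := t) hn hw hF d).2.symm.trans hf) (by simp)
    obtain ⟨p, hp⟩ := exists_isParent A hw hn
    obtain ⟨h1, h2⟩ := counterAt_parent (t := t) hp hF d
    have hpn := (hp.heightAt hw).1
    by_cases hp1 : A.flagAt H t w p d = 0
    · obtain ⟨k, h3, h4, h5⟩ := ih p hpn hp1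
      refine ⟨k, h3.trans hw (hp.isStair hw), fun i hi hin => ?_, h5⟩
      rcases eq_or_ne i n with rfl | hne
      · exact hF
      · exact h4 i hi (hin.parent hw hne hp)
    · replace hp1 := (fin_two_cases _).resolve_left hp1
      rw [h2] at hf
      split_ifs at hf with h5
      · rw [hp1] at hf
        exact absurd hf (by simp)
      · have hpb : A.counterAt H t w p d = A.bound :=
          le_antisymm (counterAt_le p d) (not_lt.1 h5)
        refine ⟨p, hp.isStair hw, fun i hi hin => ?_, hpb, hp1⟩
        rcases eq_or_ne i n with rfl | hne
        · exact hF
        · have h6 := hin.parent hw hne hp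
          obtain rfl : i = p := le_antisymm h6.1 hi
          -- At a final state and at position `0` the counter is `0`, whereas it is at its positive
          -- bound here.
          intro hF'
          rcases eq_or_ne i 0 with rfl | hi0
          · rw [(counterAt_zero d).1] at hpb
            exact (bound_pos (A := A)).ne hpb
          · rw [(counterAt_of_final hi0 hw hF' d).1] at hpb
            exact (bound_pos (A := A)).ne hpb

/-- An accepting run of the stair Büchi automaton is accepting for the simulation. -/
theorem mem_counterSim_lang (h : w ∈ A.lang) : w ∈ (A.counterSim H t).lang := by
  obtain ⟨hw, hF⟩ := (A.mem_lang_iff w).1 h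
  refine ((A.counterSim H t).mem_lang_iff w).2 ⟨hw, ?_⟩
  obtain ⟨P, hP⟩ := exists_isGreatest_frequently (f := A.prioAt H t w) prioAt_le
  refine ⟨P, hP, ?_⟩
  by_contra hodd
  -- An odd `P` means a full counter `d` with cleared flag. When `d` first became full, its flag was
  -- set, and by `flagAt_mono` so was that of the greatest full counter `e ≥ d`; the priority there
  -- is `2e+2 > P`. This position lies after the final step `g`, hence beyond `N`.
  have key : ∃ᶠ n in atTop, P + 1 ≤ A.prioAt H t w n := by
    refine frequently_atTop.2 fun N => ?_
    obtain ⟨g, hg, hgs, hgF⟩ := frequently_atTop.1 hF N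
    obtain ⟨n, hn, hnP⟩ := frequently_atTop.1 hP.1 g
    rcases counterPrio_cases ((A.counterSim H t).confAt w n).1 with ⟨h0, -⟩ | ⟨d, h1, -, h2⟩
    · exact absurd (show Even P by rw [← hnP, prioAt, h0]; exact Even.zero) hodd
    · have hPd : P = 2 * (d : ℕ) + 1 + (A.flagAt H t w n d : ℕ) := by rw [← hnP, prioAt, h2]; rfl
      have hf : A.flagAt H t w n d = 0 := by
        refine (fin_two_cases _).resolve_right fun h1 => hodd ?_
        rw [hPd, h1]
        exact ⟨d + 1, by simp; omega⟩
      obtain ⟨k, h3, h4, h5, h6⟩ := exists_of_flagAt_eq_zero hw n hf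
      refine ⟨k, ?_, ?_⟩
      · by_contra hk
        exact h4 g (by omega) (hgs n hn) hgF
      · rcases counterPrio_cases ((A.counterSim H t).confAt w k).1 with ⟨-, h7⟩ | ⟨e, -, h7, h8⟩
        · exact absurd h5 (h7 d)
        · have hde : d ≤ e := h7 d h5
          have hfe : ((((A.counterSim H t).confAt w k).1.2.2 e : Fin 2) : ℕ) = 1 :=
            congrArg Fin.val (flagAt_mono hw hde k h6).1
          have hde' : (d : ℕ) ≤ e := hde
          rw [prioAt, h8, hfe, hPd, hf]
          simp
          omega
  obtain ⟨k, hk, hk'⟩ := exists_frequently_eq prioAt_le key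
  have := hP.2 hk'
  omega

end StairBuchiDVPA

/-! ### Rejecting runs -/

namespace StairBuchiDVPA

variable {C I R Q Γ : Type} [Fintype Q] {A : StairBuchiDVPA C I R Q Γ} {H : ℕ} {t : Q × Q → ℕ}
  {w : ℕ → Letter C I R}

/-- While the flag is set and no final state occurs, the counter grows, by increments only. -/
theorem counterAt_path (hw : ∀ n, Fits 0 (seg w 0 n)) {d : Fin (H + 1)} {i : ℕ} (n : ℕ)
    (hin : IsStair w i n) (hF : ∀ k, i < k → IsStair w k n → (A.confAt w k).1 ∉ A.final)
    (hf : A.flagAt H t w n d = 1) :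
    A.flagAt H t w i d = 1 ∧ A.counterAt H t w i d ≤ A.counterAt H t w n d ∧
      (i ≠ n → A.counterAt H t w i d < A.bound) ∧
      ∀ v, A.counterAt H t w i d < v → v ≤ A.counterAt H t w n d →
        ∃ p j, IsParent w p j ∧ IsStair w j n ∧ IsStair w i p ∧ A.Increases H t w p j d ∧
          A.counterAt H t w p d + 1 = v ∧ A.counterAt H t w j d = v := by
  classical
  induction n using Nat.strong_induction_on with
  | _ n ih =>
    rcases eq_or_ne i n with rfl | hne
    · exact ⟨hf, le_rfl, fun h => absurd rfl h, fun v h1 h2 => by omega⟩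
    have hn : n ≠ 0 := by have := hin.1; omega
    obtain ⟨p, hp⟩ := exists_isParent A hw hn
    have hpn := (hp.heightAt hw).1
    have hip := hin.parent hw hne hp
    have hpst := hp.isStair hw
    obtain ⟨h1, h2⟩ := counterAt_parent (t := t) hp
      (hF n (lt_of_le_of_ne hin.1 hne) (IsStair.refl n)) d
    rw [h2] at hf
    split_ifs at hf with h5
    · obtain ⟨h6, h7, h8, h9⟩ := ih p hpn hip
        (fun k hk hkp => hF k hk (hkp.trans hw hpst)) hf
      rw [Nat.mod_eq_of_lt h5] at h1
      refine ⟨h6, by omega, fun _ => h7.trans_lt h5, fun v hv hv' => ?_⟩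
      rcases le_or_gt v (A.counterAt H t w p d) with h10 | h10
      · obtain ⟨p', j, h11, h12, h13⟩ := h9 v hv h10
        exact ⟨p', j, h11, h12.trans hw hpst, h13⟩
      · by_cases hI : A.Increases H t w p n d
        · rw [if_pos hI] at h1
          exact ⟨p, n, hp, IsStair.refl n, hip, hI, by omega, by omega⟩
        · rw [if_neg hI] at h1
          omega
    · simp at hf

omit [Fintype Q] in
/-- Inside a factor the height of the pair of its end points bounds the counters that can be
increased without passing a final state. -/
theorem le_rank_of_increases (ht : A.IsRank H t) (hw : ∀ n, Fits 0 (seg w 0 n)) {s s' p j : ℕ}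
    (hs : IsFactor w s s') (hq : (A.confAt w s).1 ∉ A.final) (hq' : (A.confAt w s').1 ∉ A.final)
    {d : Fin (H + 1)} (hsp : s < p) (hjs : j < s') (hI : A.Increases H t w p j d) :
    (d : ℕ) ≤ t ((A.confAt w s).1, (A.confAt w s').1) := by
  rcases hI with ⟨-, rfl⟩ | ⟨hpj, -, hd⟩
  · exact Nat.zero_le _
  · obtain ⟨h1, h2, -, -⟩ := hpj.heightAt hw
    exact hd.trans (ht.le_of_wraps (A.reachable_confAt hw p) (A.reachable_confAt hw s)
      (A.wraps_seg hw hs hsp (IsParent.isStair hw (.inr hpj)) hjs h2) hq hq')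

/-- Inside a factor every position is completed to a well-matched factor of maximal length. -/
theorem exists_completion (hw : ∀ n, Fits 0 (seg w 0 n)) {s s' p n : ℕ} (hs : IsFactor w s s')
    (hsp : s < p) (hp : IsStair w p n) (hn : n < s') :
    ∃ e, n ≤ e ∧ e < s' ∧ IsStair w p e ∧ heightAt w e = heightAt w p ∧
      ¬ IsStair w p (e + 1) := by
  obtain ⟨-, h1, -, h2⟩ := hs.heightAt hw
  have hns' : ¬ IsStair w p s' := fun h => by
    have h3 := ((isStair_iff_heightAt hw).1 h).2 s' h.1 le_rfl
    have h4 := h2 p hsp (hp.1.trans_lt hn)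
    omega
  have hex : ∃ k, ¬ IsStair w p (n + k) := ⟨s' - n, by rwa [Nat.add_sub_cancel' hn.le]⟩
  classical
  have hk := Nat.find_spec hex
  have hmin := fun m => Nat.find_min hex (m := m)
  generalize Nat.find hex = k at hk hmin
  obtain ⟨k, rfl⟩ : ∃ l, k = l + 1 := Nat.exists_eq_succ_of_ne_zero (by rintro rfl; exact hk hp)
  have hst : IsStair w p (n + k) := not_not.1 (hmin k (Nat.lt_succ_self k))
  have hlt : n + k < s' := by
    by_contra h
    exact hmin (s' - n) (by omega) (by rwa [Nat.add_sub_cancel' hn.le])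
  refine ⟨n + k, Nat.le_add_right _ _, hlt, hst, ?_, hk⟩
  have h3 := (isStair_iff_heightAt hw).1 hst
  have h4 := h3.2 (n + k) h3.1 le_rfl
  by_contra hne
  refine hk ((isStair_iff_heightAt hw).2 ⟨by omega, fun l hl hl' => ?_⟩)
  rcases Nat.lt_or_ge l (n + k + 1) with h5 | h5
  · exact h3.2 l hl (by omega)
  · obtain rfl : l = n + k + 1 := le_antisymm hl' h5
    -- The height drops by at most one per letter, so just before falling below the height of `p`
    -- the run is exactly at that height.
    have h5 : heightAt w (n + k) ≤ heightAt w (n + k + 1) + 1 := by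
      rw [heightAt_succ (n + k)]
      cases w (n + k) <;> simp [endHeight] <;> omega
    omega

/-- If a counter reaches its bound for the first time after a final state inside a factor, then the
height of the pair of the end points of the factor is greater than the index of the counter. -/
theorem lt_rank_of_counterAt_eq_bound (ht : A.IsRank H t) (hw : ∀ n, Fits 0 (seg w 0 n))
    {s s' n : ℕ} (hs : IsFactor w s s') (hq : (A.confAt w s).1 ∉ A.final)
    (hq' : (A.confAt w s').1 ∉ A.final) {d : Fin (H + 1)} (hn : n < s')
    (hF : ∃ k, s < k ∧ IsStair w k n ∧ (A.confAt w k).1 ∈ A.final)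
    (hc : A.counterAt H t w n d = A.bound) (hf : A.flagAt H t w n d = 1) :
    (d : ℕ) < t ((A.confAt w s).1, (A.confAt w s').1) := by
  classical
  -- Counter `0` is also increased by single letters, which yield no factors; there the positivity
  -- of the rank suffices.
  rcases Nat.eq_zero_or_pos (d : ℕ) with hd0 | hd0
  · rw [hd0]
    exact ht.pos _ (A.reachable_confAt hw s)
  -- the last final state
  obtain ⟨i, hsi, hin, hiF, hmax⟩ : ∃ i, s < i ∧ IsStair w i n ∧ (A.confAt w i).1 ∈ A.final ∧
      ∀ k, i < k → IsStair w k n → (A.confAt w k).1 ∉ A.final := by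
    let P : ℕ → Prop := fun k => s < k ∧ IsStair w k n ∧ (A.confAt w k).1 ∈ A.final
    obtain ⟨k, hk⟩ := hF
    have h1 : P (Nat.findGreatest P n) := Nat.findGreatest_spec hk.2.1.1 hk
    refine ⟨_, h1.1, h1.2.1, h1.2.2, fun k hk hkn hkF => ?_⟩
    exact Nat.findGreatest_is_greatest hk hkn.1 ⟨h1.1.trans hk, hkn, hkF⟩
  have hci : A.counterAt H t w i d = 0 := (counterAt_of_final (by omega) hw hiF d).1
  obtain ⟨-, -, -, hv⟩ := counterAt_path hw n hin hmax hf
  -- From the last final state, where it is `0`, the counter climbs by ones to `|Q|³+1`. Each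
  -- increment happens at a factor from `p` to `j`, and `e` is where the run last is at the height
  -- of `p` before falling below it. One of the `|Q|³` triples of states at `p`, `j`, `e` must
  -- repeat.
  have hdata : ∀ v : Fin A.bound, ∃ p j e, IsFactor w p j ∧ IsStair w j n ∧ IsStair w i p ∧
      (A.confAt w p).1 ∉ A.final ∧ (d : ℕ) ≤ t ((A.confAt w p).1, (A.confAt w j).1) ∧
      A.counterAt H t w p d = v ∧ A.counterAt H t w j d = v + 1 ∧ n ≤ e ∧ e < s' ∧
      IsStair w p e ∧ heightAt w e = heightAt w p ∧ ¬ IsStair w p (e + 1) := by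
    intro v
    obtain ⟨p, j, h1, h2, h3, h4, h5, h6⟩ := hv (v + 1) (by omega) (by have := v.2; omega)
    rcases h4 with ⟨-, rfl⟩ | ⟨h4, h7, h8⟩
    · simp at hd0
    · have hpn := (h1.isStair hw).trans hw h2
      obtain ⟨e, he⟩ := exists_completion hw hs (hsi.trans_le h3.1) hpn hn
      exact ⟨p, j, e, h4, h2, h3, h7, h8, by omega, h6, he⟩
  choose p j e hpj hjn hip hpF hdt hcp hcj hne hes hpe hhe hpe' using hdata
  -- two increments with the same states
  obtain ⟨v, v', hvv, hpq⟩ := Fintype.exists_ne_map_eq_of_card_lt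
    (fun v : Fin A.bound => ((A.confAt w (p v)).1, (A.confAt w (j v)).1, (A.confAt w (e v)).1))
    (by
      rw [Fintype.card_fin, Fintype.card_prod, Fintype.card_prod, bound]
      exact Nat.lt_succ_of_le (le_of_eq (by ring)))
  wlog hlt : v < v' generalizing v v'
  · exact this v' v hvv.symm hpq.symm (lt_of_le_of_ne (not_lt.1 hlt) hvv.symm)
  simp only [Prod.mk.injEq] at hpq
  obtain ⟨hqp, hqj, hqe⟩ := hpq
  have hpar : ∀ v, IsParent w (p v) (j v) := fun v => .inr (hpj v)
  have hpn : ∀ v, IsStair w (p v) n := fun v => ((hpar v).isStair hw).trans hw (hjn v)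
  -- Otherwise `p v'` would be at or before `p v` on the chain, although the counter is greater at
  -- `p v'` and never decreases there.
  have hjp : j v ≤ p v' := by
    by_contra hcon
    have h1 : IsStair w (p v') (p v) :=
      ((hpn v').of_le hw (not_le.1 hcon).le (hjn v).1).parent hw (by omega) (hpar v)
    obtain ⟨h2, -, -, -⟩ := counterAt_path hw n (hpn v)
      (fun k hk hkn => hmax k ((hip v).1.trans_lt hk) hkn) hf
    obtain ⟨-, h3, -, -⟩ := counterAt_path hw (p v) h1
      (fun k hk hkn => hmax k ((hip v').1.trans_lt hk) (hkn.trans hw (hpn v))) h2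
    have hlt' : (v : ℕ) < v' := hlt
    rw [hcp, hcp] at h3
    omega
  have hij : i < j v := (hip v).1.trans_lt ((hpar v).heightAt hw).1
  have hjpst : IsStair w (j v) (p v') := (hjn v).of_le hw hjp (hpn v').1
  have hppst : IsStair w (p v) (p v') := ((hpar v).isStair hw).trans hw hjpst
  have hee : e v' ≤ e v := by
    by_contra hcon
    refine hpe' v (hppst.trans hw ((hpe v').of_le hw ?_ (not_le.1 hcon)))
    have := (hpn v').1
    have := hne v
    omega
  have hhj : heightAt w (j v) = heightAt w (p v) := ((hpj v).heightAt hw).2.1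
  have hW := A.wraps_seg hw hs (hsi.trans_le (hip v).1) (hpe v) (hes v) (hhe v)
  -- The loop goes from `p v` through `j v` to `p v'`, which has the same state as `p v`. The
  -- crossing leads from `p v` to `e v`, and the segment from `e v'` to `e v` removes the content
  -- `σ` pushed between `j v` and `p v'`.
  have hP : A.Pumps (A.confAt w (p v)).1 (A.confAt w (j v)).1 (A.confAt w (e v)).1 := by
    obtain ⟨σ₀, h1, h2⟩ := A.stair_seg hw ((hpar v).isStair hw)
    obtain ⟨σ, h3, h4⟩ := A.stair_seg hw hjpst
    obtain ⟨σ₁, h5, h6⟩ := A.stair_seg hw (hpe v)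
    obtain ⟨σ₂, h7, h8⟩ := A.stair_seg hw (hpe v')
    have hnil : ∀ {k l : ℕ} {τ : List Γ}, (A.confAt w l).2 = τ ++ (A.confAt w k).2 →
        heightAt w l = heightAt w k → τ = [] := fun {k l τ} h h' => by
      have := congrArg List.length h
      rw [List.length_append, A.length_confAt, A.length_confAt] at this
      exact List.length_eq_zero_iff.1 (by omega)
    obtain rfl := hnil h1 hhj
    obtain rfl := hnil h5 (hhe v)
    obtain rfl := hnil h7 (hhe v')
    have h9 : (A.confAt w (e v')).2 = σ ++ (A.confAt w (p v)).2 := by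
      rw [h7, h3, h1]; rfl
    obtain ⟨σ₃, h10, h11⟩ := A.reach_seg hw hee h9 (fun k hk hk' => by
      rw [A.length_confAt]
      exact ((isStair_iff_heightAt hw).1 (hpe v)).2 k (by have := hne v'; have := (hpn v).1; omega)
        hk')
    obtain rfl : σ₃ = [] := hnil h10 (hhe v)
    rw [← hqe] at h11
    refine ⟨_, seg w (j v) (p v'), σ, _, _, h2.congr (iff_false_intro ?_), ?_, h6.reach, h11⟩
    · rintro ⟨k, hk, hkj, hkF⟩
      rcases eq_or_ne k (j v) with rfl | hne
      · exact hmax _ hij (hjn v) hkF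
      · have := (hkj.parent hw hne (hpar v)).1
        obtain rfl : k = p v := by omega
        exact hpF v hkF
    · rw [← hqp] at h4
      refine h4.congr (iff_false_intro ?_)
      rintro ⟨k, hk, hkj, hkF⟩
      exact hmax k (hij.trans_le hk) (hkj.trans hw (hpn v')) hkF
  have hprec : A.Prec ((A.confAt w (p v)).1, (A.confAt w (j v)).1)
      ((A.confAt w s).1, (A.confAt w s').1) := by
    refine prec_iff.2 ⟨hq, hq', _, ?_, hP⟩
    rwa [show (∃ k, s < k ∧ IsStair w k (p v) ∧ (A.confAt w k).1 ∈ A.final) = True from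
      eq_true ⟨i, hsi, hip v, hiF⟩] at hW
  exact (hdt v).trans_lt (ht.lt _ _ (A.reachable_confAt hw s) hprec)

/-- A position of minimal height among those from `N` on is a step. -/
theorem exists_isStep (hw : ∀ n, Fits 0 (seg w 0 n)) (N : ℕ) :
    ∃ n, N ≤ n ∧ ∀ m, n ≤ m → IsStair w n m := by
  obtain ⟨n, hn, hmin⟩ := exists_minimalFor_of_wellFoundedLT (· ∈ Set.Ici N) (heightAt w)
    ⟨N, Set.mem_Ici.2 le_rfl⟩
  refine ⟨n, hn, fun m hm => (isStair_iff_heightAt hw).2 ⟨hm, fun k hk _ => ?_⟩⟩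
  by_contra hlt
  exact hlt (hmin (Set.mem_Ici.2 ((Set.mem_Ici.1 hn).trans hk)) (not_le.1 hlt).le)

omit [Fintype Q] in
/-- The steps of a run, each of which is the parent of the next one. -/
theorem exists_step_enumeration (A : StairBuchiDVPA C I R Q Γ) (hw : ∀ n, Fits 0 (seg w 0 n)) :
    ∃ s : ℕ → ℕ, StrictMono s ∧ (∀ k, ∀ m, s k ≤ m → IsStair w (s k) m) ∧
      (∀ k, IsParent w (s k) (s (k + 1))) ∧ ∀ n, s 0 ≤ n → ∃ k, s k ≤ n ∧ n < s (k + 1) := by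
  classical
  let G : ℕ → Prop := fun n => ∀ m, n ≤ m → IsStair w n m
  have hG : {n | G n}.Infinite := Set.infinite_of_forall_exists_gt fun N => by
    obtain ⟨n, hn, hn'⟩ := exists_isStep hw (N + 1)
    exact ⟨n, hn', hn⟩
  have hmono := Nat.nth_strictMono hG
  have hmem := fun k => Nat.nth_mem_of_infinite hG k
  refine ⟨Nat.nth G, hmono, hmem, fun k => ?_, fun n hn => ?_⟩
  · obtain ⟨p, hp⟩ := exists_isParent A hw (n := Nat.nth G (k + 1))
      ((Nat.zero_le _).trans_lt (hmono (Nat.lt_succ_self k))).ne'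
    have hpl := (hp.heightAt hw).1
    have hpG : G p := fun m hm => by
      rcases le_total (Nat.nth G (k + 1)) m with h | h
      · exact (hp.isStair hw).trans hw (hmem (k + 1) m h)
      · exact (hp.isStair hw).of_le hw hm h
    have h1 : Nat.nth G k ≤ p :=
      ((hmem k _ (hmono (Nat.lt_succ_self k)).le).parent hw (hmono (Nat.lt_succ_self k)).ne hp).1
    obtain rfl : p = Nat.nth G k := by
      by_contra hne
      obtain ⟨l, rfl⟩ : ∃ l, Nat.nth G l = p := by
        have := Nat.range_nth_of_infinite hG
        exact this.symm.subset hpG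
      have h2 := hmono.lt_iff_lt.1 hpl
      have h3 := hmono.le_iff_le.1 h1
      have : l = k := by omega
      exact hne (by rw [this])
    exact hp
  · have hex : ∃ k, n < Nat.nth G (k + 1) := ⟨n, hmono.le_apply.trans_lt (hmono (Nat.lt_succ_self n))⟩
    refine ⟨Nat.find hex, ?_, Nat.find_spec hex⟩
    rcases h : Nat.find hex with _ | k
    · exact hn
    · exact not_lt.1 (Nat.find_min hex (by omega))

/-- A counter that is increased infinitely often reaches its bound infinitely often. -/
theorem frequently_eq_of_frequently_add {m : ℕ} {a : ℕ → ℕ} {P : ℕ → Prop} [DecidablePred P]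
    (hm : ∀ k, a k ≤ m) (ha : ∀ᶠ k in atTop, a (k + 1) = a k % m + if P k then 1 else 0)
    (hP : ∃ᶠ k in atTop, P k) : ∃ᶠ k in atTop, a k = m := by
  intro hne
  obtain ⟨N, hN⟩ := eventually_atTop.1 (ha.and hne)
  have hstep : ∀ k, N ≤ k → a (k + 1) = a k + if P k then 1 else 0 := fun k hk => by
    rw [(hN k hk).1, Nat.mod_eq_of_lt (lt_of_le_of_ne (hm k) (hN k hk).2)]
  have hmono : ∀ k l, N ≤ k → k ≤ l → a k ≤ a l := fun k l hk hl => by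
    induction l, hl using Nat.le_induction with
    | base => exact le_rfl
    | succ l hl ih => rw [hstep l (hk.trans hl)]; omega
  have hgrow : ∀ c, ∃ k, N ≤ k ∧ c ≤ a k := by
    intro c
    induction c with
    | zero => exact ⟨N, le_rfl, Nat.zero_le _⟩
    | succ c ih =>
      obtain ⟨k, hk, hc⟩ := ih
      obtain ⟨l, hl, hl'⟩ := frequently_atTop.1 hP k
      refine ⟨l + 1, by omega, ?_⟩
      rw [hstep l (by omega), if_pos hl']
      have := hmono k l hk hl
      omega
  obtain ⟨k, -, hk⟩ := hgrow (m + 1)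
  have := hm k
  omega

/-- A rejecting run of the stair Büchi automaton is rejecting for the simulation. -/
theorem mem_lang_of_mem_counterSim_lang (ht : A.IsRank H t)
    (h : w ∈ (A.counterSim H t).lang) : w ∈ A.lang := by
  classical
  obtain ⟨hw, P, hP, hPe⟩ := ((A.counterSim H t).mem_lang_iff w).1 h
  change IsGreatest {k | ∃ᶠ n in atTop, A.prioAt H t w n = k} P at hP
  by_contra hrej
  have hrej' := fun hF => hrej ((A.mem_lang_iff w).2 ⟨hw, hF⟩)
  obtain ⟨s, hmono, hst, hpar, hs⟩ := exists_step_enumeration A hw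
  have hNF : ∀ᶠ k in atTop, (A.confAt w (s k)).1 ∉ A.final := by
    have h1 := hmono.tendsto_atTop.eventually (not_frequently.1 hrej')
    exact h1.mono fun k hk hF => hk ⟨hst k, hF⟩
  have hNF' : ∀ᶠ k in atTop, (A.confAt w (s (k + 1))).1 ∉ A.final :=
    (tendsto_add_atTop_nat 1).eventually hNF
  have hle : ∀ {i}, (∃ᶠ n in atTop, i ≤ A.prioAt H t w n) → i ≤ P := fun {i} hi => by
    obtain ⟨k, hk, hk'⟩ := exists_frequently_eq prioAt_le hi
    exact hk.trans (hP.2 hk')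
  have hhit : ∀ d, (∃ᶠ k in atTop, A.Increases H t w (s k) (s (k + 1)) d) →
      ∃ᶠ k in atTop, A.counterAt H t w (s k) d = A.bound := fun d hd =>
    frequently_eq_of_frequently_add (fun k => counterAt_le _ d)
      (hNF'.mono fun k hk => (counterAt_parent (hpar k) hk d).1) hd
  have hprio : ∀ d, (∃ᶠ k in atTop, A.counterAt H t w (s k) d = A.bound) →
      2 * (d : ℕ) + 1 ≤ P := fun d hd =>
    hle (hmono.tendsto_atTop.frequently (hd.mono fun k hk => lt_prioAt hk))
  -- The flag is cleared at the step after the bound is reached, and only a final state could set it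
  -- again.
  have hflag : ∀ d, (∃ᶠ k in atTop, A.counterAt H t w (s k) d = A.bound) →
      ∀ᶠ k in atTop, A.flagAt H t w (s k) d = 0 := fun d hd => by
    obtain ⟨N, hN⟩ := eventually_atTop.1 hNF'
    obtain ⟨k, hk, hk'⟩ := frequently_atTop.1 hd N
    refine eventually_atTop.2 ⟨k + 1, fun l hl => ?_⟩
    induction l, hl using Nat.le_induction with
    | base =>
      rw [(counterAt_parent (hpar k) (hN k hk) d).2, if_neg (by omega)]
    | succ l hl ih =>
      rw [(counterAt_parent (hpar l) (hN l (by omega)) d).2, ih]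
      simp
  have hzero : ∃ᶠ k in atTop, A.Increases H t w (s k) (s (k + 1)) 0 :=
    (hNF.mono fun k hk => (hpar k).imp (fun h => ⟨h.1, rfl⟩)
      (fun h => ⟨h, hk, Nat.zero_le _⟩)).frequently
  have hP1 := hprio 0 (hhit 0 hzero)
  -- Counter `0` is increased at all late steps, hence `P ≥ 1`; being even, `P` comes from a full
  -- counter whose flag is set.
  obtain ⟨d, hPd, hfreq⟩ : ∃ d : Fin (H + 1), P = 2 * (d : ℕ) + 2 ∧
      ∃ᶠ n in atTop, A.counterAt H t w n d = A.bound ∧ A.flagAt H t w n d = 1 := by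
    obtain ⟨d, hd⟩ : ∃ d : ℕ, P = 2 * d + 2 := by
      obtain ⟨e, he⟩ := hPe
      exact ⟨e - 1, by omega⟩
    have key : ∀ n, A.prioAt H t w n = P → ∃ e : Fin (H + 1), (e : ℕ) = d ∧
        A.counterAt H t w n e = A.bound ∧ A.flagAt H t w n e = 1 := by
      intro n hn
      rcases counterPrio_cases ((A.counterSim H t).confAt w n).1 with ⟨h0, -⟩ | ⟨e, h1, -, h2⟩
      · rw [prioAt, h0] at hn
        omega
      · have h3 : P = 2 * (e : ℕ) + 1 + (A.flagAt H t w n e : ℕ) := by rw [← hn, prioAt, h2]; rfl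
        rcases fin_two_cases (A.flagAt H t w n e) with h4 | h4
        · rw [h4] at h3
          simp at h3
          omega
        · rw [h4] at h3
          simp at h3
          exact ⟨e, by omega, h1, h4⟩
    obtain ⟨n, hn⟩ := hP.1.exists
    obtain ⟨e, he, -⟩ := key n hn
    refine ⟨e, by omega, hP.1.mono fun n hn => ?_⟩
    obtain ⟨e', he', h1⟩ := key n hn
    obtain rfl : e' = e := Fin.ext (by omega)
    exact h1
  -- the steps around a position with a flagged counter at its bound
  have hcases : ∃ᶠ k in atTop,
      (∃ e : Fin (H + 1), (e : ℕ) = d + 1 ∧ A.Increases H t w (s k) (s (k + 1)) e) ∨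
      (A.flagAt H t w (s k) d = 1 ∧ (A.Increases H t w (s k) (s (k + 1)) d ∨
        A.counterAt H t w (s k) d = A.bound)) := by
    obtain ⟨N₀, hN₀⟩ := eventually_atTop.1 (hNF.and hNF')
    refine frequently_atTop.2 fun N => ?_
    obtain ⟨n, hn, hc, hf⟩ := frequently_atTop.1 hfreq (s (N + N₀))
    obtain ⟨k, hk, hk'⟩ := hs n ((hmono.monotone (Nat.zero_le _)).trans hn)
    have hkN : N + N₀ ≤ k := by
      by_contra hcon
      have := hmono.monotone (show k + 1 ≤ N + N₀ by omega)
      omega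
    refine ⟨k, by omega, ?_⟩
    obtain ⟨hq, hq'⟩ := hN₀ k (by omega)
    rcases hk.eq_or_lt with rfl | hkn
    · exact .inr ⟨hf, .inr hc⟩
    have hfac : IsFactor w (s k) (s (k + 1)) := (hpar k).resolve_left (by omega)
    by_cases hF : ∃ l, s k < l ∧ IsStair w l n ∧ (A.confAt w l).1 ∈ A.final
    · left
      have h1 := lt_rank_of_counterAt_eq_bound ht hw hfac hq hq' hk' hF hc hf
      have h2 := ht.le ((A.confAt w (s k)).1, (A.confAt w (s (k + 1))).1)
        (A.reachable_confAt hw _) hq hq'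
      -- Counter `d+1` exists because the rank of the factor exceeds `d` and is at most `H`.
      exact ⟨⟨d + 1, by omega⟩, rfl, .inr ⟨hfac, hq, h1⟩⟩
    · right
      push Not at hF
      obtain ⟨h1, -, h2, h3⟩ := counterAt_path hw n (hst k n hk) hF hf
      refine ⟨h1, .inl ?_⟩
      rcases Nat.eq_zero_or_pos (d : ℕ) with hd0 | hd0
      · exact .inr ⟨hfac, hq, by rw [hd0]; exact Nat.zero_le _⟩
      obtain ⟨p, j, h4, h5, h6, h7, -⟩ := h3 A.bound (h2 hkn.ne) hc.ge
      refine .inr ⟨hfac, hq, ?_⟩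
      -- The last increment cannot start at the step itself: the return matching that call comes
      -- only at the next step.
      rcases h6.1.eq_or_lt with rfl | h8
      · exfalso
        have h9 : IsFactor w (s k) j := h4.resolve_left fun h => by
          rcases h7 with ⟨-, rfl⟩ | ⟨⟨c, r, m, h9, h10, -⟩, -⟩
          · simp at hd0
          · omega
        have h10 := (h9.heightAt hw)
        have h11 := (hfac.heightAt hw).2.2.2 j (by omega) (h5.1.trans_lt hk')
        omega
      · exact le_rank_of_increases ht hw hfac hq hq' h8 (h5.1.trans_lt hk') h7
  rcases frequently_or_distrib.1 hcases with h1 | h1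
  · obtain ⟨k, e, he, -⟩ := h1.exists
    have h2 := hprio e (hhit e (h1.mono fun k ⟨e', he', h⟩ => by
      obtain rfl : e' = e := Fin.ext (by omega)
      exact h))
    omega
  · have hb : ∃ᶠ k in atTop, A.counterAt H t w (s k) d = A.bound := by
      rcases frequently_or_distrib.1 (h1.mono fun k hk => hk.2) with h2 | h2
      · exact hhit d h2
      · exact h2
    obtain ⟨k, hk, hk'⟩ := (h1.and_eventually (hflag d hb)).exists
    rw [hk.1] at hk'
    exact absurd hk' (by simp)

theorem counterSim_lang (ht : A.IsRank H t) : (A.counterSim H t).lang = A.lang :=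
  Set.ext fun _ => ⟨mem_lang_of_mem_counterSim_lang ht, mem_counterSim_lang⟩

end StairBuchiDVPA

/-! ### Primitive recursive functions, in a form suited to automation -/

-- With closure rules for bounded quantifiers, sums and lists, `fun_prop` proves primitive
-- recursiveness by following the shape of a definition. The tables below are therefore written
-- entirely in these terms, over natural numbers.
attribute [fun_prop] Primrec
attribute [fun_prop] PrimrecPred

/-- Bounded universal quantification. -/
def BAll (n : ℕ) (P : ℕ → Prop) : Prop := ∀ x < n, P x

/-- Bounded existential quantification. -/
def BEx (n : ℕ) (P : ℕ → Prop) : Prop := ∃ x < n, P x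

/-- Bounded sums. -/
def bsum (n : ℕ) (f : ℕ → ℕ) : ℕ := ∑ x ∈ Finset.range n, f x

/-- Lists indexed by an initial segment of the natural numbers. -/
def rmap {β : Type} (n : ℕ) (f : ℕ → β) : List β := (List.range n).map f

/-- Concatenations indexed by an initial segment of the natural numbers. -/
def rflat {β : Type} (n : ℕ) (f : ℕ → List β) : List β := (List.range n).flatMap f

theorem bAll_iff {n : ℕ} {P : ℕ → Prop} : BAll n P ↔ ∀ x : Fin n, P x :=
  (Fin.forall_iff (p := fun x : Fin n => P x)).symm

theorem bEx_iff {n : ℕ} {P : ℕ → Prop} : BEx n P ↔ ∃ x : Fin n, P x := by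
  rw [Fin.exists_iff]
  simp [BEx]

namespace PrimrecTools

variable {α β γ : Type} [Primcodable α] [Primcodable β] [Primcodable γ]

@[fun_prop] theorem id : Primrec fun a : α => a := Primrec.id

@[fun_prop] theorem const (c : β) : Primrec fun _ : α => c := Primrec.const c

@[fun_prop] theorem comp {f : β → γ} {g : α → β} (hf : Primrec f) (hg : Primrec g) :
    Primrec fun a => f (g a) := hf.comp hg

@[fun_prop] theorem fst {f : α → β × γ} (hf : Primrec f) : Primrec fun a => (f a).1 :=
  Primrec.fst.comp hf

@[fun_prop] theorem snd {f : α → β × γ} (hf : Primrec f) : Primrec fun a => (f a).2 :=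
  Primrec.snd.comp hf

@[fun_prop] theorem mk {f : α → β} {g : α → γ} (hf : Primrec f) (hg : Primrec g) :
    Primrec fun a => (f a, g a) := hf.pair hg

@[fun_prop] theorem add {f g : α → ℕ} (hf : Primrec f) (hg : Primrec g) :
    Primrec fun a => f a + g a := Primrec.nat_add.comp hf hg

@[fun_prop] theorem mul {f g : α → ℕ} (hf : Primrec f) (hg : Primrec g) :
    Primrec fun a => f a * g a := Primrec.nat_mul.comp hf hg

@[fun_prop] theorem div {f g : α → ℕ} (hf : Primrec f) (hg : Primrec g) :
    Primrec fun a => f a / g a := Primrec.nat_div.comp hf hg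

@[fun_prop] theorem mod {f g : α → ℕ} (hf : Primrec f) (hg : Primrec g) :
    Primrec fun a => f a % g a := Primrec.nat_mod.comp hf hg

@[fun_prop] theorem max {f g : α → ℕ} (hf : Primrec f) (hg : Primrec g) :
    Primrec fun a => Nat.max (f a) (g a) := Primrec.nat_max.comp hf hg

@[fun_prop] theorem pow {f g : α → ℕ} (hf : Primrec f) (hg : Primrec g) :
    Primrec fun a => f a ^ g a :=
  (Primrec₂.unpaired'.1 Nat.Primrec.pow : Primrec₂ fun m n : ℕ => m ^ n).comp hf hg

@[fun_prop] theorem getD {f : α → List ℕ} {g : α → ℕ} (hf : Primrec f) (hg : Primrec g) :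
    Primrec fun a => (f a).getD (g a) 0 := (Primrec.list_getD 0).comp hf hg

@[fun_prop] theorem cons {f : α → β} {g : α → List β} (hf : Primrec f) (hg : Primrec g) :
    Primrec fun a => f a :: g a := Primrec.list_cons.comp hf hg

@[fun_prop] theorem append {f g : α → List β} (hf : Primrec f) (hg : Primrec g) :
    Primrec fun a => f a ++ g a := Primrec.list_append.comp hf hg

@[fun_prop] theorem rmap {b : α → ℕ} {f : α → ℕ → β} (hb : Primrec b)
    (hf : Primrec fun z : α × ℕ => f z.1 z.2) : Primrec fun a => _root_.rmap (b a) (f a) :=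
  Primrec.list_map (Primrec.list_range.comp hb) hf.to₂

@[fun_prop] theorem rflat {b : α → ℕ} {f : α → ℕ → List β} (hb : Primrec b)
    (hf : Primrec fun z : α × ℕ => f z.1 z.2) : Primrec fun a => _root_.rflat (b a) (f a) :=
  Primrec.list_flatMap (Primrec.list_range.comp hb) hf.to₂

@[fun_prop] theorem bsum {b : α → ℕ} {f : α → ℕ → ℕ} (hb : Primrec b)
    (hf : Primrec fun z : α × ℕ => f z.1 z.2) : Primrec fun a => _root_.bsum (b a) (f a) := by
  have h : Primrec fun a => (Nat.rec 0 (fun k s => s + f a k) (b a) : ℕ) :=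
    Primrec.nat_rec' hb (Primrec.const 0)
      (by unfold Primrec₂; fun_prop : Primrec₂ fun (a : α) (z : ℕ × ℕ) => z.2 + f a z.1)
  refine h.of_eq fun a => ?_
  induction b a with
  | zero => rfl
  | succ n ih => simp only [_root_.bsum, Finset.sum_range_succ] at *; rw [ih]

@[fun_prop] theorem ite {c : α → Prop} [DecidablePred c] {f g : α → β} (hc : PrimrecPred c)
    (hf : Primrec f) (hg : Primrec g) : Primrec fun a => if c a then f a else g a :=
  Primrec.ite hc hf hg

@[fun_prop] theorem eq {f g : α → ℕ} (hf : Primrec f) (hg : Primrec g) :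
    PrimrecPred fun a => f a = g a := Primrec.eq.comp hf hg

@[fun_prop] theorem lt {f g : α → ℕ} (hf : Primrec f) (hg : Primrec g) :
    PrimrecPred fun a => f a < g a := Primrec.nat_lt.comp hf hg

@[fun_prop] theorem le {f g : α → ℕ} (hf : Primrec f) (hg : Primrec g) :
    PrimrecPred fun a => f a ≤ g a := Primrec.nat_le.comp hf hg

@[fun_prop] theorem and {f g : α → Prop} (hf : PrimrecPred f) (hg : PrimrecPred g) :
    PrimrecPred fun a => f a ∧ g a := hf.and hg

@[fun_prop] theorem or {f g : α → Prop} (hf : PrimrecPred f) (hg : PrimrecPred g) :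
    PrimrecPred fun a => f a ∨ g a := hf.or hg

@[fun_prop] theorem not {f : α → Prop} (hf : PrimrecPred f) : PrimrecPred fun a => ¬ f a := hf.not

@[fun_prop] theorem bAll {b : α → ℕ} {P : α → ℕ → Prop} (hb : Primrec b)
    (hP : PrimrecPred fun z : α × ℕ => P z.1 z.2) : PrimrecPred fun a => BAll (b a) (P a) := by
  have h : PrimrecRel fun (x : ℕ) (a : α) => P a x := hP.comp (Primrec.snd.pair Primrec.fst)
  exact (h.forall_mem_list.comp (Primrec.list_range.comp hb) Primrec.id).of_eq fun a => by simp [BAll]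

@[fun_prop] theorem bEx {b : α → ℕ} {P : α → ℕ → Prop} (hb : Primrec b)
    (hP : PrimrecPred fun z : α × ℕ => P z.1 z.2) : PrimrecPred fun a => BEx (b a) (P a) := by
  have h : PrimrecRel fun (x : ℕ) (a : α) => P a x := hP.comp (Primrec.snd.pair Primrec.fst)
  exact (h.exists_mem_list.comp (Primrec.list_range.comp hb) Primrec.id).of_eq fun a => by simp [BEx]

end PrimrecTools

/-! ### Least fixed points over finite sets -/

/-- `x` is an element of the finite set with characteristic number `S`. -/
def InSet (S x : ℕ) : Prop := S / 2 ^ x % 2 = 1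

/-- If `x` is in `S`, then `P`. -/
def IfIn (S x : ℕ) (P : Prop) : Prop := ¬ InSet S x ∨ P

theorem ifIn_iff {S x : ℕ} {P : Prop} : IfIn S x P ↔ (InSet S x → P) := imp_iff_not_or.symm

/-- `x` is in all subsets of `{0, …, N - 1}` with the property `closed`. -/
def Least (N : ℕ) (closed : ℕ → Prop) (x : ℕ) : Prop :=
  BAll (2 ^ N) fun S => ¬ closed S ∨ InSet S x

namespace PrimrecTools

variable {α : Type} [Primcodable α]

@[fun_prop] theorem inSet {f g : α → ℕ} (hf : Primrec f) (hg : Primrec g) :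
    PrimrecPred fun a => InSet (f a) (g a) := by unfold InSet; fun_prop

@[fun_prop] theorem ifIn {f g : α → ℕ} {P : α → Prop} (hf : Primrec f) (hg : Primrec g)
    (hP : PrimrecPred P) : PrimrecPred fun a => IfIn (f a) (g a) (P a) := by unfold IfIn; fun_prop

@[fun_prop] theorem least {N x : α → ℕ} {P : α → ℕ → Prop} (hN : Primrec N)
    (hP : PrimrecPred fun z : α × ℕ => P z.1 z.2) (hx : Primrec x) :
    PrimrecPred fun a => Least (N a) (P a) (x a) := by unfold Least; fun_prop

end PrimrecTools

theorem exists_inSet_iff (N : ℕ) (R : ℕ → Prop) : ∃ S < 2 ^ N, ∀ x < N, InSet S x ↔ R x := by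
  classical
  have key : ∀ x, InSet (Nat.ofBits fun i : Fin N => decide (R i)) x ↔
      (Nat.ofBits fun i : Fin N => decide (R i)).testBit x = true := fun x => by
    rw [Nat.testBit_eq_decide_div_mod_eq, decide_eq_true_iff, InSet]
  refine ⟨Nat.ofBits fun i : Fin N => decide (R i), Nat.ofBits_lt_two_pow _, fun x hx => ?_⟩
  rw [key, Nat.testBit_ofBits_lt _ _ hx, decide_eq_true_iff]

/-- The intersection of all closed sets is `R` if every closed set contains `R` and `R` is itself
closed. Running through all subsets replaces the iteration of a fixed point. -/
theorem least_iff {ι : Type} {N : ℕ} {closed : ℕ → Prop} (code : ι ↪ Fin N) (R : ι → Prop)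
    (h1 : ∀ S, closed S → ∀ i, R i → InSet S (code i))
    (h2 : ∀ S, (∀ i, InSet S (code i) ↔ R i) → closed S) (i : ι) :
    Least N closed (code i) ↔ R i := by
  constructor
  · intro h
    obtain ⟨S, hS, hS'⟩ := exists_inSet_iff N fun x => ∃ j, (code j : ℕ) = x ∧ R j
    have h3 : ∀ j, InSet S (code j) ↔ R j := fun j => by
      rw [hS' _ (code j).2]
      constructor
      · rintro ⟨j', hj, hR⟩
        rwa [← code.injective (Fin.ext hj)]
      · exact fun hR => ⟨j, rfl, hR⟩
    exact (h3 i).1 ((h S hS).resolve_left (not_not.2 (h2 S h3)))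
  · exact fun hR S _ => (em (closed S)).elim (fun h => .inr (h1 S h i hR)) .inl

/-! ### Tables of automata -/

/-- Entry `i` of a description. -/
def entry (L : List ℕ) (i : ℕ) : ℕ := L.getD i 0

namespace Table

variable (L : List ℕ)

/-- The number of call letters. -/
def nCall : ℕ := entry L 0
/-- The number of internal letters. -/
def nInt : ℕ := entry L 1
/-- The number of return letters. -/
def nRet : ℕ := entry L 2
/-- The number of states. -/
def nState : ℕ := entry L 3
/-- The number of stack symbols. -/
def nStack : ℕ := entry L 4
/-- The initial state. -/
def init : ℕ := entry L 5
/-- The state after a call. -/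
def callState (q x : ℕ) : ℕ := entry L (6 + (2 * nCall L * q + 2 * x))
/-- The symbol pushed by a call. -/
def callStack (q x : ℕ) : ℕ := entry L (6 + (2 * nCall L * q + (2 * x + 1)))
/-- The state after an internal letter. -/
def intState (q x : ℕ) : ℕ := entry L (6 + 2 * nCall L * nState L + (nInt L * q + x))
/-- The state after a return. -/
def retState (q Z x : ℕ) : ℕ :=
  entry L (6 + 2 * nCall L * nState L + nInt L * nState L +
    (nStack L * nRet L * q + (nRet L * Z + x)))
/-- The characteristic function of the set of final states. -/
def isFinal (q : ℕ) : ℕ :=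
  entry L (6 + 2 * nCall L * nState L + nInt L * nState L + nStack L * nRet L * nState L + q)

end Table

namespace PrimrecTools

variable {α : Type} [Primcodable α] {L : α → List ℕ} {p q r s t : α → ℕ}

@[fun_prop] theorem entry (hL : Primrec L) (hq : Primrec q) :
    Primrec fun a => entry (L a) (q a) := by unfold _root_.entry; fun_prop
@[fun_prop] theorem nCall (hL : Primrec L) : Primrec fun a => Table.nCall (L a) := by
  unfold Table.nCall; fun_prop
@[fun_prop] theorem nInt (hL : Primrec L) : Primrec fun a => Table.nInt (L a) := by
  unfold Table.nInt; fun_prop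
@[fun_prop] theorem nRet (hL : Primrec L) : Primrec fun a => Table.nRet (L a) := by
  unfold Table.nRet; fun_prop
@[fun_prop] theorem nState (hL : Primrec L) : Primrec fun a => Table.nState (L a) := by
  unfold Table.nState; fun_prop
@[fun_prop] theorem nStack (hL : Primrec L) : Primrec fun a => Table.nStack (L a) := by
  unfold Table.nStack; fun_prop
@[fun_prop] theorem init (hL : Primrec L) : Primrec fun a => Table.init (L a) := by
  unfold Table.init; fun_prop
@[fun_prop] theorem callState (hL : Primrec L) (hp : Primrec p) (hq : Primrec q) :
    Primrec fun a => Table.callState (L a) (p a) (q a) := by unfold Table.callState; fun_prop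
@[fun_prop] theorem callStack (hL : Primrec L) (hp : Primrec p) (hq : Primrec q) :
    Primrec fun a => Table.callStack (L a) (p a) (q a) := by unfold Table.callStack; fun_prop
@[fun_prop] theorem intState (hL : Primrec L) (hp : Primrec p) (hq : Primrec q) :
    Primrec fun a => Table.intState (L a) (p a) (q a) := by unfold Table.intState; fun_prop
@[fun_prop] theorem retState (hL : Primrec L) (hp : Primrec p) (hq : Primrec q) (hr : Primrec r) :
    Primrec fun a => Table.retState (L a) (p a) (q a) (r a) := by
  unfold Table.retState; fun_prop
@[fun_prop] theorem isFinal (hL : Primrec L) (hp : Primrec p) :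
    Primrec fun a => Table.isFinal (L a) (p a) := by unfold Table.isFinal; fun_prop

end PrimrecTools

namespace Table

variable (L : List ℕ)

/-- Well-matched words lead from `p` to `q`. -/
def Matched (p q : ℕ) : Prop :=
  Least (nState L * nState L) (fun S =>
    (BAll (nState L) fun p => InSet S (p + nState L * p)) ∧
    BAll (nState L) fun p => BAll (nState L) fun q => IfIn S (q + nState L * p)
      ((BAll (nInt L) fun i => InSet S (intState L q i + nState L * p)) ∧
      BAll (nCall L) fun c => BAll (nState L) fun t =>
        IfIn S (t + nState L * callState L q c) (BAll (nRet L) fun r =>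
          InSet S (retState L t (callStack L q c) r + nState L * p))))
    (q + nState L * p)

/-- An internal letter or a minimally well-matched word leads from `p` to `q`. -/
def Edge (p q : ℕ) : Prop :=
  (BEx (nInt L) fun i => intState L p i = q) ∨
    BEx (nCall L) fun c => BEx (nState L) fun t =>
      Matched L (callState L p c) t ∧ BEx (nRet L) fun r => retState L t (callStack L p c) r = q

/-- A well-matched word leads from `p` to `q` without final states on steps. -/
def NonFinalMatched (p q : ℕ) : Prop :=
  Least (nState L * nState L) (fun S =>
    (BAll (nState L) fun p => isFinal L p = 1 ∨ InSet S (p + nState L * p)) ∧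
    BAll (nState L) fun p => BAll (nState L) fun q => IfIn S (q + nState L * p)
      (BAll (nState L) fun q' => ¬ Edge L q q' ∨ isFinal L q' = 1 ∨ InSet S (q' + nState L * p)))
    (q + nState L * p)

/-- The number of the quintuple `(x, y, y', x', f)`. -/
def code (x y y' x' f : ℕ) : ℕ :=
  f + 2 * x' + nState L * 2 * y' + nState L * (nState L * 2) * y +
    nState L * (nState L * (nState L * 2)) * x

/-- Some stack content is built up from `x` to `y` and removed from `y'` to `x'`, and `f` says
whether a final state occurs on a step of the first run. -/
def Bridge (x y y' x' f : ℕ) : Prop :=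
  Least (nState L * (nState L * (nState L * (nState L * 2)))) (fun S =>
    (BAll (nState L) fun x => BAll (nState L) fun y' => BAll (nState L) fun x' =>
      ¬ Matched L y' x' ∨ InSet S (code L x x y' x' (isFinal L x))) ∧
    BAll (nState L) fun x => BAll (nState L) fun y => BAll (nState L) fun y' =>
      BAll (nState L) fun x' => BAll 2 fun f => IfIn S (code L x y y' x' f)
      ((BAll (nState L) fun z => ¬ Edge L y z ∨
        InSet S (code L x z y' x' (Nat.max f (isFinal L z)))) ∧
      BAll (nCall L) fun c => BAll (nState L) fun z => BAll (nState L) fun t =>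
        BAll (nRet L) fun r => ¬ Matched L z t ∨ ¬ retState L t (callStack L y c) r = y' ∨
          InSet S (code L x (callState L y c) z x'
            (Nat.max f (isFinal L (callState L y c))))))
    (code L x y y' x' f)

/-- The state `q` is reachable. -/
def Reachable (q : ℕ) : Prop :=
  Least (nState L) (fun S => InSet S (init L) ∧ BAll (nState L) fun q => IfIn S q
    ((BAll (nState L) fun q' => ¬ Edge L q q' ∨ InSet S q') ∧
      BAll (nCall L) fun c => InSet S (callState L q c))) q

/-- The relation `≺` on pairs. -/
def Prec (p p' q q' : ℕ) : Prop :=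
  isFinal L q = 0 ∧ isFinal L q' = 0 ∧ BEx (nState L) fun p'' =>
    (BEx (nCall L) fun c => BEx (nState L) fun t => BEx (nRet L) fun r =>
      Bridge L (callState L q c) p p'' t 1 ∧ retState L t (callStack L q c) r = q') ∧
    NonFinalMatched L p p' ∧ Bridge L p' p p'' p'' 0 ∧ Matched L p p''

/-- The number of the triple `(q, q', k)`. -/
def codeHeight (q q' k : ℕ) : ℕ :=
  k + (nState L * nState L + 1) * q' + nState L * (nState L * nState L + 1) * q

/-- The pair `(q, q')` has height at least `k`. -/
def HeightGE (q q' k : ℕ) : Prop :=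
  Least (nState L * (nState L * (nState L * nState L + 1))) (fun S =>
    (BAll (nState L) fun q => BAll (nState L) fun q' => InSet S (codeHeight L q q' 1)) ∧
    -- The restriction of `k` keeps `k + 1 ≤ |Q|²`, within the range of the coding; chains of
    -- reachable pairs are not longer.
    BAll (nState L) fun p => BAll (nState L) fun p' => BAll (nState L * nState L) fun k =>
      IfIn S (codeHeight L p p' k) (BAll (nState L) fun q => BAll (nState L) fun q' =>
        ¬ Prec L p p' q q' ∨ InSet S (codeHeight L q q' (k + 1))))
    (codeHeight L q q' k)

open Classical in
/-- The height of a pair. -/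
noncomputable def height (q q' : ℕ) : ℕ :=
  bsum (nState L * nState L) fun k => if HeightGE L q q' (k + 1) then 1 else 0

open Classical in
/-- The maximal height of a pair of non-final states with a reachable first component. -/
noncomputable def maxHeight : ℕ :=
  bsum (nState L * nState L) fun k => if BEx (nState L) fun q => BEx (nState L) fun q' =>
    Reachable L q ∧ isFinal L q = 0 ∧ isFinal L q' = 0 ∧ HeightGE L q q' (k + 1) then 1 else 0

end Table

namespace PrimrecTools

variable {α : Type} [Primcodable α] {L : α → List ℕ} {p q r s t : α → ℕ}

@[fun_prop] theorem matched (hL : Primrec L) (hp : Primrec p) (hq : Primrec q) :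
    PrimrecPred fun a => Table.Matched (L a) (p a) (q a) := by unfold Table.Matched; fun_prop
@[fun_prop] theorem edge (hL : Primrec L) (hp : Primrec p) (hq : Primrec q) :
    PrimrecPred fun a => Table.Edge (L a) (p a) (q a) := by unfold Table.Edge; fun_prop
@[fun_prop] theorem nonFinalMatched (hL : Primrec L) (hp : Primrec p) (hq : Primrec q) :
    PrimrecPred fun a => Table.NonFinalMatched (L a) (p a) (q a) := by
  unfold Table.NonFinalMatched; fun_prop
@[fun_prop] theorem code (hL : Primrec L) (hp : Primrec p) (hq : Primrec q) (hr : Primrec r)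
    (hs : Primrec s) (ht : Primrec t) :
    Primrec fun a => Table.code (L a) (p a) (q a) (r a) (s a) (t a) := by
  unfold Table.code; fun_prop
@[fun_prop] theorem bridge (hL : Primrec L) (hp : Primrec p) (hq : Primrec q) (hr : Primrec r)
    (hs : Primrec s) (ht : Primrec t) :
    PrimrecPred fun a => Table.Bridge (L a) (p a) (q a) (r a) (s a) (t a) := by
  unfold Table.Bridge; fun_prop
@[fun_prop] theorem reachable (hL : Primrec L) (hp : Primrec p) :
    PrimrecPred fun a => Table.Reachable (L a) (p a) := by unfold Table.Reachable; fun_prop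
@[fun_prop] theorem prec (hL : Primrec L) (hp : Primrec p) (hq : Primrec q) (hr : Primrec r)
    (hs : Primrec s) :
    PrimrecPred fun a => Table.Prec (L a) (p a) (q a) (r a) (s a) := by
  unfold Table.Prec; fun_prop
@[fun_prop] theorem codeHeight (hL : Primrec L) (hp : Primrec p) (hq : Primrec q)
    (hr : Primrec r) : Primrec fun a => Table.codeHeight (L a) (p a) (q a) (r a) := by
  unfold Table.codeHeight; fun_prop
@[fun_prop] theorem heightGE (hL : Primrec L) (hp : Primrec p) (hq : Primrec q)
    (hr : Primrec r) : PrimrecPred fun a => Table.HeightGE (L a) (p a) (q a) (r a) := by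
  unfold Table.HeightGE; fun_prop
@[fun_prop] theorem height (hL : Primrec L) (hp : Primrec p) (hq : Primrec q) :
    Primrec fun a => Table.height (L a) (p a) (q a) := by unfold Table.height; fun_prop
@[fun_prop] theorem maxHeight (hL : Primrec L) : Primrec fun a => Table.maxHeight (L a) := by
  unfold Table.maxHeight; fun_prop

end PrimrecTools

/-! ### The table of the simulating automaton -/

namespace Table

variable (L : List ℕ)

/-- The bound on the counters. -/
def bound : ℕ := nState L ^ 3 + 1

/-- The number of values of the flags. -/
noncomputable def nFlag : ℕ := 2 ^ (maxHeight L + 1)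

/-- The number of values of the counters and flags. -/
noncomputable def nCounter : ℕ := (bound L + 1) ^ (maxHeight L + 1) * nFlag L

/-- The number of states. -/
noncomputable def nSim : ℕ := nState L * nCounter L

/-- The first component of the state with number `s`. -/
noncomputable def stateOf (s : ℕ) : ℕ := s / nCounter L

/-- Counter `i` of the state with number `s`. -/
noncomputable def counterOf (s i : ℕ) : ℕ :=
  s % nCounter L / nFlag L / (bound L + 1) ^ i % (bound L + 1)

/-- Flag `i` of the state with number `s`. -/
noncomputable def flagOf (s i : ℕ) : ℕ := s % nCounter L % nFlag L / 2 ^ i % 2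

/-- The number of the state with given components. -/
noncomputable def ofParts (q : ℕ) (χ f : ℕ → ℕ) : ℕ :=
  bsum (maxHeight L + 1) (fun i => f i * 2 ^ i) +
    nFlag L * bsum (maxHeight L + 1) (fun i => χ i * (bound L + 1) ^ i) + nCounter L * q

open Classical in
/-- The state with first component `q` whose counters and flags are obtained from those of `s`. -/
noncomputable def successor (q s : ℕ) (inc : ℕ → Prop) : ℕ :=
  if isFinal L q = 1 then ofParts L q (fun _ => 0) (fun _ => 1)
  else ofParts L q (fun i => counterOf L s i % bound L + if inc i then 1 else 0)
    (fun i => if counterOf L s i < bound L then flagOf L s i else 0)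

/-- The state of the simulating automaton after a call. -/
noncomputable def simCall (s x : ℕ) : ℕ :=
  successor L (callState L (stateOf L s) x) s (fun i => i = 0)

/-- The symbol pushed by the simulating automaton. -/
noncomputable def simCallStack (s x : ℕ) : ℕ := s + nSim L * callStack L (stateOf L s) x

/-- The state of the simulating automaton after an internal letter. -/
noncomputable def simInt (s x : ℕ) : ℕ :=
  successor L (intState L (stateOf L s) x) s (fun i => i = 0)

/-- The state of the simulating automaton after a return. -/
noncomputable def simRet (s Y x : ℕ) : ℕ :=
  successor L (retState L (stateOf L s) (Y / nSim L) x) (Y % nSim L)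
    (fun i => isFinal L (stateOf L (Y % nSim L)) = 0 ∧ i ≤ height L (stateOf L (Y % nSim L))
      (retState L (stateOf L s) (Y / nSim L) x))

open Classical in
/-- The priority of the state with number `s`. -/
noncomputable def simPrio (s : ℕ) : ℕ :=
  -- Only the greatest full counter contributes, so the sum is its summand, or `0` if no counter is
  -- full.
  bsum (maxHeight L + 1) fun i => if counterOf L s i = bound L ∧
    (BAll (maxHeight L + 1) fun j => ¬ i < j ∨ ¬ counterOf L s j = bound L)
    then 2 * i + 1 + flagOf L s i else 0

/-- The description of the simulating automaton. -/
noncomputable def build : List ℕ :=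
  [nCall L, nInt L, nRet L, nSim L, nStack L * nSim L,
    ofParts L (init L) (fun _ => 0) (fun _ => 1)] ++
  (rflat (nSim L) fun q => rflat (nCall L) fun x => [simCall L q x, simCallStack L q x]) ++
  (rflat (nSim L) fun q => rmap (nInt L) fun x => simInt L q x) ++
  (rflat (nSim L) fun q => rflat (nStack L * nSim L) fun Z => rmap (nRet L) fun x =>
    simRet L q Z x) ++
  rmap (nSim L) fun q => simPrio L q

end Table

namespace PrimrecTools

variable {α : Type} [Primcodable α] {L : α → List ℕ} {p q r s t : α → ℕ}

@[fun_prop] theorem bound (hL : Primrec L) : Primrec fun a => Table.bound (L a) := by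
  unfold Table.bound; fun_prop
@[fun_prop] theorem nFlag (hL : Primrec L) : Primrec fun a => Table.nFlag (L a) := by
  unfold Table.nFlag; fun_prop
@[fun_prop] theorem nCounter (hL : Primrec L) : Primrec fun a => Table.nCounter (L a) := by
  unfold Table.nCounter; fun_prop
@[fun_prop] theorem nSim (hL : Primrec L) : Primrec fun a => Table.nSim (L a) := by
  unfold Table.nSim; fun_prop
@[fun_prop] theorem stateOf (hL : Primrec L) (hs : Primrec s) :
    Primrec fun a => Table.stateOf (L a) (s a) := by unfold Table.stateOf; fun_prop
@[fun_prop] theorem counterOf (hL : Primrec L) (hs : Primrec s) (ht : Primrec t) :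
    Primrec fun a => Table.counterOf (L a) (s a) (t a) := by unfold Table.counterOf; fun_prop
@[fun_prop] theorem flagOf (hL : Primrec L) (hs : Primrec s) (ht : Primrec t) :
    Primrec fun a => Table.flagOf (L a) (s a) (t a) := by unfold Table.flagOf; fun_prop
@[fun_prop] theorem ofParts {χ f : α → ℕ → ℕ} (hL : Primrec L) (hq : Primrec q)
    (hχ : Primrec fun z : α × ℕ => χ z.1 z.2) (hf : Primrec fun z : α × ℕ => f z.1 z.2) :
    Primrec fun a => Table.ofParts (L a) (q a) (χ a) (f a) := by unfold Table.ofParts; fun_prop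
@[fun_prop] theorem successor {P : α → ℕ → Prop} (hL : Primrec L) (hq : Primrec q)
    (hs : Primrec s) (hP : PrimrecPred fun z : α × ℕ => P z.1 z.2) :
    Primrec fun a => Table.successor (L a) (q a) (s a) (P a) := by
  unfold Table.successor; fun_prop
@[fun_prop] theorem simCall (hL : Primrec L) (hs : Primrec s) (ht : Primrec t) :
    Primrec fun a => Table.simCall (L a) (s a) (t a) := by unfold Table.simCall; fun_prop
@[fun_prop] theorem simCallStack (hL : Primrec L) (hs : Primrec s) (ht : Primrec t) :
    Primrec fun a => Table.simCallStack (L a) (s a) (t a) := by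
  unfold Table.simCallStack; fun_prop
@[fun_prop] theorem simInt (hL : Primrec L) (hs : Primrec s) (ht : Primrec t) :
    Primrec fun a => Table.simInt (L a) (s a) (t a) := by unfold Table.simInt; fun_prop
@[fun_prop] theorem simRet (hL : Primrec L) (hr : Primrec r) (hs : Primrec s) (ht : Primrec t) :
    Primrec fun a => Table.simRet (L a) (r a) (s a) (t a) := by unfold Table.simRet; fun_prop
@[fun_prop] theorem simPrio (hL : Primrec L) (hs : Primrec s) :
    Primrec fun a => Table.simPrio (L a) (s a) := by unfold Table.simPrio; fun_prop
theorem build : Primrec Table.build := by unfold Table.build; fun_prop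

end PrimrecTools

/-! ### Correctness of the tables -/

theorem getD_append_add {α : Type} (l l' : List α) (i : ℕ) (d : α) :
    (l ++ l').getD (l.length + i) d = l'.getD i d := by
  rw [List.getD_append_right _ _ _ _ (Nat.le_add_right _ _), Nat.add_sub_cancel_left]

theorem getD_append_of_lt {α : Type} (l l' : List α) (i : ℕ) (d : α) (h : i < l.length) :
    (l ++ l').getD i d = l.getD i d := List.getD_append _ _ _ _ h

theorem length_flatMap_const {α β : Type} (l : List α) (f : α → List β) (k : ℕ)
    (hf : ∀ x, (f x).length = k) : (l.flatMap f).length = k * l.length := by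
  induction l with
  | nil => simp
  | cons x l ih => rw [List.flatMap_cons, List.length_append, hf, ih, List.length_cons]; ring

theorem getD_flatMap_const {α β : Type} (l : List α) (f : α → List β) (k : ℕ)
    (hf : ∀ x, (f x).length = k) (i j : ℕ) (hi : i < l.length) (hj : j < k) (d : β) :
    (l.flatMap f).getD (k * i + j) d = (f l[i]).getD j d := by
  induction l generalizing i with
  | nil => simp at hi
  | cons x l ih =>
    rw [List.flatMap_cons]
    cases i with
    | zero => rw [Nat.mul_zero, Nat.zero_add, getD_append_of_lt _ _ _ _ (by rw [hf]; exact hj)]; rfl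
    | succ i =>
      rw [show k * (i + 1) + j = (f x).length + (k * i + j) by rw [hf]; ring, getD_append_add]
      exact ih i (by simpa using hi)

/-- The table `L` describes the automaton `A`. -/
structure Represents {a b c n k : ℕ} (L : List ℕ)
    (A : StairBuchiDVPA (Fin a) (Fin b) (Fin c) (Fin n) (Fin k)) : Prop where
  nCall : Table.nCall L = a
  nInt : Table.nInt L = b
  nRet : Table.nRet L = c
  nState : Table.nState L = n
  nStack : Table.nStack L = k
  init : Table.init L = A.init
  callState : ∀ (q : Fin n) (x : Fin a), Table.callState L q x = (A.call q x).1
  callStack : ∀ (q : Fin n) (x : Fin a), Table.callStack L q x = (A.call q x).2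
  intState : ∀ (q : Fin n) (x : Fin b), Table.intState L q x = A.int q x
  retState : ∀ (q : Fin n) (Z : Fin k) (x : Fin c), Table.retState L q Z x = A.ret q Z x
  isFinal : ∀ q : Fin n, Table.isFinal L q = if q ∈ A.final then 1 else 0

theorem represents_encode {a b c n k : ℕ}
    (A : StairBuchiDVPA (Fin a) (Fin b) (Fin c) (Fin n) (Fin k)) : Represents A.encode A := by
  set hd : List ℕ := [a, b, c, n, k, A.init.val] with hhd
  set tc := (List.finRange n).flatMap fun q => (List.finRange a).flatMap fun x =>
    [(A.call q x).1.val, (A.call q x).2.val] with htc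
  set ti := (List.finRange n).flatMap fun q => (List.finRange b).map fun x => (A.int q x).val
    with hti
  set tr := (List.finRange n).flatMap fun q => (List.finRange k).flatMap fun Z =>
    (List.finRange c).map fun x => (A.ret q Z x).val with htr
  set tf := (List.finRange n).map fun q => if q ∈ A.final then 1 else 0 with htf
  have he : A.encode = hd ++ (tc ++ (ti ++ (tr ++ tf))) := by
    simp only [StairBuchiDVPA.encode, DVPM.encode, List.append_assoc]; rfl
  have lc : tc.length = 2 * a * n := by
    rw [htc, length_flatMap_const _ _ (2 * a) fun q => by
      rw [length_flatMap_const _ _ 2 fun x => rfl, List.length_finRange], List.length_finRange]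
  have li : ti.length = b * n := by
    rw [hti, length_flatMap_const _ _ b fun q => by simp, List.length_finRange]
  have lr : tr.length = k * c * n := by
    rw [htr, length_flatMap_const _ _ (k * c) fun q => by
      rw [length_flatMap_const _ _ c fun x => by simp, List.length_finRange, mul_comm],
      List.length_finRange]
  have h0 : Table.nCall A.encode = a := rfl
  have h1 : Table.nInt A.encode = b := rfl
  have h2 : Table.nRet A.encode = c := rfl
  have h3 : Table.nState A.encode = n := rfl
  have h4 : Table.nStack A.encode = k := rfl
  have hcall : ∀ (q : Fin n) (x : Fin a) (j : ℕ), j < 2 →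
      entry A.encode (6 + (2 * a * q + (2 * x + j))) =
        [(A.call q x).1.val, (A.call q x).2.val].getD j 0 := by
    intro q x j hj
    have hx : 2 * (x : ℕ) + j < 2 * a := by have := x.2; omega
    rw [entry, he, show 6 + (2 * a * (q : ℕ) + (2 * x + j)) =
      hd.length + (2 * a * q + (2 * x + j)) from rfl, getD_append_add,
      getD_append_of_lt _ _ _ _ (by
        rw [lc]
        have := q.2
        calc 2 * a * (q : ℕ) + (2 * x + j) < 2 * a * q + 2 * a := by omega
          _ = 2 * a * (q + 1) := by ring
          _ ≤ 2 * a * n := Nat.mul_le_mul_left _ this),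
      htc, getD_flatMap_const _ _ (2 * a) (fun q => by
        rw [length_flatMap_const _ _ 2 fun x => rfl, List.length_finRange]) _ _ (by simp) hx,
      getD_flatMap_const _ _ 2 (fun x => rfl) _ _ (by simp) hj]
    simp
  refine ⟨h0, h1, h2, h3, h4, rfl, fun q x => ?_, fun q x => ?_, fun q x => ?_, fun q Z x => ?_,
    fun q => ?_⟩
  · rw [Table.callState, h0]
    exact hcall q x 0 (by omega)
  · rw [Table.callStack, h0]
    exact hcall q x 1 (by omega)
  · rw [Table.intState, h0, h1, h3, entry, he, show 6 + 2 * a * n + (b * (q : ℕ) + x) =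
      hd.length + (tc.length + (b * q + x)) by rw [lc, hhd]; simp; ring, getD_append_add,
      getD_append_add, getD_append_of_lt _ _ _ _ (by
        rw [li]
        have := q.2
        calc b * (q : ℕ) + x < b * q + b := by have := x.2; omega
          _ = b * (q + 1) := by ring
          _ ≤ b * n := Nat.mul_le_mul_left _ this),
      hti, getD_flatMap_const _ _ b (fun q => by simp) _ _ (by simp) x.2]
    simp
  · have hx : c * (Z : ℕ) + x < k * c := by
      have := Z.2
      calc c * (Z : ℕ) + x < c * Z + c := by have := x.2; omega
        _ = c * (Z + 1) := by ring
        _ ≤ c * k := Nat.mul_le_mul_left _ this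
        _ = k * c := mul_comm _ _
    rw [Table.retState, h0, h1, h2, h3, h4, entry, he,
      show 6 + 2 * a * n + b * n + (k * c * (q : ℕ) + (c * Z + x)) =
      hd.length + (tc.length + (ti.length + (k * c * q + (c * Z + x)))) by
        rw [lc, li, hhd]; simp; ring, getD_append_add,
      getD_append_add, getD_append_add, getD_append_of_lt _ _ _ _ (by
        rw [lr]
        have := q.2
        calc k * c * (q : ℕ) + (c * Z + x) < k * c * q + k * c := by omega
          _ = k * c * (q + 1) := by ring
          _ ≤ k * c * n := Nat.mul_le_mul_left _ this),
      htr, getD_flatMap_const _ _ (k * c) (fun q => by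
        rw [length_flatMap_const _ _ c fun x => by simp, List.length_finRange, mul_comm]) _ _
        (by simp) hx,
      getD_flatMap_const _ _ c (fun q => by simp) _ _ (by simp) x.2]
    simp
  · rw [Table.isFinal, h0, h1, h2, h3, h4, entry, he,
      show 6 + 2 * a * n + b * n + k * c * n + (q : ℕ) =
      hd.length + (tc.length + (ti.length + (tr.length + q))) by
        rw [lc, li, lr, hhd]; simp; ring, getD_append_add,
      getD_append_add, getD_append_add, getD_append_add, htf]
    simp

/-! ### The relations behind the tables -/

namespace DVPM

variable {C I R Q Γ : Type}

/-- The run is cut at the return that removes `Z`. Up to there only symbols above `Z` are used,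
which matches one layer of `Bridge`. -/
theorem Reach.pop {M : DVPM C I R Q Γ} {u : List (Letter C I R)} {p q : Q} {Z : Γ} {σ τ : List Γ}
    (h : M.Reach u (p, τ ++ Z :: σ) (q, [])) :
    ∃ v t r z, M.Reach v (p, τ) (t, []) ∧ M.Reach z (M.ret t Z r, σ) (q, []) := by
  induction u generalizing p τ with
  | nil => simp [reach_iff] at h
  | cons x u ih =>
    obtain ⟨h1, h2⟩ := (M.reach_iff _ _ _).1 h
    obtain ⟨h1, h3⟩ := (fits_append _ [x] u).1 h1
    have hu : M.Reach u (M.next (p, τ ++ Z :: σ) x) (q, []) :=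
      (M.reach_iff _ _ _).2 ⟨by rw [length_next]; exact h3, h2⟩
    cases x with
    | call c =>
      obtain ⟨v, t, r, z, hv, hz⟩ := ih (τ := (M.call p c).2 :: τ) hu
      exact ⟨_, t, r, z, (M.reach_call p τ c).append hv, hz⟩
    | int i =>
      obtain ⟨v, t, r, z, hv, hz⟩ := ih hu
      have hi : M.Reach [.int i] (p, τ) (M.int p i, τ) := by simp [reach_iff, Fits, next]
      exact ⟨_, t, r, z, hi.append hv, hz⟩
    | ret r =>
      cases τ with
      | nil => exact ⟨[], p, r, u, by simp [reach_iff, Fits], hu⟩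
      | cons Y τ =>
        obtain ⟨v, t, r', z, hv, hz⟩ := ih (τ := τ) hu
        exact ⟨_, t, r', z, (M.reach_ret p Y τ r).append hv, hz⟩

end DVPM

namespace StairBuchiDVPA

variable {C I R Q Γ : Type}

/-- Well-matched words lead from `p` to `q`. -/
def Matched (A : StairBuchiDVPA C I R Q Γ) (p q : Q) : Prop := ∃ u b, A.Stair p u q [] b

/-- An internal letter or a minimally well-matched word leads from `p` to `q`. -/
def Edge (A : StairBuchiDVPA C I R Q Γ) (p q : Q) : Prop :=
  (∃ i, A.int p i = q) ∨ ∃ c t, A.Matched (A.call p c).1 t ∧ ∃ r, A.ret t (A.call p c).2 r = q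

/-- Some stack content is built up from `x` to `y` and removed from `y'` to `x'`, and `b` says
whether a final state occurs on a step of the first run. -/
def Bridge (A : StairBuchiDVPA C I R Q Γ) (x y y' x' : Q) (b : Prop) : Prop :=
  ∃ σ u z, A.Stair x u y σ b ∧ A.Reach z (y', σ) (x', [])

variable {A : StairBuchiDVPA C I R Q Γ}

theorem matched_iff {p q : Q} : A.Matched p q ↔ ∃ u, A.Reach u (p, []) (q, []) :=
  ⟨fun ⟨u, _, h⟩ => ⟨u, h.reach⟩, fun ⟨u, h⟩ => ⟨u, stair_of_reach h⟩⟩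

theorem Edge.stair {p q q' : Q} (h : A.Edge q q') {u σ b} (hs : A.Stair p u q σ b) :
    ∃ v, A.Stair p v q' σ (b ∨ q' ∈ A.final) := by
  rcases h with ⟨i, rfl⟩ | ⟨c, t, ⟨v, b', hv⟩, r, rfl⟩
  · exact ⟨_, hs.int i⟩
  · exact ⟨_, hs.nest c r hv⟩

theorem matched_induction {P : Q → Q → Prop} (refl : ∀ p, P p p)
    (int : ∀ p q i, P p q → P p (A.int q i))
    (nest : ∀ p q c t r, P p q → P (A.call q c).1 t → P p (A.ret t (A.call q c).2 r))
    {p q : Q} (h : A.Matched p q) : P p q := by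
  obtain ⟨u, b, h⟩ := h
  generalize hσ : ([] : List Γ) = σ at h
  induction h with
  | nil p => exact refl p
  | int i _ ih => exact int _ _ i (ih hσ)
  | call c => cases hσ
  | nest c r _ _ ih ih' => exact nest _ _ c _ r (ih hσ) (ih' rfl)

/-- No step lies strictly inside a factor, so a factor acts like an internal letter. This is the
form of the closure conditions in the tables. -/
theorem Stair.edge_induction {P : Q → Q → List Γ → Prop → Prop}
    (refl : ∀ p, P p p [] (p ∈ A.final))
    (edge : ∀ p q q' σ b, P p q σ b → A.Edge q q' → P p q' σ (b ∨ q' ∈ A.final))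
    (call : ∀ p q σ b c, P p q σ b →
      P p (A.call q c).1 ((A.call q c).2 :: σ) (b ∨ (A.call q c).1 ∈ A.final))
    {p u q σ b} (h : A.Stair p u q σ b) : P p q σ b := by
  induction h with
  | nil p => exact refl p
  | int i _ ih => exact edge _ _ _ _ _ ih (.inl ⟨i, rfl⟩)
  | call c _ ih => exact call _ _ _ _ c ih
  | nest c r _ h' ih _ => exact edge _ _ _ _ _ ih (.inr ⟨c, _, ⟨_, _, h'⟩, r, rfl⟩)

end StairBuchiDVPA

namespace Represents

variable {a b c n k : ℕ} {L : List ℕ}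
  {A : StairBuchiDVPA (Fin a) (Fin b) (Fin c) (Fin n) (Fin k)}

open StairBuchiDVPA

theorem isFinal_eq_one (h : Represents L A) (q : Fin n) :
    Table.isFinal L q = 1 ↔ q ∈ A.final := by
  rw [h.isFinal]; split_ifs <;> simp_all

theorem isFinal_eq_zero (h : Represents L A) (q : Fin n) :
    Table.isFinal L q = 0 ↔ q ∉ A.final := by
  rw [h.isFinal]; split_ifs <;> simp_all

theorem matched (h : Represents L A) (p q : Fin n) : Table.Matched L p q ↔ A.Matched p q := by
  simp only [Table.Matched, h.nState, h.nInt, h.nCall, h.nRet, bAll_iff, ifIn_iff, h.intState,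
    h.callState, h.callStack, h.retState]
  refine least_iff finProdFinEquiv.toEmbedding (fun i => A.Matched i.1 i.2) ?_ ?_ (p, q)
  · rintro S ⟨h1, h2⟩ ⟨p, q⟩ hpq
    exact matched_induction (P := fun p q : Fin n => InSet S (q + n * p)) h1
      (fun p q i hpq => (h2 p q hpq).1 i)
      (fun p q c t r hpq ht => (h2 p q hpq).2 c t ht r) hpq
  · intro S hS
    replace hS : ∀ p q : Fin n, InSet S (q + n * p) ↔ A.Matched p q := fun p q => hS (p, q)
    simp only [hS]
    refine ⟨fun p => ⟨_, _, .nil p⟩, fun p q ⟨u, b, hu⟩ => ⟨fun i => ⟨_, _, hu.int i⟩, ?_⟩⟩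
    rintro c t ⟨v, b', hv⟩ r
    exact ⟨_, _, hu.nest c r hv⟩

theorem edge (h : Represents L A) (p q : Fin n) : Table.Edge L p q ↔ A.Edge p q := by
  simp only [Table.Edge, h.nState, h.nInt, h.nCall, h.nRet, bEx_iff, h.intState,
    h.callState, h.callStack, h.retState, h.matched, Fin.val_inj, Edge]

theorem nonFinalMatched (h : Represents L A) (p q : Fin n) :
    Table.NonFinalMatched L p q ↔ ∃ u, A.Stair p u q [] False := by
  simp only [Table.NonFinalMatched, h.nState, bAll_iff, ifIn_iff, h.edge, h.isFinal_eq_one]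
  refine least_iff finProdFinEquiv.toEmbedding (fun i => ∃ u, A.Stair i.1 u i.2 [] False) ?_ ?_
    (p, q)
  · rintro S ⟨h1, h2⟩ ⟨p, q⟩ ⟨u, hu⟩
    refine Stair.edge_induction (P := fun (p q : Fin n) σ b => σ = [] → ¬ b → InSet S (q + n * p)) ?_ ?_ ?_
      hu rfl id
    · exact fun p _ hp => (h1 p).resolve_left hp
    · intro p q q' σ b ih he hσ hb
      exact ((h2 p q (ih hσ fun hb' => hb (.inl hb')) q').resolve_left (not_not.2 he)).resolve_left
        fun hq => hb (.inr hq)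
    · intro p q σ b c _ hσ
      cases hσ
  · intro S hS
    replace hS : ∀ p q : Fin n, InSet S (q + n * p) ↔ ∃ u, A.Stair p u q [] False :=
      fun p q => hS (p, q)
    simp only [hS]
    refine ⟨fun p => ?_, fun p q ⟨u, hu⟩ q' => ?_⟩
    · by_cases hp : p ∈ A.final
      · exact .inl hp
      · exact .inr ⟨_, (Stair.nil p).congr (iff_false_intro hp)⟩
    · by_cases he : A.Edge q q'
      · by_cases hq : q' ∈ A.final
        · exact .inr (.inl hq)
        · obtain ⟨v, hv⟩ := he.stair hu
          exact .inr (.inr ⟨v, hv.congr (by simp [hq])⟩)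
      · exact .inl he

theorem reachable (h : Represents L A) (q : Fin n) :
    Table.Reachable L q ↔ A.ReachableState q := by
  simp only [Table.Reachable, h.nState, h.nCall, bAll_iff, ifIn_iff, h.edge, h.init, h.callState]
  refine least_iff (Function.Embedding.refl (Fin n)) A.ReachableState ?_ ?_ q
  · rintro S ⟨h1, h2⟩ q ⟨u, σ, hu⟩
    obtain ⟨b, hs⟩ := stair_of_reach hu
    exact Stair.edge_induction (P := fun (p q : Fin n) σ b => InSet S p → InSet S q) (fun p hp => hp)
      (fun p q q' σ b ih he hp => ((h2 q (ih hp)).1 q').resolve_left (not_not.2 he))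
      (fun p q σ b c ih hp => (h2 q (ih hp)).2 c) hs h1
  · intro S hS
    replace hS : ∀ q : Fin n, InSet S q ↔ A.ReachableState q := hS
    simp only [hS]
    refine ⟨⟨_, _, (Stair.nil A.init).reach⟩, fun q ⟨u, σ, hu⟩ => ?_⟩
    obtain ⟨b, hs⟩ := stair_of_reach hu
    refine ⟨fun q' => ?_, fun c => ⟨_, _, (hs.call c).reach⟩⟩
    by_cases he : A.Edge q q'
    · exact .inr ((he.stair hs).imp fun v hv => ⟨_, hv.reach⟩)
    · exact .inl he

open Classical in
/-- The truth value of a proposition. -/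
noncomputable def flag (P : Prop) : Fin 2 := if P then 1 else 0

theorem flag_eq_one (P : Prop) : flag P = 1 ↔ P := by
  rw [flag]; split_ifs <;> simp_all

theorem flag_or (P P' : Prop) :
    max (flag P) (flag P') = flag (P ∨ P') := by
  by_cases hP : P <;> by_cases hP' : P' <;> simp [flag, hP, hP']

theorem flag_self (f : Fin 2) : flag (f = 1) = f := by
  fin_cases f <;> simp [flag]

theorem isFinal_eq_flag (h : Represents L A) (q : Fin n) :
    Table.isFinal L q = flag (q ∈ A.final) := by
  rw [h.isFinal, flag]; split_ifs <;> rfl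

/-- The numbering of quintuples. -/
def quintupleCode (n : ℕ) : (Fin n × Fin n × Fin n × Fin n × Fin 2) ≃
    Fin (n * (n * (n * (n * 2)))) :=
  ((Equiv.refl _).prodCongr (((Equiv.refl _).prodCongr (((Equiv.refl _).prodCongr
    finProdFinEquiv).trans finProdFinEquiv)).trans finProdFinEquiv)).trans finProdFinEquiv

theorem bridge (h : Represents L A) (x y y' x' : Fin n) (P : Prop) :
    Table.Bridge L x y y' x' (flag P) ↔ A.Bridge x y y' x' P := by
  have hc : ∀ (x y y' x' : Fin n) (f : Fin 2), Table.code L x y y' x' f =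
      quintupleCode n (x, y, y', x', f) := fun x y y' x' f => by
    simp only [Table.code, h.nState]; rfl
  have hm : ∀ f g : Fin 2, Nat.max f g = ((max f g : Fin 2) : ℕ) := by decide
  simp only [Table.Bridge, h.nState, h.nCall, h.nRet, bAll_iff, ifIn_iff, h.edge, h.matched,
    h.callState, h.callStack, h.retState, h.isFinal_eq_flag, Fin.val_inj, hm, hc]
  refine (least_iff (quintupleCode n).toEmbedding
    (fun i => A.Bridge i.1 i.2.1 i.2.2.1 i.2.2.2.1 (i.2.2.2.2 = 1)) ?_ ?_
    (x, y, y', x', flag P)).trans (by simp only [flag_eq_one])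
  · rintro S ⟨h1, h2⟩ ⟨x, y, y', x', f⟩ ⟨σ, u, z, hs, hz⟩
    -- The start `y'` and the word `z` of the way down must vary: each call on the way up prepends a
    -- matched word and a return to the way down.
    refine flag_self f ▸ Stair.edge_induction (P := fun (x y : Fin n) σ b => ∀ (y' : Fin n) z,
      A.Reach z (y', σ) (x', []) → InSet S (quintupleCode n (x, y, y', x', flag b))) ?_ ?_ ?_
      hs y' z hz
    · exact fun x y' z hz => (h1 x y' x').resolve_left (not_not.2 (matched_iff.2 ⟨z, hz⟩))
    · intro x y w σ b ih he y' z hz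
      rw [← flag_or]
      exact ((h2 x y y' x' _ (ih y' z hz)).1 w).resolve_left (not_not.2 he)
    · intro x y σ b d ih y' z hz
      obtain ⟨v, t, r, z, hv, hz⟩ := hz.pop (τ := [])
      rw [← flag_or]
      exact (((h2 x y _ x' _ (ih _ z hz)).2 d y' t r).resolve_left
        (not_not.2 (matched_iff.2 ⟨v, hv⟩))).resolve_left (not_not.2 rfl)
  · intro S hS
    replace hS : ∀ (x y y' x' : Fin n) (f : Fin 2), InSet S (quintupleCode n (x, y, y', x', f)) ↔
      A.Bridge x y y' x' (f = 1) := fun x y y' x' f => hS (x, y, y', x', f)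
    simp only [hS, flag_eq_one]
    refine ⟨fun x y' x' => ?_, fun x y y' x' f ⟨σ, u, z, hs, hz⟩ => ?_⟩
    · by_cases hM : A.Matched y' x'
      · obtain ⟨v, hv⟩ := matched_iff.1 hM
        exact .inr ⟨_, _, v, .nil x, hv⟩
      · exact .inl hM
    · have hf : ∀ P : Prop, max f (flag P) = 1 ↔ (f = 1 ∨ P) := fun P => by
        rw [← flag_self f, flag_or, flag_eq_one, flag_eq_one]
      simp only [hf]
      refine ⟨fun w => ?_, fun d w t r => ?_⟩
      · by_cases he : A.Edge y w
        · obtain ⟨v, hv⟩ := he.stair hs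
          exact .inr ⟨σ, v, z, hv, hz⟩
        · exact .inl he
      · by_cases hM : A.Matched w t
        · refine .inr (or_iff_not_imp_left.2 fun hr => ?_)
          obtain ⟨v, hv⟩ := matched_iff.1 hM
          obtain rfl := not_not.1 hr
          exact ⟨_, _, _, hs.call d, ((hv.frame _).append (A.reach_ret _ _ _ r)).append hz⟩
        · exact .inl hM

theorem prec (h : Represents L A) (p p' q q' : Fin n) :
    Table.Prec L p p' q q' ↔ A.Prec (p, p') (q, q') := by
  have h1 : ∀ x y y' x' : Fin n, Table.Bridge L x y y' x' 1 ↔ A.Bridge x y y' x' True :=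
    fun x y y' x' => by simpa [flag] using h.bridge x y y' x' True
  have h0 : ∀ x y y' x' : Fin n, Table.Bridge L x y y' x' 0 ↔ A.Bridge x y y' x' False :=
    fun x y y' x' => by simpa [flag] using h.bridge x y y' x' False
  simp only [Table.Prec, prec_iff, h.isFinal_eq_zero, h.nState, h.nCall, h.nRet, bEx_iff,
    h.callState, h.callStack, h.retState, h0, h1, h.nonFinalMatched, h.matched, Fin.val_inj]
  refine and_congr_right fun _ => and_congr_right fun _ => exists_congr fun p'' =>
    and_congr ?_ ?_
  · constructor
    · rintro ⟨c, t, r, ⟨σ, u, z, hs, hz⟩, hr⟩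
      exact ⟨c, u, σ, z, t, r, hs, hz, hr⟩
    · rintro ⟨c, u, σ, z, t, r, hs, hz, hr⟩
      exact ⟨c, t, r, ⟨σ, u, z, hs, hz⟩, hr⟩
  · rw [matched_iff]
    constructor
    · rintro ⟨⟨v₀, h2⟩, ⟨σ, w, y, h3, h4⟩, ⟨v₁, h5⟩⟩
      exact ⟨v₀, w, σ, v₁, y, h2, h3, h5, h4⟩
    · rintro ⟨v₀, w, σ, v₁, y, h2, h3, h5, h4⟩
      exact ⟨⟨v₀, h2⟩, ⟨σ, w, y, h3, h4⟩, ⟨v₁, h5⟩⟩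

/-- The numbering of pairs of states with a height. -/
def heightCode (n : ℕ) : (Fin n × Fin n × Fin (n * n + 1)) ≃ Fin (n * (n * (n * n + 1))) :=
  ((Equiv.refl _).prodCongr finProdFinEquiv).trans finProdFinEquiv

theorem heightGE (h : Represents L A) (q q' : Fin n) (m : ℕ) (hm : m ≤ n * n) :
    Table.HeightGE L q q' m ↔ A.HeightGE (q, q') m := by
  have hc : ∀ (q q' : Fin n) (m : Fin (n * n + 1)), Table.codeHeight L q q' m =
      heightCode n (q, q', m) := fun q q' m => by
    simp only [Table.codeHeight, h.nState]; rfl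
  simp only [Table.HeightGE, h.nState, bAll_iff, ifIn_iff, h.prec]
  refine Iff.trans (b := Least _ _ (heightCode n (q, q', ⟨m, Nat.lt_succ_of_le hm⟩) : ℕ))
    (by rw [← hc]) (least_iff (heightCode n).toEmbedding
    (fun i => A.HeightGE (i.1, i.2.1) i.2.2) ?_ ?_ (q, q', ⟨m, Nat.lt_succ_of_le hm⟩))
  · rintro S ⟨h1, h2⟩ ⟨q, q', m, hm⟩ hq
    have key : ∀ (x : Fin n × Fin n) (m : ℕ), A.HeightGE x m → m ≤ n * n →
        InSet S (Table.codeHeight L x.1 x.2 m) := by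
      intro x m hx
      induction hx with
      | one x => exact fun _ => h1 x.1 x.2
      | succ x y m hxy _ ih =>
        exact fun hm => (h2 x.1 x.2 ⟨m, hm⟩ (ih (by omega)) y.1 y.2).resolve_left (not_not.2 hxy)
    exact hc q q' ⟨m, hm⟩ ▸ key (q, q') m hq (by omega)
  · intro S hS
    replace hS : ∀ (q q' : Fin n) (m : ℕ), m ≤ n * n →
      (InSet S (Table.codeHeight L q q' m) ↔ A.HeightGE (q, q') m) := fun q q' m hm => by
        have := hS (q, q', ⟨m, Nat.lt_succ_of_le hm⟩)
        rw [Function.Embedding.coeFn_mk, ← hc] at this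
        exact this
    refine ⟨fun q q' => (hS q q' 1 ?_).2 (.one _), fun p p' m hp q q' => ?_⟩
    · exact Nat.one_le_iff_ne_zero.2 (Nat.mul_pos q.pos q.pos).ne'
    · by_cases hP : A.Prec (p, p') (q, q')
      · exact .inr ((hS q q' _ m.2).2 (.succ _ _ _ hP ((hS p p' _ m.2.le).1 hp)))
      · exact .inl hP

end Represents

/-! ### Computed heights -/

theorem bsum_ite_eq {M N : ℕ} (hN : N ≤ M) (P : ℕ → Prop) {_ : DecidablePred P}
    (hP : ∀ k < M, P k ↔ k < N) : bsum M (fun k => if P k then 1 else 0) = N := by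
  rw [bsum, ← Finset.card_filter, show (Finset.range M).filter P = Finset.range N by
    ext k
    simp only [Finset.mem_filter, Finset.mem_range]
    exact ⟨fun h => (hP k h.1).1 h.2, fun h => ⟨h.trans_le hN, (hP k (h.trans_le hN)).2 h⟩⟩,
    Finset.card_range]

theorem le_bsum_ite {M N : ℕ} (hN : N ≤ M) (P : ℕ → Prop) {_ : DecidablePred P}
    (hP : ∀ k < N, P k) : N ≤ bsum M (fun k => if P k then 1 else 0) := by
  rw [bsum, ← Finset.card_filter]
  calc N = (Finset.range N).card := (Finset.card_range N).symm
    _ ≤ _ := Finset.card_le_card fun k hk => by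
      rw [Finset.mem_range] at hk
      exact Finset.mem_filter.2 ⟨Finset.mem_range.2 (hk.trans_le hN), hP k hk⟩

namespace StairBuchiDVPA

variable {C I R Q Γ : Type}

theorem ht_le [Fintype Q] {A : StairBuchiDVPA C I R Q Γ}
    (hA : ∀ x : Q × Q, A.ReachableState x.1 → ¬ A.Prec x x) {x : Q × Q}
    (hx : A.ReachableState x.1) : A.ht x ≤ Fintype.card Q * Fintype.card Q :=
  csSup_le ⟨1, .one x⟩ fun _ hn => HeightGE.le_card hA hn hx

theorem heightGE_iff [Fintype Q] {A : StairBuchiDVPA C I R Q Γ}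
    (hA : ∀ x : Q × Q, A.ReachableState x.1 → ¬ A.Prec x x) {x : Q × Q}
    (hx : A.ReachableState x.1) (k : ℕ) : A.HeightGE x (k + 1) ↔ k < A.ht x := by
  have hb : BddAbove {n | A.HeightGE x n} := ⟨_, fun n hn => HeightGE.le_card hA hn hx⟩
  refine ⟨fun h => le_csSup hb h, fun h => ?_⟩
  exact HeightGE.of_le (Nat.sSup_mem ⟨1, .one x⟩ hb) (Nat.succ_pos k) h

end StairBuchiDVPA

namespace Represents

variable {a b c n k : ℕ} {L : List ℕ}
  {A : StairBuchiDVPA (Fin a) (Fin b) (Fin c) (Fin n) (Fin k)}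

open StairBuchiDVPA

theorem height_eq (h : Represents L A)
    (hA : ∀ x : Fin n × Fin n, A.ReachableState x.1 → ¬ A.Prec x x) {q q' : Fin n}
    (hq : A.ReachableState q) : Table.height L q q' = A.ht (q, q') := by
  rw [Table.height, h.nState]
  refine bsum_ite_eq (by simpa using ht_le hA (x := (q, q')) hq) _ fun m hm => ?_
  rw [h.heightGE _ _ _ hm, heightGE_iff hA hq]

theorem exists_pair_iff (h : Represents L A)
    (hA : ∀ x : Fin n × Fin n, A.ReachableState x.1 → ¬ A.Prec x x) {m : ℕ} (hm : m < n * n) :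
    (BEx n fun q => BEx n fun q' => Table.Reachable L q ∧ Table.isFinal L q = 0 ∧
      Table.isFinal L q' = 0 ∧ Table.HeightGE L q q' (m + 1)) ↔
    ∃ x : Fin n × Fin n, A.ReachableState x.1 ∧ x.1 ∉ A.final ∧ x.2 ∉ A.final ∧ m < A.ht x := by
  simp only [bEx_iff, h.reachable, h.isFinal_eq_zero, h.heightGE _ _ _ hm, Prod.exists]
  exact exists_congr fun q => exists_congr fun q' => and_congr_right fun hq => by
    rw [heightGE_iff hA (x := (q, q')) hq]

theorem ht_le_maxHeight (h : Represents L A)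
    (hA : ∀ x : Fin n × Fin n, A.ReachableState x.1 → ¬ A.Prec x x) {x : Fin n × Fin n}
    (hx : A.ReachableState x.1) (h1 : x.1 ∉ A.final) (h2 : x.2 ∉ A.final) :
    A.ht x ≤ Table.maxHeight L := by
  have hn : A.ht x ≤ n * n := by simpa using ht_le hA hx
  rw [Table.maxHeight, h.nState]
  exact le_bsum_ite hn _ fun m hm =>
    (h.exists_pair_iff hA (hm.trans_le hn)).2 ⟨x, hx, h1, h2, hm⟩

theorem maxHeight_eq (h : Represents L A)
    (hA : ∀ x : Fin n × Fin n, A.ReachableState x.1 → ¬ A.Prec x x)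
    (hr : ∀ q, A.ReachableState q) : Table.maxHeight L = A.maxHt := by
  have hb : ∀ m ∈ {m | ∃ x : Fin n × Fin n, x.1 ∉ A.final ∧ x.2 ∉ A.final ∧ m = A.ht x},
      m ≤ n * n := by
    rintro _ ⟨x, -, -, rfl⟩
    simpa using ht_le hA (hr x.1)
  rw [Table.maxHeight, h.nState]
  refine bsum_ite_eq (csSup_le' hb) _ fun m hm => ?_
  rw [h.exists_pair_iff hA hm]
  constructor
  · rintro ⟨x, -, h1, h2, hx⟩
    exact hx.trans_le (le_csSup ⟨_, hb⟩ ⟨x, h1, h2, rfl⟩)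
  · intro hm
    have hne : {m | ∃ x : Fin n × Fin n, x.1 ∉ A.final ∧ x.2 ∉ A.final ∧ m = A.ht x}.Nonempty :=
        Set.nonempty_iff_ne_empty.2 fun he => by
      rw [he] at hm
      simp at hm
    obtain ⟨x, h1, h2, hx⟩ := Nat.sSup_mem hne ⟨_, hb⟩
    exact ⟨x, hr _, h1, h2, hm.trans_eq hx⟩

/-- Computed heights agree with `ht` on pairs with a reachable first component, and `IsRank` asks
for nothing else. -/
theorem isRank (h : Represents L A)
    (hA : ∀ x : Fin n × Fin n, A.ReachableState x.1 → ¬ A.Prec x x) :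
    A.IsRank (Table.maxHeight L) fun x => Table.height L x.1 x.2 := by
  have ht := isRank_ht hA fun x hx h1 h2 => h.ht_le_maxHeight hA hx h1 h2
  have he : ∀ x : Fin n × Fin n, A.ReachableState x.1 → Table.height L x.1 x.2 = A.ht x :=
    fun x hx => h.height_eq hA hx
  refine ⟨fun x hx => ?_, fun x hx h1 h2 => ?_, fun x y hy hxy => ?_, fun y hy => ?_⟩
  · rw [he x hx]; exact ht.pos x hx
  · rw [he x hx]; exact ht.le x hx h1 h2
  · simp only [he y hy, he x (hxy.reachable hy)]; exact ht.lt x y hy hxy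
  · simp only [he y hy]
    exact (ht.exists_prec y hy).imp_right fun ⟨x, hxy, hx⟩ =>
      ⟨x, hxy, by simpa only [he x (hxy.reachable hy)] using hx⟩

end Represents

/-! ### Renaming and numbering of the simulating automaton -/

namespace ParityDVPA

variable {C I R Q Γ Q' Γ' : Type}

/-- Renaming of states and stack symbols. -/
def rename (B : ParityDVPA C I R Q Γ) (e : Q ≃ Q') (g : Γ ≃ Γ') : ParityDVPA C I R Q' Γ' where
  init := e B.init
  call q c := (e (B.call (e.symm q) c).1, g (B.call (e.symm q) c).2)
  int q i := e (B.int (e.symm q) i)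
  ret q Z r := e (B.ret (e.symm q) (g.symm Z) r)
  prio q := B.prio (e.symm q)

theorem rename_isomorphic (B : ParityDVPA C I R Q Γ) (e : Q ≃ Q') (g : Γ ≃ Γ') :
    (B.rename e g).Isomorphic B :=
  ⟨e.symm, g.symm, by simp [rename], by simp [rename], by simp [rename], by simp [rename],
    fun _ => rfl⟩

theorem Isomorphic.lang_eq {B : ParityDVPA C I R Q Γ} {B' : ParityDVPA C I R Q' Γ'}
    (h : B.Isomorphic B') : B.lang = B'.lang := by
  obtain ⟨e, g, h0, hc, hi, hr, hp⟩ := h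
  have hnext : ∀ s x, B'.next (e s.1, s.2.map g) x =
      (e (B.next s x).1, (B.next s x).2.map g) := by
    rintro ⟨q, σ⟩ (c | i | r)
    · simp [DVPM.next, hc]
    · simp [DVPM.next, hi]
    · cases σ <;> simp [DVPM.next, hr]
  have hrun : ∀ u s, B'.runOn (e s.1, s.2.map g) u =
      (e (B.runOn s u).1, (B.runOn s u).2.map g) := fun u => by
    induction u with
    | nil => exact fun s => rfl
    | cons x u ih => exact fun s => by rw [DVPM.runOn_cons, DVPM.runOn_cons, hnext, ih]
  have hconf : ∀ w n, (B'.confAt w n).1 = e (B.confAt w n).1 := fun w n => by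
    have := hrun (seg w 0 n) (B.init, [])
    rw [DVPM.confAt, DVPM.confAt, ← h0]
    exact congrArg Prod.fst this
  ext w
  rw [mem_lang_iff, mem_lang_iff]
  simp only [hconf, hp]

end ParityDVPA

theorem map_val_finRange (N : ℕ) : (List.finRange N).map Fin.val = List.range N :=
  List.ext_getElem (by simp) (by simp)

theorem rmap_eq {β : Type} {N : ℕ} {F : ℕ → β} {f : Fin N → β} (h : ∀ i : Fin N, F i = f i) :
    rmap N F = (List.finRange N).map f := by
  rw [_root_.rmap, ← map_val_finRange, List.map_map]
  exact List.map_congr_left fun i _ => h i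

theorem rflat_eq {β : Type} {N : ℕ} {F : ℕ → List β} {f : Fin N → List β}
    (h : ∀ i : Fin N, F i = f i) : rflat N F = (List.finRange N).flatMap f := by
  rw [rflat, ← map_val_finRange, List.flatMap_map]
  exact List.flatMap_congr fun i _ => h i

theorem bsum_eq {N : ℕ} {F : ℕ → ℕ} {f : Fin N → ℕ} (h : ∀ i : Fin N, F i = f i) :
    bsum N F = ∑ i, f i := by
  rw [bsum, ← Fin.sum_univ_eq_sum_range]
  exact Finset.sum_congr rfl fun i _ => h i

namespace StairBuchiDVPA

variable {C I R Q Γ : Type}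

/-- The numbering of the states of the simulating automaton. -/
def stateCode {n : ℕ} (A : StairBuchiDVPA C I R (Fin n) Γ) (H : ℕ) : A.CounterState H ≃
    Fin (n * ((A.bound + 1) ^ (H + 1) * 2 ^ (H + 1))) :=
  ((Equiv.refl _).prodCongr ((finFunctionFinEquiv.prodCongr finFunctionFinEquiv).trans
    finProdFinEquiv)).trans finProdFinEquiv

end StairBuchiDVPA

namespace Represents

variable {a b c n k : ℕ} {L : List ℕ}
  {A : StairBuchiDVPA (Fin a) (Fin b) (Fin c) (Fin n) (Fin k)}

open StairBuchiDVPA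

theorem bound (h : Represents L A) : Table.bound L = A.bound := by
  simp [Table.bound, h.nState, StairBuchiDVPA.bound]

/-- The equivalences composed in `stateCode` are positional number systems, and `Table.ofParts`
spells out the same numerals; hence the closing `rfl`. -/
theorem ofParts (h : Represents L A) (s : A.CounterState (Table.maxHeight L)) {χ f : ℕ → ℕ}
    (hχ : ∀ i : Fin _, χ i = s.2.1 i) (hf : ∀ i : Fin _, f i = s.2.2 i) :
    Table.ofParts L s.1 χ f = A.stateCode (Table.maxHeight L) s := by
  rw [Table.ofParts, bsum_eq fun i => congrArg (· * _) (hf i),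
    bsum_eq fun i => congrArg (· * _) (hχ i), Table.nCounter, Table.nFlag, h.bound]
  rfl

theorem stateOf (h : Represents L A) (s : Fin _) :
    Table.stateOf L s = ((A.stateCode (Table.maxHeight L)).symm s).1 := by
  rw [Table.stateOf, Table.nCounter, Table.nFlag, h.bound]
  rfl

theorem counterOf (h : Represents L A) (s : Fin _) (i : Fin _) :
    Table.counterOf L s i = ((A.stateCode (Table.maxHeight L)).symm s).2.1 i := by
  rw [Table.counterOf, Table.nCounter, Table.nFlag, h.bound]
  rfl

theorem flagOf (h : Represents L A) (s : Fin _) (i : Fin _) :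
    Table.flagOf L s i = ((A.stateCode (Table.maxHeight L)).symm s).2.2 i := by
  rw [Table.flagOf, Table.nCounter, Table.nFlag, h.bound]
  rfl

theorem successor (h : Represents L A) (q : Fin n) (s : Fin _) {inc : ℕ → Prop}
    {inc' : Fin (Table.maxHeight L + 1) → Prop} (hinc : ∀ i : Fin _, inc i ↔ inc' i) :
    Table.successor L q s inc = A.stateCode (Table.maxHeight L) (A.counterUpdate _ q
      ((A.stateCode _).symm s).2.1 ((A.stateCode _).symm s).2.2 inc') := by
  classical
  rw [Table.successor, counterUpdate]
  simp only [h.isFinal_eq_one]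
  split_ifs with hq
  · exact h.ofParts (q, _, _) (fun _ => by simp) fun _ => by simp
  · refine h.ofParts (q, _, _) (fun i => ?_) fun i => ?_
    · simp [h.counterOf, h.bound, hinc]
    · simp only [h.counterOf, h.bound, h.flagOf]
      split_ifs <;> rfl

theorem simPrio (h : Represents L A) (s : Fin _) :
    Table.simPrio L s = A.counterPrio _ ((A.stateCode (Table.maxHeight L)).symm s) := by
  classical
  rw [Table.simPrio, bsum_eq (f := fun i => if (((A.stateCode _).symm s).2.1 i : ℕ) = A.bound ∧
    ∀ j, (((A.stateCode _).symm s).2.1 j : ℕ) = A.bound → j ≤ i then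
      2 * (i : ℕ) + 1 + ((A.stateCode _).symm s).2.2 i else 0) fun i => by
    simp only [bAll_iff, h.counterOf, h.flagOf, h.bound, Fin.val_fin_lt]
    congr 1
    refine propext (and_congr_right fun _ => forall_congr' fun j => ?_)
    rw [← not_lt]; tauto]
  generalize (A.stateCode _).symm s = s
  rcases counterPrio_cases s with ⟨h1, h2⟩ | ⟨d, h1, h2, h3⟩
  · rw [h1]
    exact Finset.sum_eq_zero fun i _ => if_neg fun hi => h2 i hi.1
  · rw [h3, Finset.sum_eq_single d, if_pos ⟨h1, h2⟩]
    · exact fun i _ hi => if_neg fun hi' => hi (le_antisymm (h2 i hi'.1) (hi'.2 d h1))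
    · exact fun hd => absurd (Finset.mem_univ d) hd

end Represents

namespace StairBuchiDVPA

variable {C I R Γ : Type}

/-- The numbering of the stack symbols of the simulating automaton. -/
def stackCode {n k : ℕ} (A : StairBuchiDVPA C I R (Fin n) Γ) (H : ℕ) :
    Fin k × A.CounterState H ≃ Fin (k * (n * ((A.bound + 1) ^ (H + 1) * 2 ^ (H + 1)))) :=
  ((Equiv.refl _).prodCongr (A.stateCode H)).trans finProdFinEquiv

/-- The simulating automaton with numbered states and stack symbols. -/
noncomputable def codedSim {a b c n k : ℕ}
    (A : StairBuchiDVPA (Fin a) (Fin b) (Fin c) (Fin n) (Fin k)) (H : ℕ) (t : Fin n × Fin n → ℕ) :=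
  (A.counterSim H t).rename (A.stateCode H) (A.stackCode H)

end StairBuchiDVPA

namespace Represents

variable {a b c n k : ℕ} {L : List ℕ}
  {A : StairBuchiDVPA (Fin a) (Fin b) (Fin c) (Fin n) (Fin k)}

open StairBuchiDVPA

theorem nSim (h : Represents L A) : Table.nSim L =
    n * ((A.bound + 1) ^ (Table.maxHeight L + 1) * 2 ^ (Table.maxHeight L + 1)) := by
  rw [Table.nSim, Table.nCounter, Table.nFlag, h.bound, h.nState]

theorem simCall (h : Represents L A) (s : Fin _) (x : Fin a) :
    Table.simCall L s x =
      ((A.codedSim (Table.maxHeight L) fun x => Table.height L x.1 x.2).call s x).1 := by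
  rw [Table.simCall, h.stateOf, h.callState]
  exact h.successor _ s fun i => Fin.val_eq_zero_iff

theorem simCallStack (h : Represents L A) (s : Fin _) (x : Fin a) :
    Table.simCallStack L s x =
      ((A.codedSim (Table.maxHeight L) fun x => Table.height L x.1 x.2).call s x).2 := by
  rw [Table.simCallStack, h.stateOf, h.callStack, h.nSim]
  simp [codedSim, ParityDVPA.rename, counterSim, stackCode]

theorem simInt (h : Represents L A) (s : Fin _) (x : Fin b) :
    Table.simInt L s x =
      (A.codedSim (Table.maxHeight L) fun x => Table.height L x.1 x.2).int s x := by
  rw [Table.simInt, h.stateOf, h.intState]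
  exact h.successor _ s fun i => Fin.val_eq_zero_iff

theorem simRet (h : Represents L A) (s : Fin _) (Y : Fin _) (x : Fin c) :
    Table.simRet L s Y x =
      (A.codedSim (Table.maxHeight L) fun x => Table.height L x.1 x.2).ret s Y x := by
  have h1 : (Y : ℕ) / Table.nSim L = Y.divNat := by rw [h.nSim]; rfl
  have h2 : (Y : ℕ) % Table.nSim L = Y.modNat := by rw [h.nSim]; rfl
  rw [Table.simRet, h1, h2, h.stateOf, h.stateOf, h.retState]
  refine h.successor _ Y.modNat fun i => ?_
  rw [h.isFinal_eq_zero]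
  rfl

theorem build_eq (h : Represents L A) : Table.build L =
    (A.codedSim (Table.maxHeight L) fun x => Table.height L x.1 x.2).encode := by
  have h0 : Table.ofParts L (Table.init L) (fun _ => 0) (fun _ => 1) =
      (A.codedSim (Table.maxHeight L) fun x => Table.height L x.1 x.2).init := by
    rw [h.init]
    exact h.ofParts (A.init, fun _ => 0, fun _ => 1) (fun _ => by simp) fun _ => by simp
  rw [Table.build, ParityDVPA.encode, DVPM.encode, h0, h.nCall, h.nInt, h.nRet, h.nStack, h.nSim,
    rmap_eq h.simPrio]
  rw [rflat_eq fun q => rflat_eq fun x => congrArg₂ (fun y z => [y, z]) (h.simCall q x)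
      (h.simCallStack q x),
    rflat_eq fun q => rmap_eq fun x => h.simInt q x,
    rflat_eq fun q => rflat_eq fun Z => rmap_eq fun x => h.simRet q Z x]
  rfl

end Represents

/-! ### The main theorem -/

theorem mainTheorem5 :
    ∃ construct : List ℕ → List ℕ, Computable construct ∧
      ∀ (a b c n k : ℕ) (A : StairBuchiDVPA (Fin a) (Fin b) (Fin c) (Fin n) (Fin k)),
        (∃ (n₀ k₀ : ℕ) (B₀ : ParityDVPA (Fin a) (Fin b) (Fin c) (Fin n₀) (Fin k₀)),
          B₀.lang = A.lang) →
        ∃ (n' k' : ℕ) (B : ParityDVPA (Fin a) (Fin b) (Fin c) (Fin n') (Fin k')),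
          construct A.encode = B.encode ∧ B.lang = A.lang ∧
          ((∀ q, A.ReachableState q) → B.Isomorphic A.sim) := by
  refine ⟨Table.build, PrimrecTools.build.to_comp, fun a b c n k A ⟨n₀, k₀, B₀, hB₀⟩ => ?_⟩
  have h := represents_encode A
  -- This is the only place where the given parity automaton enters.
  have hA : ∀ x : Fin n × Fin n, A.ReachableState x.1 → ¬ A.Prec x x := fun x hx =>
    StairBuchiDVPA.not_prec_self hB₀ hx
  have hiso := (A.counterSim (Table.maxHeight A.encode) fun x =>
    Table.height A.encode x.1 x.2).rename_isomorphic (A.stateCode _) (A.stackCode _)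
  refine ⟨_, _, A.codedSim _ _, h.build_eq, ?_, fun hr => ?_⟩
  · exact hiso.lang_eq.trans (StairBuchiDVPA.counterSim_lang (h.isRank hA))
  · have ht : (fun x : Fin n × Fin n => Table.height A.encode x.1 x.2) = A.ht :=
      funext fun x => h.height_eq hA (hr x.1)
    rw [ht, h.maxHeight_eq hA hr] at hiso ⊢
    exact hiso
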